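/- **Setting.** Let $G=(V,E)$ be a finite simple graph with maximum degree at most $\Delta\ge 2$. A PEPS on $G$ with bond dimension $D\ge 1$ and physical dimension $d$ is a family of linear maps $T_v:\bigotimes_{n\in\mathcal N(v)}\mathbb C^D\to\mathbb C^d$, $v\in V$; contracting the virtual legs along the edges gives the state $|\psi\rangle$. It is $\delta$-injective if all singular values of every $T_v$ lie in $[\delta,1]$; put $\varepsilon:=1-\delta^2$ and $\varepsilon_*:=1/(2\Delta-1)$, and take $0<\delta<1$. For a family $\mu=(\mu_{\vec e})$ of positive semidefinite trace-one $D\times D$ matrices on the directed edges, let $f_{(v,n)}(\mu)$ be the matrix obtained by contracting the double-layer tensor $T_v\star\bar T_v$ with $\mu_{(m,v)}$ on all legs $m\in\mathcal N(v)\setminus\{n\}$; $\mu$ is a BP fixed point if $\mu_{\vec e}=f_{\vec e}(\mu)/\operatorname{Tr}f_{\vec e}(\mu)$ for all $\vec e$. A perturbation of the PEPS on $A\subseteq V$ is a PEPS $(T'_v)$ (with state $|\psi'\rangle$) such that $T'_v=T_v$ for $v\notin A$ and $\|T_v-T'_v\|_\infty\le(\varepsilon_*-\varepsilon)/4$ for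 $v\in A$. A loop is a connected subgraph $\ell$ all of whose vertices have degree at least $2$ in it, and $|\ell|$ is its number of edges. Given a fixed point $\mu$, write $\langle X,Y\rangle=\sum_{ij}X_{ij}Y_{ij}$ and $I_e=\langle\mu_{\vec e},\mu_{\overleftarrow e}\rangle$, and let $Z^{(v)}$ be the contraction of $T_v\star\bar T_v$ with $\mu_{(n,v)}/\sqrt{I_{vn}}$ on all legs $n\in\mathcal N(v)$. The loop activity $Z_\ell$ is the contraction of the network $\langle\psi|\psi\rangle$, with each vertex tensor divided by $Z^{(v)}$, where on each edge $e\notin\ell$ the projector $P_e$ onto the BP messages, $P_{\{v,w\}}=\mu_{(w,v)}\otimes\mu_{(v,w)}/I_e$, is inserted, and on each edge $e\in\ell$ the projector $\mathbb 1-P_e$. The PEPS has decay of loops with rate $c$ if all $I_e>0$, all $Z^{(v)}\ne0$, and $|Z_\ell|\le e^{-c|\ell|}$ for all loops $\ell$. Let $c_0:=\log(2e\Delta)+\tfrac12$. **Theorem (algorithmic locality).** Fix $\Delta\ge2$ and $D\ge1$. 1. *(Fixed points.)* There is $C>0$ depending only on $\Delta,D$ such that for every $\delta$-injective PEPS with $\varepsilon<\varepsilon_*$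 and every perturbation of it on a region $A$ as above, both PEPS have exactly one BP fixed point, $\mu_\star$ and $\mu'_\star$ respectively, and for every directed edge $\vec e=(v,n)$ and every integer $r\ge0$ with $d(v,A)\ge r$, $$\|\mu'_{\star,\vec e}-\mu_{\star,\vec e}\|_1\le C\,q^{r}\le C\,e^{-r/\xi_*},\qquad q=\frac{2(\Delta-1)\varepsilon}{1-\varepsilon},\quad \frac1{\xi_*}=\log\frac{\varepsilon_*}{\varepsilon}.$$ 2. *(Expectation values.)* There is a threshold $\varepsilon_{**}>0$ depending only on $\Delta,D$, with $$\varepsilon_{**}<\varepsilon_*,\qquad \varepsilon_{**}\le\min\Big\{\tfrac{D^{\Delta/2-2}}{2(D+2)}\tfrac{e^{-\Delta/4}}{(2e\Delta)^{\Delta/2}},\tfrac1{1+2\sqrt D},\tfrac1D\Big\},$$ such that: (a) there is $c>c_0$ depending only on $\Delta,D$ such that every $\delta$-injective PEPS with $\varepsilon<\varepsilon_{**}$ has decay of loops with rate $c$; (b) for every $c>c_0$ and every $b\in\mathbb N$ there is $C>0$ depending only on $\Delta,D,c,b$ such that for every $\delta$-injective PEPS with $\varepsilon<\varepsilon_{**}$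 that has decay of loops with rate $c$, every perturbation of it on a region $A$ as above, every $B\subseteq V$ with $|B|\le b$, every operator $O_B$ supported on $B$ and every integer $R\ge0$ with $d(A,B)\ge R$, the vectors $|\psi\rangle,|\psi'\rangle$ are non-zero and $$\left|\frac{\langle\psi'|O_B|\psi'\rangle}{\langle\psi'|\psi'\rangle}-\frac{\langle\psi|O_B|\psi\rangle}{\langle\psi|\psi\rangle}\right|\le C\,\|O_B\|_\infty\,e^{-R/\xi_{**}},\qquad \frac1{\xi_{**}}=\tfrac12\min\Big\{\frac1{\xi_*},\,c-c_0\Big\}.$$ -/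

import Mathlib

open scoped Matrix.Norms.L2Operator

universe u

namespace BPLocality

noncomputable section

/-! ### Matrix quantities -/

/-- The Schatten 1-norm (sum of the singular values) of a matrix on `ℂ^D`. -/
def traceNorm {D : ℕ} (X : Matrix (Fin D) (Fin D) ℂ) : ℝ :=
  ∑ i ∈ Finset.range D, (Matrix.toEuclideanLin X).singularValues i

/-- All singular values of `T`, viewed as a map from the virtual space (columns) to the physical
space (rows), lie in `[δ, 1]`. There is one singular value per dimension of the virtual space. -/
def IsInjectiveTensor {m n : Type*} [Fintype m] [Fintype n] [DecidableEq n]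
    (δ : ℝ) (T : Matrix m n ℂ) : Prop :=
  ∀ i < Fintype.card n,
    δ ≤ (Matrix.toEuclideanLin T).singularValues i ∧
      (Matrix.toEuclideanLin T).singularValues i ≤ 1

section Network

variable {V : Type u} [Fintype V] [DecidableEq V] (G : SimpleGraph V) [DecidableRel G.Adj]

/-! ### PEPS -/

/-- A PEPS on `G` with bond dimension `D` and physical dimension `d`: for every vertex `v` a linear
map from the virtual space `⨂_{n ∈ N(v)} ℂ^D` to the physical space `ℂ^d`, written as a matrix
whose columns are indexed by one index in `Fin D` for each neighbour of `v`. -/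
abbrev PEPS (D d : ℕ) : Type _ :=
  ∀ v : V, Matrix (Fin d) (G.neighborSet v → Fin D) ℂ

variable {G} {D d : ℕ}

/-- A PEPS is `δ`-injective if all its local tensors are. -/
def IsInjectivePEPS (δ : ℝ) (T : PEPS G D d) : Prop :=
  ∀ v, IsInjectiveTensor δ (T v)

/-- The state vector of the PEPS: every edge carries one index, shared by the two legs that it
joins, and all these indices are summed over. -/
def stateVec (T : PEPS G D d) (s : V → Fin d) : ℂ :=
  ∑ x : G.edgeSet → Fin D, ∏ v, T v (s v) fun n => x ⟨s(v, n), G.mem_edgeSet.2 n.2⟩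

/-- The operator `O ⊗ 1` on the whole system, for `O` acting on the sites of `B`. -/
def localOp (B : Finset V) (O : Matrix (B → Fin d) (B → Fin d) ℂ) :
    Matrix (V → Fin d) (V → Fin d) ℂ :=
  fun s s' => if ∀ v, v ∉ B → s v = s' v then O (fun b => s b) (fun b => s' b) else 0

/-- The expectation value `⟨ψ|O_B|ψ⟩ / ⟨ψ|ψ⟩`. -/
def expectation (T : PEPS G D d) (B : Finset V) (O : Matrix (B → Fin d) (B → Fin d) ℂ) : ℂ :=
  (star (stateVec T) ⬝ᵥ (localOp B O).mulVec (stateVec T)) / (star (stateVec T) ⬝ᵥ stateVec T)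

/-! ### Belief propagation -/

/-- The double-layer tensor `T_v ⋆ T̄_v`, with ket indices `x` and bra indices `y`. -/
def doubleTensor (T : PEPS G D d) (v : V) (x y : G.neighborSet v → Fin D) : ℂ :=
  ∑ s, T v s x * star (T v s y)

/-- The directed edge `(v, n)`. -/
def outDart (v : V) (n : G.neighborSet v) : G.Dart := ⟨(v, n), n.2⟩

/-- The directed edge `(n, v)`. -/
def inDart (v : V) (n : G.neighborSet v) : G.Dart := (outDart v n).symm

variable (G D) in
/-- A configuration of messages: a matrix on the bond space of every directed edge. -/
abbrev Messages : Type _ := G.Dart → Matrix (Fin D) (Fin D) ℂ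

open scoped ComplexOrder in
/-- The product space `𝒦_G` of positive semidefinite, trace-one messages. -/
def IsNormalized (μ : Messages G D) : Prop :=
  ∀ e, (μ e).PosSemidef ∧ (μ e).trace = 1

/-- The unnormalized message sent along the directed edge `e = (v, n)`: the superoperator
`Φ_(v,n)` applied to the product of the messages `μ_(m,v)`, `m ∈ N(v) \ {n}`. -/
def rawUpdate (T : PEPS G D d) (μ : Messages G D) : Messages G D :=
  fun e i j =>
    ∑ x : G.neighborSet e.fst → Fin D, ∑ y : G.neighborSet e.fst → Fin D,
      if x ⟨e.snd, e.adj⟩ = i ∧ y ⟨e.snd, e.adj⟩ = j then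
        doubleTensor T e.fst x y *
          ∏ m ∈ Finset.univ.erase (⟨e.snd, e.adj⟩ : G.neighborSet e.fst),
            μ (inDart e.fst m) (x m) (y m)
      else 0

/-- The normalized message-passing map `F`. -/
def update (T : PEPS G D d) (μ : Messages G D) : Messages G D :=
  fun e => (rawUpdate T μ e).trace⁻¹ • rawUpdate T μ e

/-- `μ ∈ 𝒦_G` is a BP fixed point of the PEPS. -/
def IsFixedPoint (T : PEPS G D d) (μ : Messages G D) : Prop :=
  IsNormalized μ ∧ update T μ = μ

/-! ### Loop activities

A message on `(v, w)` and one on `(w, v)` are paired by contracting their ket indices with each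
other and their bra indices with each other, exactly as the edge `{v, w}` of the norm network
`⟨ψ|ψ⟩` does. For positive semidefinite messages this pairing is a nonnegative real number. -/

/-- The overlap `I_e` of the two messages on an edge. -/
def overlap (μ : Messages G D) (e : G.Dart) : ℝ :=
  (∑ i, ∑ j, μ e i j * μ e.symm i j).re

/-- The local BP contribution `Z^(v)`: the double-layer tensor at `v` contracted with the incoming
messages `μ_(n,v) / √I_{vn}`. -/
def bpVertex (T : PEPS G D d) (μ : Messages G D) (v : V) : ℂ :=
  ∑ x : G.neighborSet v → Fin D, ∑ y : G.neighborSet v → Fin D,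
    doubleTensor T v x y *
      ∏ n, (μ (inDart v n) (x n) (y n) / (Real.sqrt (overlap μ (inDart v n)) : ℂ))

/-- Matrix element of the projector onto the BP messages on an edge `e = (v, w)`: the index pair
`(x e, y e)` on the leg at `v` meets the message from `w`, and conversely. -/
def bpProj (μ : Messages G D) (x y : G.Dart → Fin D) (e : G.Dart) : ℂ :=
  μ e.symm (x e) (y e) * μ e (x e.symm) (y e.symm) / (overlap μ e : ℂ)

/-- Matrix element on an edge of the complementary projector `1 - (BP projector)`. -/
def excProj (μ : Messages G D) (x y : G.Dart → Fin D) (e : G.Dart) : ℂ :=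
  (if x e = x e.symm ∧ y e = y e.symm then 1 else 0) - bpProj μ x y e

open Classical in
/-- The matrix inserted on an edge: the excitation projector if the edge lies in `S`, and the
projector onto the BP messages otherwise. -/
def dartWeight (μ : Messages G D) (S : Set (Sym2 V)) (x y : G.Dart → Fin D) (e : G.Dart) : ℂ :=
  if e.edge ∈ S then excProj μ x y e else bpProj μ x y e

theorem dartWeight_symm (μ : Messages G D) (S : Set (Sym2 V)) (x y : G.Dart → Fin D)
    (e : G.Dart) : dartWeight μ S x y e.symm = dartWeight μ S x y e := by
  have h1 : overlap μ e.symm = overlap μ e := by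
    simp only [overlap, SimpleGraph.Dart.symm_symm, mul_comm]
  have h2 : bpProj μ x y e.symm = bpProj μ x y e := by
    simp only [bpProj, SimpleGraph.Dart.symm_symm, h1, mul_comm]
  have h3 : excProj μ x y e.symm = excProj μ x y e := by
    simp only [excProj, SimpleGraph.Dart.symm_symm, h2, eq_comm]
  have h4 : e.symm.edge = e.edge := SimpleGraph.Dart.edge_symm e
  unfold dartWeight
  rw [h2, h3, h4]

/-- `dartWeight` as a function of the undirected edge. -/
def edgeWeight (μ : Messages G D) (S : Set (Sym2 V)) (x y : G.Dart → Fin D) : Sym2 V → ℂ :=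
  Sym2.lift ⟨fun v w => if h : G.Adj v w then dartWeight μ S x y ⟨(v, w), h⟩ else 1, by
    intro v w
    beta_reduce
    by_cases h : G.Adj v w
    · rw [dif_pos h, dif_pos h.symm]
      exact (dartWeight_symm μ S x y ⟨(v, w), h⟩).symm
    · rw [dif_neg h, dif_neg fun h' => h h'.symm]⟩

/-- A loop: a connected subgraph (with at least one vertex) all of whose degrees are at least 2. -/
def IsLoop (ℓ : G.Subgraph) : Prop :=
  ℓ.Connected ∧ ∀ v ∈ ℓ.verts, 2 ≤ (ℓ.neighborSet v).ncard

/-- The number of edges of a subgraph. -/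
def loopSize (ℓ : G.Subgraph) : ℕ := ℓ.edgeSet.ncard

/-- The loop activity `Z_ℓ`: the norm network, each vertex tensor divided by `Z^(v)`, contracted
with excitation projectors on the edges of `ℓ` and BP projectors on all other edges. -/
def loopActivity (T : PEPS G D d) (μ : Messages G D) (ℓ : G.Subgraph) : ℂ :=
  ∑ x : G.Dart → Fin D, ∑ y : G.Dart → Fin D,
    (∏ v, doubleTensor T v (fun n => x (outDart v n)) (fun n => y (outDart v n)) /
        bpVertex T μ v) *
      ∏ e ∈ G.edgeFinset, edgeWeight μ ℓ.edgeSet x y e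

/-- Decay of loops with rate `c`, with respect to the messages `μ`: the BP normalization is
meaningful and `|Z_ℓ| ≤ e^{-c|ℓ|}` for all loops `ℓ`. -/
def LoopDecay (T : PEPS G D d) (μ : Messages G D) (c : ℝ) : Prop :=
  (∀ e, 0 < overlap μ e) ∧ (∀ v, bpVertex T μ v ≠ 0) ∧
    ∀ ℓ : G.Subgraph, IsLoop ℓ → ‖loopActivity T μ ℓ‖ ≤ Real.exp (-(c * loopSize ℓ))

/-! ### Perturbations and distances -/

variable (G) in
/-- Graph distance between two sets of vertices (`⊤` if there is no path between them). -/
def setDist (A B : Set V) : ℕ∞ := ⨅ a ∈ A, ⨅ b ∈ B, G.edist a b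

/-- `T'` differs from `T` only at the vertices of `A`, and there by at most `η` in operator norm
(virtual legs are the input, the physical leg is the output). -/
def IsPerturbation (A : Set V) (η : ℝ) (T T' : PEPS G D d) : Prop :=
  (∀ v, v ∉ A → T' v = T v) ∧ ∀ v ∈ A, ‖T v - T' v‖ ≤ η

end Network

/-! ### Thresholds and rates -/

/-- `ε = 1 - δ²`. -/
def deviation (δ : ℝ) : ℝ := 1 - δ ^ 2

/-- `ε_* = 1 / (2Δ - 1)`. -/
def epsStar (Δ : ℕ) : ℝ := 1 / (2 * Δ - 1)

/-- The contraction constant `q = 2(Δ - 1)(1 - δ²) / δ²`. -/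
def contractionConst (Δ : ℕ) (δ : ℝ) : ℝ := 2 * (Δ - 1) * (1 - δ ^ 2) / δ ^ 2

/-- `c_0 = log(2eΔ) + 1/2`. -/
def cZero (Δ : ℕ) : ℝ := Real.log (2 * Real.exp 1 * Δ) + 1 / 2

/-- The inverse length `1/ξ_* = log(ε_*/ε)`. -/
def invXiStar (Δ : ℕ) (δ : ℝ) : ℝ := Real.log (epsStar Δ / deviation δ)

/-- The inverse length `1/ξ_** = min{1/ξ_*, c - c_0} / 2`. -/
def invXiStarStar (Δ : ℕ) (δ c : ℝ) : ℝ := min (invXiStar Δ δ) (c - cZero Δ) / 2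

/-- The scaling bound for the loop-decay threshold `ε_**`. -/
def loopScale (Δ D : ℕ) : ℝ :=
  min ((D : ℝ) ^ ((Δ : ℝ) / 2 - 2) / (2 * (D + 2)) *
        (Real.exp (-(Δ : ℝ) / 4) / (2 * Real.exp 1 * Δ) ^ ((Δ : ℝ) / 2)))
    (min (1 / (1 + 2 * Real.sqrt D)) (1 / D))

end

end BPLocality

open BPLocality

/-!
The argument uses `δ`-injectivity only through the Loewner bounds `lo ≤ T_vᴴ T_v ≤ hi`
(`HasBounds`), with `lo = δ²`, `hi = 1` for the PEPS itself and `lo = (δ - η)²`, `hi = (1 + η)²`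
for its perturbation, `η = (ε_* - ε) / 4`.

*Fixed points.* The identity tensor turns normalized messages into the identity matrix, whatever
the messages are. Hence changing one incoming message changes the outgoing one only through the
positive remainder `hi - T_vᴴ T_v ≤ hi - lo`, and after normalization message passing contracts, in
the trace norm and per incoming leg, by `2 (hi - lo) / lo` (`traceNorm_contract_update_sub_le`,
`traceNorm_outMessage_sub_le`). With `Δ - 1` incoming legs the total constant is `q < 1` exactly
when `ε < ε_*`, which gives existence and uniqueness (`existsUnique_isFixedPoint`). Off `A` the two
fixed points are images under the same contraction, so each step towards `A` gains a factor `q`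
(`traceNorm_fixedPoint_sub_le`).

*Decay of loops.* For small `ε` all messages of a fixed point are close to the maximally mixed
state. The projectors on the edges of a loop are idempotent, so the loop activity factorizes over
the vertices (`loopActivity_eq_sum`). At a vertex of the loop the tensor is nearly the identity,
which is nearly annihilated by the projectors `1 - P_e`, so each such vertex contributes a factor
`O(ε)` (`norm_loopVertex_le`). A loop of size `|ℓ|` has at least `|ℓ| / Δ` vertices, and any rate
is reached for `ε` small enough (`loopDecay_of_isFixedPoint`).

*Expectation values.* The difference of the two expectation values is, up to normalization, the
contraction of two replicas of the norm network, one for `T` and one for `T'`, with a seed on `B`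
that is odd under the exchange of the replicas. Off `A` the doubled tensors are invariant under
this exchange and, up to `O(ε)`, equal to the identity, which is even invariant under the exchange
on each leg separately. The tensors next to the seed are expanded around the identity. If the
identity is chosen at all of them, exchanging the replicas inside shows that the term vanishes;
otherwise the seed grows by at least one vertex at a cost `O(ε)`. This is iterated until `A` is
reached (`ReplicaNetwork.peel`, `norm_expectation_sub_le`). All terms are dominated by the doubled
norm network itself, since the kernels involved are positive semidefinite and the Schur product
theorem makes pointwise products monotone. The estimate only needs `ε` to be small in terms of `Δ`.
The resulting rate `log (1 / (K ε))` is at least half of `1/ξ_*` once `K² ε ≤ 1`.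
-/

namespace BPLocality

noncomputable section

open Matrix
open scoped ComplexOrder MatrixOrder

/-! ### Singular values and Loewner bounds -/

/-- The singular value decomposition of `T` as an expansion of `‖T u‖²` in the
eigenbasis of `T† T`. -/
theorem norm_sq_apply_eq_sum_singularValues {E F : Type*} [NormedAddCommGroup E]
    [InnerProductSpace ℂ E] [FiniteDimensional ℂ E] [NormedAddCommGroup F]
    [InnerProductSpace ℂ F] [FiniteDimensional ℂ F] (T : E →ₗ[ℂ] F) {n : ℕ}
    (hn : Module.finrank ℂ E = n) (u : E) :
    ‖T u‖ ^ 2 = ∑ i : Fin n, (T.singularValues i) ^ 2 *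
      ‖inner ℂ (T.isSymmetric_adjoint_comp_self.eigenvectorBasis hn i) u‖ ^ 2 := by
  set b := T.isSymmetric_adjoint_comp_self.eigenvectorBasis hn with hb
  have h1 : ((‖T u‖ : ℂ)) ^ 2 = inner ℂ u ((T.adjoint ∘ₗ T) u) := by
    rw [LinearMap.comp_apply, LinearMap.adjoint_inner_right]
    exact (inner_self_eq_norm_sq_to_K (𝕜 := ℂ) (T u)).symm
  have h2 : ∀ i, inner ℂ (b i) ((T.adjoint ∘ₗ T) u)
      = ((T.singularValues i ^ 2 : ℝ) : ℂ) * inner ℂ (b i) u := by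
    intro i
    rw [← T.isSymmetric_adjoint_comp_self (b i) u, hb,
      LinearMap.IsSymmetric.apply_eigenvectorBasis, inner_smul_left, T.sq_singularValues_fin hn i]
    simp
  have h3 := b.sum_inner_mul_inner u ((T.adjoint ∘ₗ T) u)
  rw [← h1] at h3
  have h4 : ((‖T u‖ ^ 2 : ℝ) : ℂ) = ((∑ i : Fin n, (T.singularValues i) ^ 2 *
      ‖inner ℂ (b i) u‖ ^ 2 : ℝ) : ℂ) := by
    push_cast
    rw [← h3]
    refine Finset.sum_congr rfl fun i _ => ?_
    rw [h2 i, ← inner_conj_symm u (b i), mul_left_comm, Complex.conj_mul']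
    push_cast
    ring
  exact_mod_cast h4

theorem IsInjectiveTensor.norm_bounds {m n : Type*} [Fintype m] [Fintype n] [DecidableEq n]
    {δ : ℝ} (hδ : 0 ≤ δ) {T : Matrix m n ℂ} (h : IsInjectiveTensor δ T)
    (u : EuclideanSpace ℂ n) :
    δ * ‖u‖ ≤ ‖toEuclideanLin T u‖ ∧ ‖toEuclideanLin T u‖ ≤ ‖u‖ := by
  have hn : Module.finrank ℂ (EuclideanSpace ℂ n) = Fintype.card n := by simp
  have h1 := norm_sq_apply_eq_sum_singularValues (toEuclideanLin T) hn u
  set b := (toEuclideanLin T).isSymmetric_adjoint_comp_self.eigenvectorBasis hn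
  have h2 : ‖u‖ ^ 2 = ∑ i, ‖inner ℂ (b i) u‖ ^ 2 := (b.sum_sq_norm_inner_right u).symm
  constructor
  · refine le_of_sq_le_sq ?_ (norm_nonneg _)
    rw [mul_pow, h1, h2, Finset.mul_sum]
    gcongr with i
    exact (h i i.2).1
  · refine le_of_sq_le_sq ?_ (norm_nonneg _)
    rw [h1, h2]
    refine Finset.sum_le_sum fun i _ => mul_le_of_le_one_left (by positivity) ?_
    exact pow_le_one₀ (LinearMap.singularValues_nonneg _ _) (h i i.2).2

/-- The Loewner bounds `lo ≤ Tᴴ T ≤ hi`. -/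
def HasBounds {m n : Type*} [Fintype m] [DecidableEq n] (lo hi : ℝ) (T : Matrix m n ℂ) : Prop :=
  (Tᴴ * T - (lo : ℂ) • 1).PosSemidef ∧ ((hi : ℂ) • 1 - Tᴴ * T).PosSemidef

theorem posSemidef_ofReal_smul {n : Type*} {M : Matrix n n ℂ} (hM : M.PosSemidef) {a : ℝ}
    (ha : 0 ≤ a) : ((a : ℂ) • M).PosSemidef :=
  hM.smul (by exact_mod_cast ha)

theorem star_dotProduct_self_eq {n : Type*} [Fintype n] (x : n → ℂ) :
    star x ⬝ᵥ x = ((‖WithLp.toLp 2 x‖ ^ 2 : ℝ) : ℂ) := by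
  rw [EuclideanSpace.norm_sq_eq]
  simp [dotProduct, Complex.conj_mul']

theorem isHermitian_smul_one {n : Type*} [DecidableEq n] (a : ℝ) :
    ((a : ℂ) • (1 : Matrix n n ℂ)).IsHermitian := by
  simp [IsHermitian, conjTranspose_smul]

theorem HasBounds.mono {m n : Type*} [Fintype m] [DecidableEq n] {lo hi lo' hi' : ℝ}
    {T : Matrix m n ℂ} (h : HasBounds lo hi T) (h1 : lo' ≤ lo) (h2 : hi ≤ hi') :
    HasBounds lo' hi' T := by
  constructor
  · have := h.1.add (posSemidef_ofReal_smul (PosSemidef.one (n := n)) (sub_nonneg.2 h1))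
    convert this using 1
    push_cast
    rw [sub_smul]
    abel
  · have := h.2.add (posSemidef_ofReal_smul (PosSemidef.one (n := n)) (sub_nonneg.2 h2))
    convert this using 1
    push_cast
    rw [sub_smul]
    abel

section

variable {m n : Type*} [Fintype m] [Fintype n] [DecidableEq n]

theorem star_dotProduct_conjTranspose_mul (T : Matrix m n ℂ) (x : n → ℂ) :
    star x ⬝ᵥ ((Tᴴ * T) *ᵥ x) = ((‖toEuclideanLin T (WithLp.toLp 2 x)‖ ^ 2 : ℝ) : ℂ) := by
  rw [← mulVec_mulVec, dotProduct_mulVec, ← star_mulVec, star_dotProduct_self_eq]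
  rfl

theorem hasBounds_of_norm_bounds {a b : ℝ} (ha : 0 ≤ a) {T : Matrix m n ℂ}
    (h : ∀ u : EuclideanSpace ℂ n,
      a * ‖u‖ ≤ ‖toEuclideanLin T u‖ ∧ ‖toEuclideanLin T u‖ ≤ b * ‖u‖) :
    HasBounds (a ^ 2) (b ^ 2) T := by
  have hT : (Tᴴ * T).IsHermitian := isHermitian_conjTranspose_mul_self T
  constructor
  · refine PosSemidef.of_dotProduct_mulVec_nonneg (hT.sub (isHermitian_smul_one _)) fun x => ?_
    rw [sub_mulVec, dotProduct_sub, star_dotProduct_conjTranspose_mul, smul_mulVec, one_mulVec,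
      dotProduct_smul, star_dotProduct_self_eq, smul_eq_mul, ← Complex.ofReal_mul,
      ← Complex.ofReal_sub]
    have := pow_le_pow_left₀ (by positivity) (h (WithLp.toLp 2 x)).1 2
    rw [mul_pow] at this
    exact_mod_cast sub_nonneg.2 this
  · refine PosSemidef.of_dotProduct_mulVec_nonneg ((isHermitian_smul_one _).sub hT) fun x => ?_
    rw [sub_mulVec, dotProduct_sub, star_dotProduct_conjTranspose_mul, smul_mulVec, one_mulVec,
      dotProduct_smul, star_dotProduct_self_eq, smul_eq_mul, ← Complex.ofReal_mul,
      ← Complex.ofReal_sub]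
    have := pow_le_pow_left₀ (by positivity) (h (WithLp.toLp 2 x)).2 2
    rw [mul_pow] at this
    exact_mod_cast sub_nonneg.2 this

theorem IsInjectiveTensor.hasBounds {δ : ℝ} (hδ : 0 ≤ δ) {T : Matrix m n ℂ}
    (h : IsInjectiveTensor δ T) : HasBounds (δ ^ 2) 1 T := by
  have := hasBounds_of_norm_bounds (b := 1) hδ (T := T) fun u => by
    simpa using h.norm_bounds hδ u
  simpa using this

/-- A tensor at operator-norm distance at most `η` from a `δ`-injective one has its singular
values in `[δ - η, 1 + η]`. -/
theorem IsInjectiveTensor.hasBounds_of_norm_sub_le {δ η : ℝ} (hη : 0 ≤ η) (hδ : η ≤ δ)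
    {T T' : Matrix m n ℂ} (h : IsInjectiveTensor δ T) (hT : ‖T - T'‖ ≤ η) :
    HasBounds ((δ - η) ^ 2) ((1 + η) ^ 2) T' := by
  refine hasBounds_of_norm_bounds (by linarith) fun u => ?_
  have h1 := h.norm_bounds (hη.trans hδ) u
  have h2 : ‖toEuclideanLin T u - toEuclideanLin T' u‖ ≤ η * ‖u‖ := by
    rw [← LinearMap.sub_apply, ← map_sub]
    exact (l2_opNorm_mulVec (T - T') u).trans (by gcongr)
  have h3 := abs_le.1 ((abs_norm_sub_norm_le _ _).trans h2)
  constructor <;> linarith [h3.1, h3.2]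

theorem posSemidef_norm_smul_one_sub {A : Matrix n n ℂ} (hA : A.IsHermitian) {a : ℝ}
    (ha : ‖A‖ ≤ a) : ((a : ℂ) • 1 - A).PosSemidef := by
  refine PosSemidef.of_dotProduct_mulVec_nonneg ((isHermitian_smul_one _).sub hA) fun x => ?_
  have him : (star x ⬝ᵥ (A *ᵥ x)).im = 0 := by
    have := hA.im_star_dotProduct_mulVec_self x
    simpa using this
  have hre : (star x ⬝ᵥ (A *ᵥ x)).re ≤ a * ‖WithLp.toLp 2 x‖ ^ 2 := by
    have h1 : star x ⬝ᵥ (A *ᵥ x)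
        = inner ℂ (WithLp.toLp 2 x) (WithLp.toLp 2 (A *ᵥ x)) := by
      rw [EuclideanSpace.inner_eq_star_dotProduct, dotProduct_comm]
    rw [h1]
    refine (Complex.re_le_norm _).trans ((norm_inner_le_norm _ _).trans ?_)
    have h2 : ‖WithLp.toLp 2 (A *ᵥ x)‖ ≤ ‖A‖ * ‖WithLp.toLp 2 x‖ :=
      l2_opNorm_mulVec A (WithLp.toLp 2 x)
    calc _ ≤ ‖WithLp.toLp 2 x‖ * (a * ‖WithLp.toLp 2 x‖) := by
          gcongr
          exact h2.trans (by gcongr)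
      _ = _ := by ring
  rw [sub_mulVec, dotProduct_sub, smul_mulVec, one_mulVec, dotProduct_smul,
    star_dotProduct_self_eq, smul_eq_mul, ← Complex.ofReal_mul, Complex.le_def]
  refine ⟨?_, ?_⟩
  · simp only [Complex.zero_re, Complex.sub_re, Complex.ofReal_re]
    linarith
  · simp only [Complex.zero_im, Complex.sub_im, Complex.ofReal_im, him, sub_zero]

/-- A linear functional that is nonnegative on positive semidefinite matrices is bounded by twice
its value at the identity (the factor 2 comes from splitting into Hermitian and skew-Hermitian
parts). -/
theorem norm_positive_functional_le (f : Matrix n n ℂ →ₗ[ℂ] ℂ)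
    (hf : ∀ A : Matrix n n ℂ, A.PosSemidef → 0 ≤ f A) (O : Matrix n n ℂ) :
    ‖f O‖ ≤ 2 * ‖O‖ * (f 1).re := by
  have key : ∀ A : Matrix n n ℂ, A.IsHermitian → ‖A‖ ≤ ‖O‖ → ‖f A‖ ≤ ‖O‖ * (f 1).re := by
    intro A hA hn
    have h1 := hf _ (posSemidef_norm_smul_one_sub hA hn)
    have h2 := hf _ (posSemidef_norm_smul_one_sub hA.neg ((norm_neg A).trans_le hn))
    rw [map_sub, map_smul, smul_eq_mul, Complex.le_def] at h1 h2
    rw [map_neg] at h2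
    simp only [Complex.zero_re, Complex.sub_re, Complex.mul_re, Complex.ofReal_re,
      Complex.ofReal_im, zero_mul, sub_zero, Complex.zero_im, Complex.sub_im, Complex.mul_im,
      Complex.neg_re, Complex.neg_im, add_zero] at h1 h2
    have him : (f A).im = 0 := by linarith [h1.2, h2.2]
    have : f A = ((f A).re : ℂ) := Complex.ext rfl (by simp [him])
    rw [this, Complex.norm_real, Real.norm_eq_abs, abs_le]
    constructor <;> linarith [h1.1, h2.1]
  have hstar : ‖Oᴴ‖ = ‖O‖ := l2_opNorm_conjTranspose O
  have hH : ‖(2⁻¹ : ℂ) • (O + Oᴴ)‖ ≤ ‖O‖ := by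
    rw [norm_smul]
    have := norm_add_le O Oᴴ
    norm_num
    linarith
  have hK : ‖(-Complex.I * 2⁻¹ : ℂ) • (O - Oᴴ)‖ ≤ ‖O‖ := by
    rw [norm_smul]
    have := norm_sub_le O Oᴴ
    norm_num
    linarith
  have h1 := key _ (by
    simp [IsHermitian, conjTranspose_smul, conjTranspose_add, add_comm]) hH
  have h2 := key _ (by
    simp only [IsHermitian, conjTranspose_smul, conjTranspose_sub, conjTranspose_conjTranspose]
    rw [← neg_sub O Oᴴ, smul_neg, ← neg_smul]
    congr 1
    simp) hK
  have hO : O = (2⁻¹ : ℂ) • (O + Oᴴ) + Complex.I • ((-Complex.I * 2⁻¹ : ℂ) • (O - Oᴴ)) := by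
    rw [smul_smul, ← mul_assoc, mul_neg, Complex.I_mul_I, neg_neg, one_mul, ← smul_add]
    rw [add_add_sub_cancel, ← two_smul ℂ O, smul_smul]
    norm_num
  calc ‖f O‖ = ‖f ((2⁻¹ : ℂ) • (O + Oᴴ))
        + Complex.I * f ((-Complex.I * 2⁻¹ : ℂ) • (O - Oᴴ))‖ := by
        conv_lhs => rw [hO, map_add, map_smul f Complex.I, smul_eq_mul]
    _ ≤ _ := by
        refine (norm_add_le _ _).trans ?_
        rw [norm_mul, Complex.norm_I, one_mul]
        linarith

end

/-! ### The trace norm of Hermitian matrices -/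

section TraceNorm

variable {D : ℕ}

/-- The eigenvalues of `X† X` as an operator and as a matrix agree up to the order of the index
set. -/
theorem sum_eigenvalues_adjoint_comp (X : Matrix (Fin D) (Fin D) ℂ) (f : ℝ → ℝ) :
    ∑ i : Fin D, f ((toEuclideanLin X).isSymmetric_adjoint_comp_self.eigenvalues
        (by simp) i)
      = ∑ i, f ((isHermitian_conjTranspose_mul_self X).eigenvalues i) := by
  have hS : (toEuclideanLin X).adjoint ∘ₗ toEuclideanLin X = toEuclideanLin (Xᴴ * X) := by
    rw [← toEuclideanLin_conjTranspose_eq_adjoint]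
    ext1 x
    simp [toLpLin_apply, mulVec_mulVec]
  -- Generalizing over the operators allows to substitute along the equality `hS`.
  have hgen : ∀ (S S' : EuclideanSpace ℂ (Fin D) →ₗ[ℂ] EuclideanSpace ℂ (Fin D))
      (h : S.IsSymmetric) (h' : S'.IsSymmetric) (k : ℕ)
      (hk : Module.finrank ℂ (EuclideanSpace ℂ (Fin D)) = D)
      (hk' : Module.finrank ℂ (EuclideanSpace ℂ (Fin D)) = k), S = S' →
      ∑ i : Fin D, f (h.eigenvalues hk i) = ∑ i : Fin k, f (h'.eigenvalues hk' i) := by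
    intro S S' h h' k hk hk' hSS
    subst hSS
    obtain rfl : k = D := hk'.symm.trans hk
    rfl
  rw [hgen _ _ _ (isSymmetric_toEuclideanLin_iff.2 (isHermitian_conjTranspose_mul_self X))
    (Fintype.card (Fin D)) (by simp) (by simp) hS]
  unfold IsHermitian.eigenvalues IsHermitian.eigenvalues₀
  exact (Equiv.sum_comp (Fintype.equivOfCardEq (Fintype.card_fin _)).symm _).symm

/-- The Schatten 1-norm of a Hermitian matrix is the sum of the absolute values of its
eigenvalues. -/
theorem traceNorm_eq_sum_abs_eigenvalues {X : Matrix (Fin D) (Fin D) ℂ} (hX : X.IsHermitian) :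
    traceNorm X = ∑ i, |hX.eigenvalues i| := by
  have h1 : traceNorm X
      = ∑ i, Real.sqrt ((isHermitian_conjTranspose_mul_self X).eigenvalues i) := by
    rw [← sum_eigenvalues_adjoint_comp X Real.sqrt]
    unfold traceNorm
    rw [Finset.sum_range]
    exact Finset.sum_congr rfl fun i _ => LinearMap.singularValues_fin _ _ i
  have hsq : Xᴴ * X = Unitary.conjStarAlgAut ℂ _ hX.eigenvectorUnitary
      (diagonal fun i => ((hX.eigenvalues i ^ 2 : ℝ) : ℂ)) := by
    rw [hX.eq]
    conv_lhs => rw [hX.spectral_theorem, ← map_mul, diagonal_mul_diagonal]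
    congr 2
    ext i
    simp [sq]
  have hroots : (Multiset.map
      (fun i => (((isHermitian_conjTranspose_mul_self X).eigenvalues i : ℝ) : ℂ))
      Finset.univ.val) = Multiset.map (fun i => ((hX.eigenvalues i ^ 2 : ℝ) : ℂ))
        Finset.univ.val := by
    have h2 := (isHermitian_conjTranspose_mul_self X).roots_charpoly_eq_eigenvalues
    have h3 : (Xᴴ * X).charpoly
        = ∏ i, (Polynomial.X - Polynomial.C ((hX.eigenvalues i ^ 2 : ℝ) : ℂ)) := by
      rw [hsq, Unitary.conjStarAlgAut_apply, charpoly_mul_comm, ← mul_assoc]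
      simp [charpoly_diagonal]
    rw [h3, Polynomial.roots_prod _ _
      (Finset.prod_ne_zero_iff.2 fun i _ => Polynomial.X_sub_C_ne_zero _)]
      at h2
    simp only [Polynomial.roots_X_sub_C, Multiset.bind_singleton] at h2
    exact h2.symm
  have h4 := congrArg (fun s : Multiset ℂ => (s.map fun z => Real.sqrt z.re).sum) hroots
  simp only [Multiset.map_map, Function.comp_def, Complex.ofReal_re, Real.sqrt_sq_eq_abs] at h4
  rw [h1]
  exact h4

theorem diagonal_eigenvalues_eq {X : Matrix (Fin D) (Fin D) ℂ} (hX : X.IsHermitian) :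
    (hX.eigenvectorUnitary : Matrix (Fin D) (Fin D) ℂ)ᴴ * X * hX.eigenvectorUnitary
      = diagonal fun i => (hX.eigenvalues i : ℂ) := by
  have := hX.conjStarAlgAut_star_eigenvectorUnitary
  rw [Unitary.conjStarAlgAut_apply] at this
  simpa [star_eq_conjTranspose, Function.comp_def] using this

theorem trace_unitary_conj (U : unitaryGroup (Fin D) ℂ) (P : Matrix (Fin D) (Fin D) ℂ) :
    ((U : Matrix (Fin D) (Fin D) ℂ)ᴴ * P * U).trace = P.trace := by
  rw [trace_mul_cycle, ← star_eq_conjTranspose, Unitary.mul_star_self_of_mem U.2, one_mul]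

/-- Any splitting of a matrix into a difference of positive semidefinite ones bounds its trace
norm. -/
theorem traceNorm_sub_le {P N : Matrix (Fin D) (Fin D) ℂ} (hP : P.PosSemidef)
    (hN : N.PosSemidef) : traceNorm (P - N) ≤ P.trace.re + N.trace.re := by
  have hX : (P - N).IsHermitian := hP.1.sub hN.1
  rw [traceNorm_eq_sum_abs_eigenvalues hX]
  set U := hX.eigenvectorUnitary
  have hP' := hP.conjTranspose_mul_mul_same (U : Matrix (Fin D) (Fin D) ℂ)
  have hN' := hN.conjTranspose_mul_mul_same (U : Matrix (Fin D) (Fin D) ℂ)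
  have hd := diagonal_eigenvalues_eq hX
  rw [mul_sub, sub_mul] at hd
  rw [← trace_unitary_conj U P, ← trace_unitary_conj U N, trace, trace, Complex.re_sum,
    Complex.re_sum, ← Finset.sum_add_distrib]
  refine Finset.sum_le_sum fun i _ => ?_
  have h1 := congrArg Complex.re (congrFun (congrFun hd i) i)
  rw [diagonal_apply_eq, Matrix.sub_apply, Complex.sub_re, Complex.ofReal_re] at h1
  have h2 := (Complex.le_def.1 (hP'.diag_nonneg (i := i))).1
  have h3 := (Complex.le_def.1 (hN'.diag_nonneg (i := i))).1
  simp only [Complex.zero_re] at h2 h3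
  simp only [diag_apply]
  rw [← h1, abs_le]
  constructor <;> linarith

/-- The Jordan decomposition of a Hermitian matrix attains the bound of `traceNorm_sub_le`. -/
theorem exists_posSemidef_sub {X : Matrix (Fin D) (Fin D) ℂ} (hX : X.IsHermitian) :
    ∃ P N : Matrix (Fin D) (Fin D) ℂ, P.PosSemidef ∧ N.PosSemidef ∧ X = P - N ∧
      P.trace.re + N.trace.re = traceNorm X := by
  set U := hX.eigenvectorUnitary
  have hpsd : ∀ g : ℝ → ℝ, (∀ x, 0 ≤ g x) →
      (Unitary.conjStarAlgAut ℂ _ U (diagonal fun i => (g (hX.eigenvalues i) : ℂ))).PosSemidef := by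
    intro g hg
    rw [Unitary.conjStarAlgAut_apply, star_eq_conjTranspose]
    exact PosSemidef.mul_mul_conjTranspose_same
      (posSemidef_diagonal_iff.2 fun i => by exact_mod_cast hg (hX.eigenvalues i)) _
  have htr : ∀ g : ℝ → ℝ,
      (Unitary.conjStarAlgAut ℂ _ U (diagonal fun i => (g (hX.eigenvalues i) : ℂ))).trace.re
        = ∑ i, g (hX.eigenvalues i) := by
    intro g
    rw [Unitary.conjStarAlgAut_apply, trace_mul_cycle, Unitary.coe_star_mul_self, one_mul,
      trace_diagonal, Complex.re_sum]
    simp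
  refine ⟨_, _, hpsd (fun x => x⁺) (fun x => posPart_nonneg x), hpsd (fun x => x⁻)
    (fun x => negPart_nonneg x), ?_, ?_⟩
  · rw [← map_sub, diagonal_sub]
    conv_lhs => rw [hX.spectral_theorem]
    congr 2
    ext i
    simp only [Function.comp_apply, ← Complex.ofReal_sub, posPart_sub_negPart]
    rfl
  · rw [htr, htr, traceNorm_eq_sum_abs_eigenvalues hX, ← Finset.sum_add_distrib]
    exact Finset.sum_congr rfl fun i _ => posPart_add_negPart _

theorem traceNorm_nonneg (X : Matrix (Fin D) (Fin D) ℂ) : 0 ≤ traceNorm X :=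
  Finset.sum_nonneg fun _ _ => LinearMap.singularValues_nonneg _ _

theorem traceNorm_add_le {X Y : Matrix (Fin D) (Fin D) ℂ} (hX : X.IsHermitian)
    (hY : Y.IsHermitian) : traceNorm (X + Y) ≤ traceNorm X + traceNorm Y := by
  obtain ⟨P, N, hP, hN, rfl, h1⟩ := exists_posSemidef_sub hX
  obtain ⟨P', N', hP', hN', rfl, h2⟩ := exists_posSemidef_sub hY
  have := traceNorm_sub_le (hP.add hP') (hN.add hN')
  rw [trace_add, trace_add, Complex.add_re, Complex.add_re] at this
  rw [← h1, ← h2, sub_add_sub_comm]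
  linarith

theorem traceNorm_le_trace {P : Matrix (Fin D) (Fin D) ℂ} (hP : P.PosSemidef) :
    traceNorm P ≤ P.trace.re := by
  simpa using traceNorm_sub_le hP PosSemidef.zero

/-- A positive semidefinite matrix is a Gram matrix, so this is the inequality `2 a b ≤ a² + b²`. -/
theorem two_mul_norm_entry_le {n : Type*} [Fintype n] {P : Matrix n n ℂ} (hP : P.PosSemidef)
    (i j : n) : 2 * ‖P i j‖ ≤ (P i i).re + (P j j).re := by
  classical
  obtain ⟨R, rfl⟩ : ∃ R : Matrix n n ℂ, P = Rᴴ * R :=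
    CStarAlgebra.nonneg_iff_eq_star_mul_self.1 (nonneg_iff_posSemidef.2 hP)
  have hd : ∀ k, ((Rᴴ * R) k k).re = ∑ l, ‖R l k‖ ^ 2 := by
    intro k
    rw [mul_apply, Complex.re_sum]
    refine Finset.sum_congr rfl fun l _ => ?_
    rw [conjTranspose_apply, Complex.star_def, Complex.conj_mul']
    exact_mod_cast Complex.ofReal_re _
  rw [hd, hd, mul_apply, ← Finset.sum_add_distrib]
  refine (mul_le_mul_of_nonneg_left (norm_sum_le _ _) zero_le_two).trans ?_
  rw [Finset.mul_sum]
  refine Finset.sum_le_sum fun l _ => ?_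
  rw [norm_mul, conjTranspose_apply, norm_star]
  nlinarith [sq_nonneg (‖R l i‖ - ‖R l j‖)]

theorem norm_entry_le_trace {P : Matrix (Fin D) (Fin D) ℂ} (hP : P.PosSemidef) (i j : Fin D) :
    ‖P i j‖ ≤ P.trace.re := by
  have h1 := two_mul_norm_entry_le hP i j
  have hd : ∀ k, (P k k).re ≤ P.trace.re := by
    intro k
    rw [trace, Complex.re_sum]
    exact Finset.single_le_sum (f := fun k => (P k k).re)
      (fun k _ => (Complex.le_def.1 hP.diag_nonneg).1) (Finset.mem_univ k)
  linarith [hd i, hd j]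

theorem norm_entry_le_traceNorm {X : Matrix (Fin D) (Fin D) ℂ} (hX : X.IsHermitian)
    (i j : Fin D) : ‖X i j‖ ≤ traceNorm X := by
  obtain ⟨P, N, hP, hN, rfl, h1⟩ := exists_posSemidef_sub hX
  rw [← h1]
  exact (norm_sub_le _ _).trans (add_le_add (norm_entry_le_trace hP i j)
    (norm_entry_le_trace hN i j))

theorem norm_entry_le_of_le_smul_one {n : Type*} [Fintype n] [DecidableEq n] {P : Matrix n n ℂ}
    {a : ℝ} (hP : P.PosSemidef) (ha : ((a : ℂ) • 1 - P).PosSemidef) (i j : n) : ‖P i j‖ ≤ a := by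
  have h1 := two_mul_norm_entry_le hP i j
  have hd : ∀ k, (P k k).re ≤ a := by
    intro k
    have := (Complex.le_def.1 (ha.diag_nonneg (i := k))).1
    simpa using this
  linarith [hd i, hd j]

end TraceNorm

/-! ### Positive semidefinite kernels -/

section Kernel

variable {Y : Type*}

theorem prod_kernel_apply {ι : Type*} (s : Finset ι) (K : ι → Y → Y → ℂ) (x y : Y) :
    (∏ i ∈ s, K i) x y = ∏ i ∈ s, K i x y := by
  rw [Finset.prod_apply, Finset.prod_apply]

/-- A kernel is positive semidefinite if it is so as a matrix. Kernels are multiplied pointwise, so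
`IsPSD K → IsPSD L → IsPSD (K * L)` is the Schur product theorem. -/
def IsPSD (K : Y → Y → ℂ) : Prop := (Matrix.of K).PosSemidef

theorem IsPSD.add {K L : Y → Y → ℂ} (hK : IsPSD K) (hL : IsPSD L) : IsPSD (K + L) :=
  PosSemidef.add hK hL

theorem IsPSD.mul {K L : Y → Y → ℂ} (hK : IsPSD K) (hL : IsPSD L) : IsPSD (K * L) :=
  PosSemidef.hadamard hK hL

theorem IsPSD.smul {K : Y → Y → ℂ} (hK : IsPSD K) {a : ℝ} (ha : 0 ≤ a) : IsPSD ((a : ℂ) • K) :=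
  posSemidef_ofReal_smul hK ha

theorem isPSD_one [Finite Y] : IsPSD (1 : Y → Y → ℂ) := by
  have := posSemidef_vecMulVec_self_star (1 : Y → ℂ)
  unfold IsPSD
  convert this using 1
  ext i j
  simp [vecMulVec]

theorem isPSD_zero : IsPSD (0 : Y → Y → ℂ) := PosSemidef.zero

theorem isPSD_prod [Finite Y] {ι : Type*} {s : Finset ι} {K : ι → Y → Y → ℂ}
    (h : ∀ i ∈ s, IsPSD (K i)) :
    IsPSD (∏ i ∈ s, K i) := by
  classical
  induction s using Finset.induction_on with
  | empty => simpa using isPSD_one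
  | insert a s ha ih =>
    rw [Finset.prod_insert ha]
    exact (h a (by simp)).mul (ih fun i hi => h i (by simp [hi]))

/-- Pointwise products of positive semidefinite kernels are monotone in the Loewner order. -/
theorem IsPSD.mul_sub_mul {K L K' L' : Y → Y → ℂ} (hK : IsPSD K) (h : IsPSD (L - K))
    (hK' : IsPSD K') (h' : IsPSD (L' - K')) : IsPSD (L * L' - K * K') := by
  have hL' : IsPSD L' := by simpa using h'.add hK'
  have : L * L' - K * K' = (L - K) * L' + K * (L' - K') := by ring
  rw [this]
  exact (h.mul hL').add (hK.mul h')

theorem isPSD_prod_sub_prod [Finite Y] {ι : Type*} {s : Finset ι} {K L : ι → Y → Y → ℂ}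
    (hK : ∀ i ∈ s, IsPSD (K i)) (h : ∀ i ∈ s, IsPSD (L i - K i)) :
    IsPSD (∏ i ∈ s, L i - ∏ i ∈ s, K i) := by
  classical
  induction s using Finset.induction_on with
  | empty => simpa using isPSD_zero
  | insert a s ha ih =>
    rw [Finset.prod_insert ha, Finset.prod_insert ha]
    exact (hK a (by simp)).mul_sub_mul (h a (by simp))
      (isPSD_prod fun i hi => hK i (by simp [hi]))
      (ih (fun i hi => hK i (by simp [hi])) fun i hi => h i (by simp [hi]))

theorem isPSD_smul_prod_sub_prod [Finite Y] {ι : Type*} {s : Finset ι} {K L : ι → Y → Y → ℂ} {a : ℝ}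
    (hK : ∀ i ∈ s, IsPSD (K i)) (h : ∀ i ∈ s, IsPSD ((a : ℂ) • L i - K i)) :
    IsPSD (((a ^ s.card : ℝ) : ℂ) • ∏ i ∈ s, L i - ∏ i ∈ s, K i) := by
  have := isPSD_prod_sub_prod hK h
  have h2 : ∏ i ∈ s, (a : ℂ) • L i = ((a ^ s.card : ℝ) : ℂ) • ∏ i ∈ s, L i := by
    rw [Finset.prod_smul]
    simp
  rwa [h2] at this

variable [Fintype Y]

/-- The sum of all entries of a kernel. Tensor-network contractions are totals of pointwise
products of kernels on the set of bond configurations. -/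
def total (K : Y → Y → ℂ) : ℂ := ∑ x, ∑ y, K x y

theorem total_add (K L : Y → Y → ℂ) : total (K + L) = total K + total L := by
  simp [total, Finset.sum_add_distrib]

theorem total_sub (K L : Y → Y → ℂ) : total (K - L) = total K - total L := by
  simp [total, Finset.sum_sub_distrib]

theorem total_smul (a : ℂ) (K : Y → Y → ℂ) : total (a • K) = a * total K := by
  simp [total, Finset.mul_sum]

theorem total_neg (K : Y → Y → ℂ) : total (-K) = -total K := by
  simp [total]

theorem total_sum {ι : Type*} (s : Finset ι) (K : ι → Y → Y → ℂ) :
    total (∑ i ∈ s, K i) = ∑ i ∈ s, total (K i) := by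
  classical
  induction s using Finset.induction_on with
  | empty => simp [total]
  | insert a s ha ih => rw [Finset.sum_insert ha, Finset.sum_insert ha, total_add, ih]

theorem total_comp_equiv (σ : Y ≃ Y) (K : Y → Y → ℂ) :
    total (fun x y => K (σ x) (σ y)) = total K := by
  unfold total
  rw [← Equiv.sum_comp σ fun x => ∑ y, K x y]
  exact Finset.sum_congr rfl fun x _ => Equiv.sum_comp σ (K (σ x))

theorem IsPSD.total_nonneg {K : Y → Y → ℂ} (hK : IsPSD K) : 0 ≤ total K := by
  have := PosSemidef.dotProduct_mulVec_nonneg hK (1 : Y → ℂ)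
  simpa [dotProduct, mulVec, total] using this

theorem IsPSD.total_re_nonneg {K : Y → Y → ℂ} (hK : IsPSD K) : 0 ≤ (total K).re :=
  (Complex.le_def.1 hK.total_nonneg).1

theorem IsPSD.total_eq_re {K : Y → Y → ℂ} (hK : IsPSD K) : total K = ((total K).re : ℂ) :=
  Complex.ext rfl (by simpa using (Complex.le_def.1 hK.total_nonneg).2.symm)

theorem total_re_le_of_isPSD_sub {K L : Y → Y → ℂ} (h : IsPSD (L - K)) :
    (total K).re ≤ (total L).re := by
  have := h.total_re_nonneg
  rw [total_sub, Complex.sub_re] at this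
  linarith

end Kernel

/-! ### Peeling layers of a doubled network -/

section Peel

variable {V : Type*} [Fintype V] [DecidableEq V]

/-- The edges (unordered pairs) that have an endpoint in `C`. -/
def touching (C : Finset V) : Set (Sym2 V) := {e | ∃ v ∈ C, v ∈ e}

/-- Two replicas of a norm network on the common configuration space `Y`: the doubled double-layer
tensors `M v`, comparison tensors `J v`, and, for each set `F` of edges, the exchange `σ F` of the
two replicas on the edges of `F`. The replicas agree away from `A`, where `M v` is moreover close to
`J v`, and `J v` is invariant under the exchange on each single leg. -/
structure ReplicaNetwork {Y : Type*} [Fintype Y] (G : SimpleGraph V) (A : Finset V) (η : ℝ)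
    (M J : V → Y → Y → ℂ) (σ : Set (Sym2 V) → Y ≃ Y) : Prop where
  eta_nonneg : 0 ≤ η
  psd_M : ∀ v, IsPSD (M v)
  psd_J : ∀ v, v ∉ A → IsPSD (J v)
  psd_sub : ∀ v, v ∉ A → IsPSD (J v - M v)
  sub_le : ∀ v, v ∉ A → IsPSD ((η : ℂ) • M v - (J v - M v))
  J_le : ∀ v, v ∉ A → IsPSD (((4 : ℝ) : ℂ) • M v - J v)
  swap_J : ∀ F v x y, J v (σ F x) (σ F y) = J v x y
  swap_M_of_subset : ∀ F v, v ∉ A → (∀ e ∈ G.incidenceSet v, e ∈ F) →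
    ∀ x y, M v (σ F x) (σ F y) = M v x y
  swap_M_of_disjoint : ∀ F v, (∀ e ∈ G.incidenceSet v, e ∉ F) →
    ∀ x y, M v (σ F x) (σ F y) = M v x y

variable {G : SimpleGraph V} [DecidableRel G.Adj] {Y : Type*} [Fintype Y] {A : Finset V} {η : ℝ}
  {M J : V → Y → Y → ℂ} {σ : Set (Sym2 V) → Y ≃ Y}

theorem sum_powerset_erase_le {V : Type*} [DecidableEq V] {N : Finset V} {x y : ℝ}
    (hxy : ∀ n, 1 ≤ n → x ^ n ≤ y) (hy : 0 ≤ y) :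
    ∑ S ∈ N.powerset.erase ∅, x ^ S.card ≤ 2 ^ N.card * y := by
  calc _ ≤ ∑ S ∈ N.powerset.erase ∅, y := Finset.sum_le_sum fun S hS => hxy _ (by
          rw [Nat.one_le_iff_ne_zero, Finset.card_ne_zero]
          exact Finset.nonempty_iff_ne_empty.2 (Finset.ne_of_mem_erase hS))
    _ ≤ ∑ S ∈ N.powerset, y := Finset.sum_le_sum_of_subset_of_nonneg (Finset.erase_subset _ _)
          fun _ _ _ => hy
    _ = _ := by rw [Finset.sum_const, Finset.card_powerset, nsmul_eq_mul]; push_cast; ring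

/-- The layer-peeling estimate. `C` is the set of vertices reached from the seed of the kernel `K`,
`S` the last layer added to `C`, and `I` the set of all vertices absorbed into `K`. The
tensors `M v = J v - (J v - M v)` next to `S` are expanded: if `J v` is chosen at all of them, the
replica exchange on the edges touching `C` shows that the contribution vanishes, so that each of
the `j` layers between `S` and `A` costs a factor `η`. At most `Δ |S|` tensors are expanded; the
factor `8 ^ Δ` per vertex of `S` is `4 ^ Δ` from `J ≤ 4 M` times `2 ^ Δ` terms of the expansion. -/
theorem ReplicaNetwork.peel (hN : ReplicaNetwork G A η M J σ) {Δ : ℕ}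
    (hΔ : ∀ v, G.degree v ≤ Δ) (hη : η * 8 ^ Δ ≤ 1) (j : ℕ) :
    ∀ (C I S : Finset V) (K : Y → Y → ℂ) (κ : ℝ), 0 ≤ κ → S ⊆ C → C ⊆ I →
      (∀ v ∈ C, ∀ w, G.Adj v w → w ∈ I ∨ v ∈ S) →
      (∀ s ∈ S, ∀ a ∈ A, (j : ℕ∞) < G.edist s a) → (∀ a ∈ A, a ∉ I) →
      (∀ F, touching C ⊆ F → ∀ x y, K (σ F x) (σ F y) = -K x y) →
      (∀ L, IsPSD L → ‖total (K * L)‖ ≤ κ * (total ((∏ v ∈ I, M v) * L)).re) →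
      ‖total (K * ∏ v ∈ Iᶜ, M v)‖
        ≤ κ * (η * 8 ^ Δ) ^ j * (8 ^ Δ) ^ S.card * (total (∏ v, M v)).re := by
  have hZ : 0 ≤ (total (∏ v, M v)).re := (isPSD_prod fun v _ => hN.psd_M v).total_re_nonneg
  have hQ : (1 : ℝ) ≤ 8 ^ Δ := one_le_pow₀ (by norm_num)
  have hη0 := hN.eta_nonneg
  induction j with
  | zero =>
    intro C I S K κ hκ hSC hCI hnb hdist hAI hanti hbound
    refine (hbound _ (isPSD_prod fun v _ => hN.psd_M v)).trans ?_
    rw [Finset.prod_mul_prod_compl, pow_zero, mul_one]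
    refine mul_le_mul_of_nonneg_right ?_ hZ
    exact le_mul_of_one_le_right hκ (one_le_pow₀ hQ)
  | succ j ih =>
    intro C I S K κ hκ hSC hCI hnb hdist hAI hanti hbound
    classical
    set N : Finset V := Finset.univ.filter fun v => v ∉ I ∧ ∃ s ∈ S, G.Adj s v with hNdef
    have hNI : Disjoint I N := by
      rw [Finset.disjoint_left]
      intro v hv hv'
      exact (Finset.mem_filter.1 hv').2.1 hv
    have hNA : ∀ v ∈ N, v ∉ A := by
      intro v hv hA
      obtain ⟨-, -, s, hs, hadj⟩ := Finset.mem_filter.1 hv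
      have h1 := hdist s hs v hA
      rw [SimpleGraph.edist_eq_one_iff_adj.2 hadj] at h1
      have h2 : ((1 : ℕ) : ℕ∞) ≤ ((j + 1 : ℕ) : ℕ∞) := by exact_mod_cast Nat.le_add_left 1 j
      exact absurd (h1.trans_le (by exact_mod_cast h2)) (lt_irrefl _)
    have hNcard : N.card ≤ Δ * S.card := by
      have : N ⊆ S.biUnion fun s => G.neighborFinset s := by
        intro v hv
        obtain ⟨-, -, s, hs, hadj⟩ := Finset.mem_filter.1 hv
        exact Finset.mem_biUnion.2 ⟨s, hs, (G.mem_neighborFinset s v).2 hadj⟩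
      refine (Finset.card_le_card this).trans ((Finset.card_biUnion_le).trans ?_)
      refine (Finset.sum_le_sum fun s _ =>
        (G.card_neighborFinset_eq_degree s).trans_le (hΔ s)).trans ?_
      rw [Finset.sum_const, smul_eq_mul, mul_comm]
    have hcompl : Iᶜ = N ∪ (I ∪ N)ᶜ := by
      ext v
      have : v ∈ N → v ∉ I := fun h h' => Finset.disjoint_left.1 hNI h' h
      simp only [Finset.mem_compl, Finset.mem_union]
      tauto
    have hdisj : Disjoint N (I ∪ N)ᶜ := by
      rw [Finset.disjoint_left]
      intro v hv hv'
      simp [hv] at hv'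
    set P : Finset V → Y → Y → ℂ :=
      fun S' => (∏ v ∈ S', (J v - M v)) * ∏ v ∈ N \ S', J v with hP
    have hexp : ∏ v ∈ N, M v = ∑ S' ∈ N.powerset, ((-1 : ℂ) ^ S'.card) • P S' := by
      have h1 : ∀ v ∈ N, M v = -(J v - M v) + J v := fun v _ => by ring
      rw [Finset.prod_congr rfl h1, Finset.prod_add]
      refine Finset.sum_congr rfl fun S' _ => ?_
      rw [Finset.prod_neg, hP, ← smul_mul_assoc]
      congr 1
    have htot : total (K * ∏ v ∈ Iᶜ, M v) = ∑ S' ∈ N.powerset,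
        (-1 : ℂ) ^ S'.card * total (K * P S' * ∏ v ∈ (I ∪ N)ᶜ, M v) := by
      rw [hcompl, Finset.prod_union hdisj, hexp, Finset.sum_mul, Finset.mul_sum, total_sum]
      refine Finset.sum_congr rfl fun S' _ => ?_
      rw [smul_mul_assoc, mul_smul_comm, total_smul, ← mul_assoc K]
    -- the contribution of the empty set vanishes by the exchange symmetry
    have hempty : total (K * P ∅ * ∏ v ∈ (I ∪ N)ᶜ, M v) = 0 := by
      have h1 := total_comp_equiv (σ (touching C)) (K * P ∅ * ∏ v ∈ (I ∪ N)ᶜ, M v)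
      have h2 : (fun x y => (K * P ∅ * ∏ v ∈ (I ∪ N)ᶜ, M v) (σ (touching C) x)
          (σ (touching C) y)) = -(K * P ∅ * ∏ v ∈ (I ∪ N)ᶜ, M v) := by
        funext x y
        simp only [Pi.mul_apply, Pi.neg_apply, hP, Finset.prod_empty, one_mul,
          Finset.sdiff_empty, prod_kernel_apply]
        rw [hanti _ subset_rfl, Finset.prod_congr rfl fun v _ => hN.swap_J _ v x y,
          Finset.prod_congr rfl fun v hv => hN.swap_M_of_disjoint (touching C) v ?_ x y]
        · ring
        · rintro e ⟨he, hve⟩ ⟨c, hc, hce⟩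
          have hvIN : v ∉ I ∪ N := Finset.mem_compl.1 hv
          have hvc : c ≠ v := by
            rintro rfl
            exact hvIN (Finset.mem_union_left _ (hCI hc))
          have hadj : G.Adj c v := by
            rw [← SimpleGraph.mem_edgeSet, ← (Sym2.mem_and_mem_iff hvc).1 ⟨hce, hve⟩]
            exact he
          rcases hnb c hc v hadj with h | h
          · exact hvIN (Finset.mem_union_left _ h)
          · by_cases hvI : v ∈ I
            · exact hvIN (Finset.mem_union_left _ hvI)
            · exact hvIN (Finset.mem_union_right _ (Finset.mem_filter.2
                ⟨Finset.mem_univ _, hvI, c, h, hadj⟩))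
      rw [h2, total_neg] at h1
      exact self_eq_neg.1 h1.symm
    -- a nonempty `S'` becomes the next layer, with one step less to go
    have hterm : ∀ S' ∈ N.powerset.erase ∅, ‖total (K * P S' * ∏ v ∈ (I ∪ N)ᶜ, M v)‖
        ≤ κ * 4 ^ N.card * (η * 8 ^ Δ) ^ j * (η * 8 ^ Δ) ^ S'.card
          * (total (∏ v, M v)).re := by
      intro S' hS'
      have hS'N : S' ⊆ N := Finset.mem_powerset.1 (Finset.mem_of_mem_erase hS')
      have hPpsd : IsPSD (P S') :=
        (isPSD_prod fun v hv => hN.psd_sub v (hNA v (hS'N hv))).mul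
          (isPSD_prod fun v hv => hN.psd_J v (hNA v (Finset.sdiff_subset hv)))
      have hPle : IsPSD (((η ^ S'.card * 4 ^ (N \ S').card : ℝ) : ℂ) • (∏ v ∈ N, M v) - P S') := by
        have := (isPSD_prod fun v hv => hN.psd_sub v (hNA v (hS'N hv))).mul_sub_mul
          (isPSD_smul_prod_sub_prod (s := S') (fun v hv => hN.psd_sub v (hNA v (hS'N hv)))
            fun v hv => hN.sub_le v (hNA v (hS'N hv)))
          (isPSD_prod fun v hv => hN.psd_J v (hNA v (Finset.sdiff_subset hv)))
          (isPSD_smul_prod_sub_prod (s := N \ S')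
            (fun v hv => hN.psd_J v (hNA v (Finset.sdiff_subset hv)))
            fun v hv => hN.J_le v (hNA v (Finset.sdiff_subset hv)))
        convert this using 2
        rw [smul_mul_smul_comm, ← Finset.prod_sdiff hS'N, mul_comm (∏ v ∈ N \ S', M v)]
        push_cast
        rfl
      have := ih (C ∪ S') (I ∪ N) S' (K * P S') (κ * (η ^ S'.card * 4 ^ (N \ S').card))
        (by positivity) Finset.subset_union_right
        (Finset.union_subset_union hCI hS'N) ?_ ?_ ?_ ?_ ?_
      · refine this.trans (mul_le_mul_of_nonneg_right ?_ hZ)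
        calc κ * (η ^ S'.card * 4 ^ (N \ S').card) * (η * 8 ^ Δ) ^ j * (8 ^ Δ) ^ S'.card
            = κ * 4 ^ (N \ S').card * (η * 8 ^ Δ) ^ j * (η * 8 ^ Δ) ^ S'.card := by
              rw [mul_pow η (8 ^ Δ) S'.card]; ring
          _ ≤ _ := by
              gcongr
              · norm_num
              · exact Finset.sdiff_subset
      · intro v hv w hvw
        rcases Finset.mem_union.1 hv with hv | hv
        · refine Or.inl ?_
          rcases hnb v hv w hvw with h | h
          · exact Finset.mem_union_left _ h
          · by_cases hw : w ∈ I
            · exact Finset.mem_union_left _ hw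
            · exact Finset.mem_union_right _
                (Finset.mem_filter.2 ⟨Finset.mem_univ _, hw, v, h, hvw⟩)
        · exact Or.inr hv
      · intro s hs a ha
        obtain ⟨-, -, t, ht, hadj⟩ := Finset.mem_filter.1 (hS'N hs)
        have h1 := hdist t ht a ha
        have h2 : G.edist t a ≤ 1 + G.edist s a := by
          have := G.edist_triangle (u := t) (v := s) (w := a)
          rwa [SimpleGraph.edist_eq_one_iff_adj.2 hadj] at this
        by_contra hcon
        have h3 := h1.trans_le (h2.trans (add_le_add_right (not_lt.1 hcon) 1))
        have h4 : ((j + 1 : ℕ) : ℕ∞) = 1 + (j : ℕ∞) := by push_cast; exact add_comm _ _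
        rw [h4] at h3
        exact lt_irrefl _ h3
      · intro a ha h
        rcases Finset.mem_union.1 h with h | h
        · exact hAI a ha h
        · exact hNA a h ha
      · intro F hF x y
        have hF' : touching C ⊆ F := fun e ⟨v, hv, hve⟩ =>
          hF ⟨v, Finset.mem_union_left _ hv, hve⟩
        simp only [Pi.mul_apply, hP, prod_kernel_apply, Pi.sub_apply]
        rw [hanti F hF', Finset.prod_congr rfl fun v _ => hN.swap_J F v x y,
          Finset.prod_congr rfl fun v hv => by
            rw [hN.swap_J F v x y, hN.swap_M_of_subset F v (hNA v (hS'N hv))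
              (fun e he => hF ⟨v, Finset.mem_union_right _ hv, he.2⟩) x y]]
        ring
      · intro L hL
        rw [mul_assoc K]
        refine (hbound _ (hPpsd.mul hL)).trans ?_
        rw [mul_assoc κ]
        refine mul_le_mul_of_nonneg_left ?_ hκ
        have h1 : IsPSD (((η ^ S'.card * 4 ^ (N \ S').card : ℝ) : ℂ) •
            ((∏ v ∈ I ∪ N, M v) * L) - (∏ v ∈ I, M v) * (P S' * L)) := by
          have := ((isPSD_prod fun v (_ : v ∈ I) => hN.psd_M v).mul hPle).mul hL
          convert this using 1
          rw [Finset.prod_union hNI, mul_sub, sub_mul, mul_smul_comm, smul_mul_assoc,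
            mul_assoc _ (P S')]
        have h2 := total_re_le_of_isPSD_sub h1
        rwa [total_smul, Complex.re_ofReal_mul] at h2
    rw [htot]
    rw [← Finset.add_sum_erase _ _ (Finset.empty_mem_powerset N), hempty, mul_zero, zero_add]
    refine (norm_sum_le _ _).trans ?_
    calc ∑ S' ∈ N.powerset.erase ∅,
          ‖(-1 : ℂ) ^ S'.card * total (K * P S' * ∏ v ∈ (I ∪ N)ᶜ, M v)‖
        ≤ ∑ S' ∈ N.powerset.erase ∅, κ * 4 ^ N.card * (η * 8 ^ Δ) ^ j * (total (∏ v, M v)).re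
            * (η * 8 ^ Δ) ^ S'.card := by
          refine Finset.sum_le_sum fun S' hS' => ?_
          rw [norm_mul, norm_pow, norm_neg, norm_one, one_pow, one_mul]
          refine (hterm S' hS').trans_eq ?_
          ring
      _ = κ * 4 ^ N.card * (η * 8 ^ Δ) ^ j * (total (∏ v, M v)).re *
            ∑ S' ∈ N.powerset.erase ∅, (η * 8 ^ Δ) ^ S'.card := by rw [Finset.mul_sum]
      _ ≤ κ * 4 ^ N.card * (η * 8 ^ Δ) ^ j * (total (∏ v, M v)).re *
            (2 ^ N.card * (η * 8 ^ Δ)) := by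
          gcongr
          exact sum_powerset_erase_le
            (fun n hn => pow_le_of_le_one (by positivity) hη (by omega)) (by positivity)
      _ = κ * (η * 8 ^ Δ) ^ (j + 1) * 8 ^ N.card * (total (∏ v, M v)).re := by
          have : (8 : ℝ) ^ N.card = 4 ^ N.card * 2 ^ N.card := by rw [← mul_pow]; norm_num
          rw [this]
          ring
      _ ≤ _ := by
          gcongr
          rw [← pow_mul]
          exact pow_le_pow_right₀ (by norm_num) hNcard

end Peel

/-! ### The norm network as a product of kernels -/

section NormNetwork

variable {V : Type u} [Fintype V] [DecidableEq V] {G : SimpleGraph V} [DecidableRel G.Adj]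
  {D d : ℕ}

/-- The restriction of a configuration of edge indices to the legs of `v`. -/
def leg (v : V) (x : G.edgeSet → Fin D) : G.neighborSet v → Fin D :=
  fun n => x ⟨s(v, n), G.mem_edgeSet.2 n.2⟩

/-- The kernel on edge configurations given by `T_vᴴ T_v`: the double-layer tensor at `v`, with the
bra configuration as first argument. -/
def vertexKernel (T : PEPS G D d) (v : V) (x y : G.edgeSet → Fin D) : ℂ :=
  ((T v)ᴴ * T v) (leg v x) (leg v y)

/-- The kernel of the identity on the legs of `v`. -/
def idKernel (v : V) (x y : G.edgeSet → Fin D) : ℂ :=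
  (1 : Matrix (G.neighborSet v → Fin D) _ ℂ) (leg v x) (leg v y)

/-- The product of the tensors at the vertices satisfying `p`, as a matrix from edge configurations
to physical configurations of these vertices. -/
def regionMatrix (T : PEPS G D d) (p : V → Prop) [DecidablePred p] :
    Matrix ({v // p v} → Fin d) (G.edgeSet → Fin D) ℂ :=
  fun t x => ∏ v : {v // p v}, T v.1 (t v) (leg v.1 x)

/-- The double layer of the tensors in `B` with the operator `O` between the layers. -/
def opKernel (T : PEPS G D d) (B : Finset V) (O : Matrix (B → Fin d) (B → Fin d) ℂ) :
    (G.edgeSet → Fin D) → (G.edgeSet → Fin D) → ℂ :=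
  (regionMatrix T (· ∈ B))ᴴ * O * regionMatrix T (· ∈ B)

theorem regionMatrix_gram (T : PEPS G D d) (p : V → Prop) [DecidablePred p]
    (x y : G.edgeSet → Fin D) :
    ∑ t, star (regionMatrix T p t x) * regionMatrix T p t y
      = ∏ v : {v // p v}, vertexKernel T v x y := by
  simp only [vertexKernel, mul_apply, conjTranspose_apply]
  rw [Finset.prod_univ_sum, Fintype.piFinset_univ]
  refine Finset.sum_congr rfl fun t _ => ?_
  rw [regionMatrix, regionMatrix, star_prod, ← Finset.prod_mul_distrib]

theorem opKernel_one (T : PEPS G D d) (B : Finset V) :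
    opKernel T B 1 = ∏ v ∈ B, vertexKernel T v := by
  funext x y
  rw [opKernel, Matrix.mul_one, mul_apply, prod_kernel_apply]
  simp only [conjTranspose_apply]
  rw [Finset.prod_subtype B (p := (· ∈ B)) (fun _ => Iff.rfl), ← regionMatrix_gram]
  congr!

theorem opKernel_apply (T : PEPS G D d) (B : Finset V) (O : Matrix (B → Fin d) (B → Fin d) ℂ)
    (x y : G.edgeSet → Fin D) :
    opKernel T B O x y = ∑ t, ∑ t', star (regionMatrix T (· ∈ B) t x) * O t t'
      * regionMatrix T (· ∈ B) t' y := by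
  rw [opKernel, mul_apply, Finset.sum_comm]
  refine Finset.sum_congr rfl fun t' _ => ?_
  rw [mul_apply, Finset.sum_mul]
  rfl

theorem sum_sum_sum_rotate {α β γ : Type*} [Fintype α] [Fintype β] [Fintype γ]
    (f : α → β → γ → ℂ) : ∑ a, ∑ b, ∑ c, f a b c = ∑ c, ∑ a, ∑ b, f a b c := by
  rw [Finset.sum_comm (s := (Finset.univ : Finset γ))]
  exact Finset.sum_congr rfl fun a _ => Finset.sum_comm

/-- The norm network with the operator `O` inserted on `B`. -/
theorem star_stateVec_dotProduct_localOp (T : PEPS G D d) (B : Finset V)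
    (O : Matrix (B → Fin d) (B → Fin d) ℂ) :
    star (stateVec T) ⬝ᵥ (localOp B O).mulVec (stateVec T)
      = total (opKernel T B O * ∏ v ∈ Bᶜ, vertexKernel T v) := by
  -- physical configurations are split into those of `B` and those of its complement
  set e := (Equiv.piEquivPiSubtypeProd (fun v => v ∈ B) (fun _ : V => Fin d)).symm with he
  have hψ : ∀ t r, stateVec T (e (t, r))
      = ∑ x, regionMatrix T (· ∈ B) t x * regionMatrix T (fun v => ¬ v ∈ B) r x := by
    intro t r
    refine Finset.sum_congr rfl fun x _ => ?_
    have h1 := Fintype.prod_subtype_mul_prod_subtype (fun v => v ∈ B)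
      fun v => T v (e (t, r) v) (leg v x)
    refine h1.symm.trans ?_
    congr 1
    · refine Finset.prod_congr rfl fun v _ => ?_
      simp [he, Equiv.piEquivPiSubtypeProd]
    · refine Finset.prod_congr rfl fun v _ => ?_
      simp [he, Equiv.piEquivPiSubtypeProd, v.2]
  have hO : ∀ t r t' r', localOp B O (e (t, r)) (e (t', r')) = if r = r' then O t t' else 0 := by
    intro t r t' r'
    have h1 : (∀ v, v ∉ B → e (t, r) v = e (t', r') v) ↔ r = r' := by
      constructor
      · intro h
        funext v
        simpa [he, Equiv.piEquivPiSubtypeProd, v.2] using h v v.2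
      · rintro rfl v hv
        simp [he, Equiv.piEquivPiSubtypeProd, hv]
    simp only [localOp, h1]
    congr 2
    · funext b
      simp [he, Equiv.piEquivPiSubtypeProd]
    · funext b
      simp [he, Equiv.piEquivPiSubtypeProd]
  have hrest : ∀ x y, (∏ v ∈ Bᶜ, vertexKernel T v) x y
      = ∑ r, star (regionMatrix T (fun v => ¬ v ∈ B) r x)
          * regionMatrix T (fun v => ¬ v ∈ B) r y := by
    intro x y
    rw [regionMatrix_gram, prod_kernel_apply]
    exact (Finset.prod_subtype _ (by simp) _)
  calc star (stateVec T) ⬝ᵥ (localOp B O).mulVec (stateVec T)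
      = ∑ t, ∑ r, ∑ t', star (stateVec T (e (t, r))) * (O t t' * stateVec T (e (t', r))) := by
        simp only [dotProduct, mulVec]
        rw [← Equiv.sum_comp e, Fintype.sum_prod_type]
        refine Finset.sum_congr rfl fun t _ => Finset.sum_congr rfl fun r _ => ?_
        rw [← Equiv.sum_comp e, Fintype.sum_prod_type, Finset.mul_sum]
        refine Finset.sum_congr rfl fun t' _ => ?_
        simp only [hO, ite_mul, zero_mul, Finset.sum_ite_eq, Finset.mem_univ, if_true,
          Pi.star_apply]
    _ = ∑ t, ∑ r, ∑ t', ∑ x, ∑ y, (star (regionMatrix T (· ∈ B) t x) * O t t'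
          * regionMatrix T (· ∈ B) t' y) * (star (regionMatrix T (fun v => ¬ v ∈ B) r x)
          * regionMatrix T (fun v => ¬ v ∈ B) r y) := by
        refine Finset.sum_congr rfl fun t _ => Finset.sum_congr rfl fun r _ =>
          Finset.sum_congr rfl fun t' _ => ?_
        rw [hψ, hψ, star_sum, Finset.sum_mul]
        refine Finset.sum_congr rfl fun x _ => ?_
        rw [Finset.mul_sum, Finset.mul_sum]
        refine Finset.sum_congr rfl fun y _ => ?_
        rw [star_mul']
        ring
    _ = ∑ x, ∑ y, ∑ t, ∑ t', ∑ r, (star (regionMatrix T (· ∈ B) t x) * O t t'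
          * regionMatrix T (· ∈ B) t' y) * (star (regionMatrix T (fun v => ¬ v ∈ B) r x)
          * regionMatrix T (fun v => ¬ v ∈ B) r y) := by
        symm
        rw [sum_sum_sum_rotate]
        refine Finset.sum_congr rfl fun t _ => ?_
        rw [sum_sum_sum_rotate]
        rw [Finset.sum_comm (s := (Finset.univ : Finset ({v // ¬ v ∈ B} → Fin d)))]
        refine Finset.sum_congr rfl fun t' _ => ?_
        rw [sum_sum_sum_rotate]
    _ = _ := by
        refine Finset.sum_congr rfl fun x _ => Finset.sum_congr rfl fun y _ => ?_
        rw [Pi.mul_apply, Pi.mul_apply, opKernel_apply, hrest, Finset.sum_mul]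
        refine Finset.sum_congr rfl fun t _ => ?_
        rw [Finset.sum_mul]
        refine Finset.sum_congr rfl fun t' _ => ?_
        rw [Finset.mul_sum]

theorem localOp_one (B : Finset V) : localOp B (1 : Matrix (B → Fin d) (B → Fin d) ℂ) = 1 := by
  ext s s'
  by_cases h : s = s'
  · subst h
    simp [localOp]
  · rw [one_apply_ne h, localOp]
    split_ifs with h1
    · rw [one_apply_ne]
      intro h2
      refine h (funext fun v => ?_)
      by_cases hv : v ∈ B
      · exact congrFun h2 ⟨v, hv⟩
      · exact h1 v hv
    · rfl

theorem star_stateVec_dotProduct_self (T : PEPS G D d) :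
    star (stateVec T) ⬝ᵥ stateVec T = total (∏ v, vertexKernel T v) := by
  have := star_stateVec_dotProduct_localOp T ∅ 1
  rw [localOp_one, one_mulVec, opKernel_one, Finset.prod_mul_prod_compl] at this
  exact this

theorem isPSD_comp_leg {v : V} {N : Matrix (G.neighborSet v → Fin D) (G.neighborSet v → Fin D) ℂ}
    (hN : N.PosSemidef) :
    IsPSD fun x y : G.edgeSet → Fin D => N (leg v x) (leg v y) :=
  hN.submatrix (leg v)

theorem isPSD_vertexKernel (T : PEPS G D d) (v : V) : IsPSD (vertexKernel T v) :=
  isPSD_comp_leg (posSemidef_conjTranspose_mul_self (T v))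

theorem isPSD_idKernel (v : V) : IsPSD (idKernel (G := G) (D := D) v) :=
  isPSD_comp_leg PosSemidef.one

theorem isPSD_opKernel (T : PEPS G D d) (B : Finset V) {O : Matrix (B → Fin d) (B → Fin d) ℂ}
    (hO : O.PosSemidef) : IsPSD (opKernel T B O) :=
  hO.conjTranspose_mul_mul_same _

theorem isPSD_vertexKernel_sub {T : PEPS G D d} {v : V} {lo hi : ℝ}
    (h : HasBounds lo hi (T v)) :
    IsPSD (vertexKernel T v - (lo : ℂ) • idKernel v) :=
  isPSD_comp_leg h.1

theorem isPSD_idKernel_sub {T : PEPS G D d} {v : V} {lo hi : ℝ} (h : HasBounds lo hi (T v)) :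
    IsPSD ((hi : ℂ) • idKernel v - vertexKernel T v) :=
  isPSD_comp_leg h.2

/-- The norm of the state of an injective PEPS is bounded below by that of the network of
identities, in which the constant configuration contributes 1. -/
theorem total_vertexKernel_pos (hD : 1 ≤ D) {T : PEPS G D d} {lo hi : ℝ} (hlo : 0 < lo)
    (h : ∀ v, HasBounds lo hi (T v)) : 0 < (total (∏ v, vertexKernel T v)).re := by
  have h1 := isPSD_prod_sub_prod (s := Finset.univ)
    (fun v _ => (isPSD_idKernel (G := G) (D := D) v).smul hlo.le)
    (fun v _ => isPSD_vertexKernel_sub (h v))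
  refine lt_of_lt_of_le ?_ (total_re_le_of_isPSD_sub h1)
  have hentry : ∀ x y : G.edgeSet → Fin D,
      0 ≤ ((∏ v, (lo : ℂ) • idKernel (G := G) (D := D) v) x y).re := by
    intro x y
    have : (∏ v, (lo : ℂ) • idKernel (G := G) (D := D) v) x y
        = ((∏ v, if leg v x = leg v y then lo else 0 : ℝ) : ℂ) := by
      rw [prod_kernel_apply]
      push_cast
      refine Finset.prod_congr rfl fun v _ => ?_
      simp only [idKernel, one_apply, Pi.smul_apply, smul_eq_mul]
      split_ifs <;> simp
    rw [this, Complex.ofReal_re]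
    exact Finset.prod_nonneg fun v _ => by split_ifs <;> linarith
  let x₀ : G.edgeSet → Fin D := fun _ => ⟨0, hD⟩
  rw [total, Complex.re_sum]
  simp only [Complex.re_sum]
  refine Finset.sum_pos' (fun x _ => Finset.sum_nonneg fun y _ => hentry x y)
    ⟨x₀, Finset.mem_univ _, Finset.sum_pos' (fun y _ => hentry _ y) ⟨x₀, Finset.mem_univ _, ?_⟩⟩
  rw [prod_kernel_apply]
  simp only [Pi.smul_apply, idKernel, one_apply_eq, smul_eq_mul, mul_one, Finset.prod_const]
  rw [← Complex.ofReal_pow, Complex.ofReal_re]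
  positivity

theorem stateVec_ne_zero (hD : 1 ≤ D) {T : PEPS G D d} {lo hi : ℝ} (hlo : 0 < lo)
    (h : ∀ v, HasBounds lo hi (T v)) : stateVec T ≠ 0 := by
  intro h0
  have h1 := total_vertexKernel_pos hD hlo h
  rw [← star_stateVec_dotProduct_self, h0] at h1
  simp at h1

/-! ### Two replicas -/

/-- The kernel of two uncoupled replicas. -/
def doubled {X : Type*} (K L : X → X → ℂ) : X × X → X × X → ℂ :=
  fun z w => K z.1 w.1 * L z.2 w.2

theorem doubled_mul {X : Type*} (K L K' L' : X → X → ℂ) :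
    doubled K L * doubled K' L' = doubled (K * K') (L * L') := by
  funext z w
  simp only [doubled, Pi.mul_apply]
  ring

theorem doubled_prod {X ι : Type*} (s : Finset ι) (K L : ι → X → X → ℂ) :
    doubled (∏ i ∈ s, K i) (∏ i ∈ s, L i) = ∏ i ∈ s, doubled (K i) (L i) := by
  funext z w
  simp only [doubled, prod_kernel_apply, Finset.prod_mul_distrib]

theorem total_doubled {X : Type*} [Fintype X] (K L : X → X → ℂ) :
    total (doubled K L) = total K * total L := by
  simp only [total, doubled, Fintype.sum_prod_type, Finset.sum_mul_sum]

theorem isPSD_fst {X : Type*} {K : X → X → ℂ} (hK : IsPSD K) :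
    IsPSD fun z w : X × X => K z.1 w.1 :=
  PosSemidef.submatrix hK Prod.fst

theorem isPSD_snd {X : Type*} {K : X → X → ℂ} (hK : IsPSD K) :
    IsPSD fun z w : X × X => K z.2 w.2 :=
  PosSemidef.submatrix hK Prod.snd

theorem isPSD_doubled {X : Type*} {K L : X → X → ℂ} (hK : IsPSD K) (hL : IsPSD L) :
    IsPSD (doubled K L) :=
  (isPSD_fst hK).mul (isPSD_snd hL)

theorem isPSD_doubled_sub {X : Type*} {K L K' L' : X → X → ℂ} (hK : IsPSD K) (hL : IsPSD L)
    (h : IsPSD (K' - K)) (h' : IsPSD (L' - L)) : IsPSD (doubled K' L' - doubled K L) :=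
  (isPSD_fst hK).mul_sub_mul (isPSD_fst h) (isPSD_snd hL) (isPSD_snd h')

open Classical in
/-- The exchange of the two replicas on the edges in `F`. -/
def replicaSwap (F : Set (Sym2 V)) :
    (G.edgeSet → Fin D) × (G.edgeSet → Fin D) ≃ (G.edgeSet → Fin D) × (G.edgeSet → Fin D) :=
  Function.Involutive.toPerm
    (fun z => (fun e => if (e : Sym2 V) ∈ F then z.2 e else z.1 e,
      fun e => if (e : Sym2 V) ∈ F then z.1 e else z.2 e)) (by
    intro z
    ext e <;> by_cases h : (e : Sym2 V) ∈ F <;> simp [h])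

theorem leg_replicaSwap_of_subset {F : Set (Sym2 V)} {v : V} (h : ∀ e ∈ G.incidenceSet v, e ∈ F)
    (z : (G.edgeSet → Fin D) × (G.edgeSet → Fin D)) :
    leg v (replicaSwap F z).1 = leg v z.2 ∧ leg v (replicaSwap F z).2 = leg v z.1 := by
  have h' : ∀ n : G.neighborSet v, s(v, (n : V)) ∈ F := fun n =>
    h _ ((G.mem_incidenceSet v n).2 n.2)
  constructor <;> funext n
  · exact if_pos (h' n)
  · exact if_pos (h' n)

theorem leg_replicaSwap_of_disjoint {F : Set (Sym2 V)} {v : V}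
    (h : ∀ e ∈ G.incidenceSet v, e ∉ F) (z : (G.edgeSet → Fin D) × (G.edgeSet → Fin D)) :
    leg v (replicaSwap F z).1 = leg v z.1 ∧ leg v (replicaSwap F z).2 = leg v z.2 := by
  have h' : ∀ n : G.neighborSet v, s(v, (n : V)) ∉ F := fun n =>
    h _ ((G.mem_incidenceSet v n).2 n.2)
  constructor <;> funext n
  · exact if_neg (h' n)
  · exact if_neg (h' n)

theorem doubled_idKernel_swap (F : Set (Sym2 V)) (v : V)
    (z w : (G.edgeSet → Fin D) × (G.edgeSet → Fin D)) :
    doubled (idKernel v) (idKernel v) (replicaSwap F z) (replicaSwap F w)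
      = doubled (idKernel v) (idKernel v) z w := by
  -- the doubled identity is a condition on each leg, symmetric in the replicas
  have h : ∀ z w : (G.edgeSet → Fin D) × (G.edgeSet → Fin D),
      doubled (idKernel v) (idKernel v) z w
        = if (∀ n : G.neighborSet v, leg v z.1 n = leg v w.1 n ∧ leg v z.2 n = leg v w.2 n)
          then 1 else 0 := by
    intro z w
    simp only [doubled, idKernel, one_apply, forall_and, ← funext_iff, ← ite_and, mul_ite,
      mul_one, mul_zero, and_comm]
  rw [h, h]
  refine if_congr (forall_congr' fun n => ?_) rfl rfl
  by_cases hn : s(v, (n : V)) ∈ F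
  · have h1 : ∀ z : (G.edgeSet → Fin D) × (G.edgeSet → Fin D),
        leg v (replicaSwap F z).1 n = leg v z.2 n ∧ leg v (replicaSwap F z).2 n = leg v z.1 n :=
      fun z => ⟨if_pos hn, if_pos hn⟩
    rw [(h1 z).1, (h1 z).2, (h1 w).1, (h1 w).2, and_comm]
  · have h1 : ∀ z : (G.edgeSet → Fin D) × (G.edgeSet → Fin D),
        leg v (replicaSwap F z).1 n = leg v z.1 n ∧ leg v (replicaSwap F z).2 n = leg v z.2 n :=
      fun z => ⟨if_neg hn, if_neg hn⟩
    rw [(h1 z).1, (h1 z).2, (h1 w).1, (h1 w).2]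

theorem isPSD_smul_sub_of_le {Y : Type*} {J M : Y → Y → ℂ} {a c : ℝ} (hJ : IsPSD J)
    (h : IsPSD (M - (a : ℂ) • J)) (hc : 0 ≤ c) (hca : 1 ≤ c * a) :
    IsPSD ((c : ℂ) • M - J) := by
  have h1 := (h.smul hc).add (hJ.smul (sub_nonneg.2 hca))
  convert h1 using 1
  rw [smul_sub, smul_smul]
  push_cast
  rw [sub_smul, one_smul]
  abel

variable {T T' : PEPS G D d} {A : Finset V} {δ : ℝ}

/-- The norm networks of `T` and `T'` form a replica network with comparison tensors `1 ⊗ 1`; the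
deviation of the doubled tensors from them is at most `1 - δ⁴ ≤ 8 ε δ⁴`. -/
theorem replicaNetwork (hT : ∀ v, HasBounds (δ ^ 2) 1 (T v)) (hTT' : ∀ v, v ∉ A → T' v = T v)
    (h0 : 0 ≤ deviation δ) (h1 : deviation δ ≤ 3 / 8) :
    ReplicaNetwork G A (8 * deviation δ) (fun v => doubled (vertexKernel T v) (vertexKernel T' v))
      (fun v => doubled (idKernel (D := D) v) (idKernel v)) replicaSwap := by
  have hδ : δ ^ 2 = 1 - deviation δ := by unfold deviation; ring
  have hK : ∀ v, v ∉ A → vertexKernel T' v = vertexKernel T v := fun v hv => by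
    unfold vertexKernel; rw [hTT' v hv]
  have hlow : ∀ v, v ∉ A → IsPSD (doubled (vertexKernel T v) (vertexKernel T' v)
      - ((δ ^ 2 * δ ^ 2 : ℝ) : ℂ) • doubled (idKernel (D := D) v) (idKernel v)) := by
    intro v hv
    rw [hK v hv]
    have := isPSD_doubled_sub ((isPSD_idKernel (D := D) v).smul (sq_nonneg δ))
      ((isPSD_idKernel (D := D) v).smul (sq_nonneg δ)) (isPSD_vertexKernel_sub (hT v))
      (isPSD_vertexKernel_sub (hT v))
    convert this using 1
    congr 1
    funext z w
    simp only [doubled, Pi.smul_apply, smul_eq_mul]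
    push_cast
    ring
  refine ⟨by positivity, fun v => isPSD_doubled (isPSD_vertexKernel T v) (isPSD_vertexKernel T' v),
    fun v _ => isPSD_doubled (isPSD_idKernel v) (isPSD_idKernel v), ?_, ?_, ?_,
    doubled_idKernel_swap, ?_, ?_⟩
  · intro v hv
    rw [hK v hv]
    have := isPSD_idKernel_sub (hT v)
    rw [Complex.ofReal_one, one_smul] at this
    exact isPSD_doubled_sub (isPSD_vertexKernel T v) (isPSD_vertexKernel T v) this this
  · intro v hv
    have := isPSD_smul_sub_of_le (c := 1 + 8 * deviation δ)
      (isPSD_doubled (isPSD_idKernel v) (isPSD_idKernel v)) (hlow v hv) (by positivity) (by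
        rw [hδ]; nlinarith [mul_nonneg h0 h0, mul_nonneg h0 (sub_nonneg.2 h1)])
    convert this using 1
    push_cast
    rw [add_smul, one_smul]
    abel
  · intro v hv
    exact isPSD_smul_sub_of_le (c := 4)
      (isPSD_doubled (isPSD_idKernel v) (isPSD_idKernel v)) (hlow v hv) (by norm_num) (by
        rw [hδ]; nlinarith)
  · intro F v hv hF z w
    rw [hK v hv]
    have hz := leg_replicaSwap_of_subset hF z
    have hw := leg_replicaSwap_of_subset hF w
    simp only [doubled, vertexKernel, hz, hw]
    ring
  · intro F v hF z w
    have hz := leg_replicaSwap_of_disjoint hF z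
    have hw := leg_replicaSwap_of_disjoint hF w
    simp only [doubled, vertexKernel, hz, hw]

theorem opKernel_congr {B : Finset V} (hB : ∀ v ∈ B, T' v = T v)
    (O : Matrix (B → Fin d) (B → Fin d) ℂ) : opKernel T' B O = opKernel T B O := by
  have : regionMatrix T' (· ∈ B) = regionMatrix T (· ∈ B) := by
    funext t x
    exact Finset.prod_congr rfl fun v _ => by rw [hB v v.2]
  rw [opKernel, opKernel, this]

theorem opKernel_congr_leg {B : Finset V} (O : Matrix (B → Fin d) (B → Fin d) ℂ)
    {x x' y y' : G.edgeSet → Fin D} (hx : ∀ v ∈ B, leg v x = leg v x')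
    (hy : ∀ v ∈ B, leg v y = leg v y') : opKernel T B O x y = opKernel T B O x' y' := by
  have h : ∀ {x x' : G.edgeSet → Fin D}, (∀ v ∈ B, leg v x = leg v x') → ∀ t,
      regionMatrix T (· ∈ B) t x = regionMatrix T (· ∈ B) t x' := fun {x x'} hx t =>
    Finset.prod_congr rfl fun v _ => by rw [hx v v.2]
  rw [opKernel_apply, opKernel_apply]
  simp only [h hx, h hy]

/-- The kernel of `O` inserted in the first replica, as a linear function of `O`, is dominated by
the kernel of the identity. -/
theorem norm_total_opKernel_mul_le (T : PEPS G D d) (B : Finset V) {Y : Type*} [Fintype Y]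
    (f : Y → G.edgeSet → Fin D) {L : Y → Y → ℂ} (hL : IsPSD L)
    (O : Matrix (B → Fin d) (B → Fin d) ℂ) :
    ‖total ((fun z w => opKernel T B O (f z) (f w)) * L)‖
      ≤ 2 * ‖O‖ * (total ((fun z w => opKernel T B 1 (f z) (f w)) * L)).re := by
  let F : Matrix (B → Fin d) (B → Fin d) ℂ →ₗ[ℂ] ℂ :=
    { toFun := fun O => total ((fun z w => opKernel T B O (f z) (f w)) * L)
      map_add' := fun O O' => by
        rw [← total_add, ← add_mul]
        congr 2
        funext z w
        simp [opKernel, Matrix.mul_add, Matrix.add_mul]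
      map_smul' := fun a O => by
        rw [RingHom.id_apply, smul_eq_mul, ← total_smul, ← smul_mul_assoc]
        congr 2
        funext z w
        simp [opKernel] }
  exact norm_positive_functional_le F
    (fun O hO => (IsPSD.mul (PosSemidef.submatrix (isPSD_opKernel T B hO) f) hL).total_nonneg) O

theorem norm_expectation_le (hD : 1 ≤ D) {lo hi : ℝ} (hlo : 0 < lo)
    (h : ∀ v, HasBounds lo hi (T v)) (B : Finset V) (O : Matrix (B → Fin d) (B → Fin d) ℂ) :
    ‖expectation T B O‖ ≤ 2 * ‖O‖ := by
  have hZ := total_vertexKernel_pos hD hlo h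
  have hZr := (isPSD_prod fun v (_ : v ∈ Finset.univ) => isPSD_vertexKernel T v).total_eq_re
  have h1 := norm_total_opKernel_mul_le T B id
    (isPSD_prod fun v (_ : v ∈ Bᶜ) => isPSD_vertexKernel T v) O
  rw [expectation, star_stateVec_dotProduct_localOp, star_stateVec_dotProduct_self, norm_div, hZr,
    Complex.norm_real, Real.norm_of_nonneg hZ.le, div_le_iff₀ hZ]
  refine h1.trans_eq ?_
  simp only [id]
  rw [show (fun z w => opKernel T B 1 z w) = opKernel T B 1 from rfl, opKernel_one,
    Finset.prod_mul_prod_compl]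

/-- Replacing the tensors of `A`, at distance more than `j` from `B`, changes expectation values on
`B` by at most `O(ε ^ j)`: the difference is the contraction of a doubled network with a seed on
`B` that is odd under the exchange of replicas. -/
theorem norm_expectation_sub_le (hD : 1 ≤ D) {Δ : ℕ} (hΔ : ∀ v, G.degree v ≤ Δ) (hδ : δ ≠ 0)
    (hT : ∀ v, HasBounds (δ ^ 2) 1 (T v)) (hTT' : ∀ v, v ∉ A → T' v = T v) {lo hi : ℝ}
    (hlo : 0 < lo) (hT' : ∀ v, HasBounds lo hi (T' v))
    (h0 : 0 ≤ deviation δ) (h1 : deviation δ ≤ 3 / 8) (h8 : 8 * deviation δ * 8 ^ Δ ≤ 1)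
    (B : Finset V) (O : Matrix (B → Fin d) (B → Fin d) ℂ) (j : ℕ)
    (hdist : ((j + 1 : ℕ) : ℕ∞) ≤ setDist G A B) :
    ‖expectation T' B O - expectation T B O‖
      ≤ 4 * ‖O‖ * (8 * deviation δ * 8 ^ Δ) ^ j * (8 ^ Δ) ^ B.card := by
  have hdist' : ∀ s ∈ B, ∀ a ∈ A, (j : ℕ∞) < G.edist s a := by
    intro s hs a ha
    have h2 : ((j + 1 : ℕ) : ℕ∞) ≤ G.edist a s :=
      hdist.trans ((iInf₂_le a ha).trans (iInf₂_le s hs))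
    rw [SimpleGraph.edist_comm] at h2
    exact lt_of_lt_of_le (by exact_mod_cast Nat.lt_succ_self j) h2
  have hAB : ∀ a ∈ A, a ∉ B := by
    intro a ha hb
    have := hdist' a hb a ha
    simp at this
  have hN := replicaNetwork hT hTT' h0 h1
  set M : V → _ := fun v => doubled (vertexKernel T v) (vertexKernel T' v) with hM
  -- the seed: its contraction is the numerator of the difference of the expectation values
  set K := doubled (opKernel T B O) (opKernel T' B 1) - doubled (opKernel T B 1) (opKernel T' B O)
    with hK
  have hopB : ∀ O, opKernel T' B O = opKernel T B O :=
    opKernel_congr fun v hv => hTT' v fun h => hAB v h hv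
  have hone : doubled (opKernel T B 1) (opKernel T' B 1) = ∏ v ∈ B, M v := by
    rw [opKernel_one, opKernel_one, doubled_prod]
  have hpeel := hN.peel hΔ h8 j B B B K (4 * ‖O‖) (by positivity) subset_rfl subset_rfl
    (fun v hv _ _ => Or.inr hv) hdist' hAB ?_ ?_
  · set Z := total (∏ v, vertexKernel T v) with hZ
    set Z' := total (∏ v, vertexKernel T' v) with hZ'
    have hZpos := total_vertexKernel_pos hD (by positivity) hT
    have hZpos' := total_vertexKernel_pos hD hlo hT'
    rw [← hZ] at hZpos
    rw [← hZ'] at hZpos'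
    have hZr : Z = (Z.re : ℂ) :=
      (isPSD_prod fun v (_ : v ∈ Finset.univ) => isPSD_vertexKernel T v).total_eq_re
    have hZr' : Z' = (Z'.re : ℂ) :=
      (isPSD_prod fun v (_ : v ∈ Finset.univ) => isPSD_vertexKernel T' v).total_eq_re
    have hZne : Z ≠ 0 := by rw [hZr]; exact_mod_cast hZpos.ne'
    have hZne' : Z' ≠ 0 := by rw [hZr']; exact_mod_cast hZpos'.ne'
    have hMtot : total (∏ v, M v) = ((Z.re * Z'.re : ℝ) : ℂ) := by
      rw [hM, ← doubled_prod, total_doubled, ← hZ, ← hZ', hZr, hZr']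
      push_cast
      simp
    have hKtot : total (K * ∏ v ∈ Bᶜ, M v)
        = total (opKernel T B O * ∏ v ∈ Bᶜ, vertexKernel T v) * Z'
          - Z * total (opKernel T' B O * ∏ v ∈ Bᶜ, vertexKernel T' v) := by
      rw [hM, ← doubled_prod, hK, sub_mul, total_sub, doubled_mul, doubled_mul, total_doubled,
        total_doubled, opKernel_one, opKernel_one, Finset.prod_mul_prod_compl,
        Finset.prod_mul_prod_compl]
    rw [hMtot, Complex.ofReal_re, hKtot] at hpeel
    have hdiff : expectation T' B O - expectation T B O
        = -(total (opKernel T B O * ∏ v ∈ Bᶜ, vertexKernel T v) * Z'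
          - Z * total (opKernel T' B O * ∏ v ∈ Bᶜ, vertexKernel T' v)) / (Z * Z') := by
      rw [expectation, expectation, star_stateVec_dotProduct_localOp,
        star_stateVec_dotProduct_localOp, star_stateVec_dotProduct_self,
        star_stateVec_dotProduct_self, ← hZ, ← hZ']
      field_simp
      ring
    rw [hdiff, norm_div, norm_neg, norm_mul, hZr, hZr', Complex.norm_real, Complex.norm_real,
      Real.norm_of_nonneg hZpos.le, Real.norm_of_nonneg hZpos'.le,
      div_le_iff₀ (mul_pos hZpos hZpos')]
    rwa [← hZr, ← hZr']
  · intro F hF z w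
    have hF' : ∀ v ∈ B, ∀ e ∈ G.incidenceSet v, e ∈ F := fun v hv e he => hF ⟨v, hv, he.2⟩
    have h2 : ∀ O : Matrix (B → Fin d) (B → Fin d) ℂ,
        opKernel T B O (replicaSwap F z).1 (replicaSwap F w).1 = opKernel T B O z.2 w.2 :=
      fun O => opKernel_congr_leg O (fun v hv => (leg_replicaSwap_of_subset (hF' v hv) z).1)
        fun v hv => (leg_replicaSwap_of_subset (hF' v hv) w).1
    have h3 : ∀ O : Matrix (B → Fin d) (B → Fin d) ℂ,
        opKernel T B O (replicaSwap F z).2 (replicaSwap F w).2 = opKernel T B O z.1 w.1 :=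
      fun O => opKernel_congr_leg O (fun v hv => (leg_replicaSwap_of_subset (hF' v hv) z).2)
        fun v hv => (leg_replicaSwap_of_subset (hF' v hv) w).2
    simp only [hK, hopB, Pi.sub_apply, doubled, h2, h3]
    ring
  · intro L hL
    have e1 : doubled (opKernel T B O) (opKernel T' B 1) * L
        = (fun z w => opKernel T B O z.1 w.1) * ((fun z w => opKernel T' B 1 z.2 w.2) * L) := by
      rw [← mul_assoc]
      rfl
    have e2 : doubled (opKernel T B 1) (opKernel T' B O) * L
        = (fun z w => opKernel T' B O z.2 w.2) * ((fun z w => opKernel T B 1 z.1 w.1) * L) := by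
      rw [← mul_assoc, mul_comm (fun z w => opKernel T' B O _ _)]
      rfl
    have b1 := norm_total_opKernel_mul_le T B Prod.fst
      ((isPSD_snd (isPSD_opKernel T' B PosSemidef.one)).mul hL) O
    have b2 := norm_total_opKernel_mul_le T' B Prod.snd
      ((isPSD_fst (isPSD_opKernel T B PosSemidef.one)).mul hL) O
    rw [← e1] at b1
    rw [← e2] at b2
    have g1 : (fun z w : (G.edgeSet → Fin D) × (G.edgeSet → Fin D) => opKernel T B 1 z.1 w.1)
        * ((fun z w => opKernel T' B 1 z.2 w.2) * L) = (∏ v ∈ B, M v) * L := by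
      rw [← hone, ← mul_assoc]
      rfl
    have g2 : (fun z w : (G.edgeSet → Fin D) × (G.edgeSet → Fin D) => opKernel T' B 1 z.2 w.2)
        * ((fun z w => opKernel T B 1 z.1 w.1) * L) = (∏ v ∈ B, M v) * L := by
      rw [← hone, ← mul_assoc, mul_comm (fun z w => opKernel T' B 1 _ _)]
      rfl
    rw [g1] at b1
    rw [g2] at b2
    rw [hK, sub_mul, total_sub]
    refine (norm_sub_le _ _).trans ((add_le_add b1 b2).trans_eq ?_)
    ring

end NormNetwork

/-! ### Contracting a tensor with messages on all legs but one -/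

section Contract

variable {ι : Type*} [Fintype ι] [DecidableEq ι] {D : ℕ}

/-- The contraction of `N` with the matrices `X m` on all legs `m ≠ n`. -/
def contract (N : Matrix (ι → Fin D) (ι → Fin D) ℂ) (n : ι)
    (X : ι → Matrix (Fin D) (Fin D) ℂ) : Matrix (Fin D) (Fin D) ℂ :=
  fun i j => ∑ x : ι → Fin D, ∑ y : ι → Fin D,
    if x n = i ∧ y n = j then N x y * ∏ m ∈ Finset.univ.erase n, X m (x m) (y m) else 0

theorem contract_congr {N : Matrix (ι → Fin D) (ι → Fin D) ℂ} {n : ι}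
    {X X' : ι → Matrix (Fin D) (Fin D) ℂ} (h : ∀ m, m ≠ n → X m = X' m) :
    contract N n X = contract N n X' := by
  funext i j
  simp only [contract]
  refine Finset.sum_congr rfl fun x _ => Finset.sum_congr rfl fun y _ => ?_
  rw [Finset.prod_congr rfl fun m hm => by rw [h m (Finset.ne_of_mem_erase hm)]]

theorem contract_sub (N N' : Matrix (ι → Fin D) (ι → Fin D) ℂ) (n : ι)
    (X : ι → Matrix (Fin D) (Fin D) ℂ) :
    contract (N - N') n X = contract N n X - contract N' n X := by
  ext i j
  simp only [contract, Matrix.sub_apply, ← Finset.sum_sub_distrib]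
  refine Finset.sum_congr rfl fun x _ => Finset.sum_congr rfl fun y _ => ?_
  split_ifs
  · ring
  · simp

theorem contract_smul (a : ℂ) (N : Matrix (ι → Fin D) (ι → Fin D) ℂ) (n : ι)
    (X : ι → Matrix (Fin D) (Fin D) ℂ) : contract (a • N) n X = a • contract N n X := by
  ext i j
  simp only [contract, Matrix.smul_apply, smul_eq_mul, Finset.mul_sum]
  refine Finset.sum_congr rfl fun x _ => Finset.sum_congr rfl fun y _ => ?_
  split_ifs
  · ring
  · simp

theorem contract_update_sub (N : Matrix (ι → Fin D) (ι → Fin D) ℂ) {n m : ι} (hm : m ≠ n)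
    (X : ι → Matrix (Fin D) (Fin D) ℂ) (P Q : Matrix (Fin D) (Fin D) ℂ) :
    contract N n (Function.update X m (P - Q))
      = contract N n (Function.update X m P) - contract N n (Function.update X m Q) := by
  have hmem : m ∈ Finset.univ.erase n := by simp [hm]
  have h : ∀ (Z : Matrix (Fin D) (Fin D) ℂ) (x y : ι → Fin D),
      ∏ k ∈ Finset.univ.erase n, Function.update X m Z k (x k) (y k)
        = Z (x m) (y m) * ∏ k ∈ (Finset.univ.erase n).erase m, X k (x k) (y k) := by
    intro Z x y
    rw [← Finset.mul_prod_erase _ _ hmem, Function.update_self]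
    congr 1
    refine Finset.prod_congr rfl fun k hk => ?_
    rw [Function.update_of_ne (Finset.ne_of_mem_erase hk)]
  ext i j
  simp only [contract, h, Matrix.sub_apply, ← Finset.sum_sub_distrib]
  refine Finset.sum_congr rfl fun x _ => Finset.sum_congr rfl fun y _ => ?_
  split_ifs
  · ring
  · simp

/-- The identity tensor sends the product of the messages to a multiple of the identity. -/
theorem contract_one (n : ι) (X : ι → Matrix (Fin D) (Fin D) ℂ) :
    contract 1 n X = (∏ m ∈ Finset.univ.erase n, (X m).trace) • 1 := by
  ext i j
  have h1 : contract 1 n X i j = ∑ x : ι → Fin D,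
      if x n = i ∧ x n = j then ∏ m ∈ Finset.univ.erase n, X m (x m) (x m) else 0 := by
    simp only [contract]
    refine Finset.sum_congr rfl fun x _ => ?_
    rw [Finset.sum_eq_single x]
    · simp
    · intro y _ hy
      simp [one_apply_ne hy.symm]
    · simp
  rw [h1, Matrix.smul_apply, smul_eq_mul]
  by_cases hij : i = j
  · subst hij
    rw [one_apply_eq, mul_one]
    have h2 : ∀ x : ι → Fin D,
        (if x n = i ∧ x n = i then ∏ m ∈ Finset.univ.erase n, X m (x m) (x m) else 0)
          = ∏ m, if m = n then (if x m = i then 1 else 0) else X m (x m) (x m) := by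
      intro x
      rw [← Finset.mul_prod_erase _ _ (Finset.mem_univ n), if_pos rfl, ite_mul, one_mul, zero_mul]
      refine if_congr (and_self_iff) ?_ rfl
      exact Finset.prod_congr rfl fun m hm => (if_neg (Finset.ne_of_mem_erase hm)).symm
    rw [Finset.sum_congr rfl fun x _ => h2 x]
    have h3 := Finset.prod_univ_sum (fun _ : ι => (Finset.univ : Finset (Fin D)))
      (fun m k => if m = n then (if k = i then (1 : ℂ) else 0) else X m k k)
    rw [Fintype.piFinset_univ] at h3
    rw [← h3, ← Finset.mul_prod_erase _ _ (Finset.mem_univ n)]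
    simp only [if_true, Finset.sum_ite_eq', Finset.mem_univ, one_mul]
    refine Finset.prod_congr rfl fun m hm => ?_
    simp only [if_neg (Finset.ne_of_mem_erase hm)]
    rfl
  · rw [one_apply_ne hij, mul_zero]
    refine Finset.sum_eq_zero fun x _ => if_neg ?_
    rintro ⟨h, h'⟩
    exact hij (h.symm.trans h')

/-- Contracting a positive semidefinite tensor with positive semidefinite messages is a completely
positive map: the Schur product with the messages, compressed to the remaining leg. -/
theorem contract_posSemidef {N : Matrix (ι → Fin D) (ι → Fin D) ℂ} (hN : N.PosSemidef) (n : ι)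
    {X : ι → Matrix (Fin D) (Fin D) ℂ} (hX : ∀ m, m ≠ n → (X m).PosSemidef) :
    (contract N n X).PosSemidef := by
  have hK : (Matrix.of fun x y : ι → Fin D =>
      N x y * ∏ m ∈ Finset.univ.erase n, X m (x m) (y m)).PosSemidef := by
    have h1 : IsPSD (∏ m ∈ Finset.univ.erase n, fun x y : ι → Fin D => X m (x m) (y m)) :=
      isPSD_prod fun m hm =>
        (hX m (Finset.ne_of_mem_erase hm)).submatrix fun x : ι → Fin D => x m
    have h2 := IsPSD.mul (K := fun x y => N x y) hN h1
    unfold IsPSD at h2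
    convert h2 using 1
    ext x y
    simp only [of_apply, Pi.mul_apply, prod_kernel_apply]
  set P : Matrix (ι → Fin D) (Fin D) ℂ := Matrix.of fun x i => if x n = i then 1 else 0 with hP
  convert hK.conjTranspose_mul_mul_same P using 1
  ext i j
  simp only [contract, mul_apply, Finset.sum_mul, conjTranspose_apply, hP, of_apply]
  rw [Finset.sum_comm]
  refine Finset.sum_congr rfl fun y _ => Finset.sum_congr rfl fun x _ => ?_
  by_cases h1 : x n = i <;> by_cases h2 : y n = j <;> simp [h1, h2]

theorem contract_one_of_trace_eq_one (n : ι) {X : ι → Matrix (Fin D) (Fin D) ℂ}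
    (hX : ∀ m, m ≠ n → (X m).trace = 1) : contract 1 n X = 1 := by
  rw [contract_one, Finset.prod_eq_one fun m hm => hX m (Finset.ne_of_mem_erase hm), one_smul]

theorem trace_one_fin : (1 : Matrix (Fin D) (Fin D) ℂ).trace = D := by simp

theorem le_trace_contract {N : Matrix (ι → Fin D) (ι → Fin D) ℂ} {lo : ℝ}
    (hlo : (N - (lo : ℂ) • 1).PosSemidef) (n : ι) {X : ι → Matrix (Fin D) (Fin D) ℂ}
    (hX : ∀ m, m ≠ n → (X m).PosSemidef ∧ (X m).trace = 1) :
    lo * D ≤ (contract N n X).trace.re := by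
  have h := (Complex.le_def.1 (contract_posSemidef hlo n fun m hm => (hX m hm).1).trace_nonneg).1
  rw [contract_sub, contract_smul, contract_one_of_trace_eq_one n fun m hm => (hX m hm).2,
    trace_sub, trace_smul, trace_one_fin, Complex.sub_re, smul_eq_mul, Complex.re_ofReal_mul,
    Complex.natCast_re, Complex.zero_re] at h
  linarith

theorem trace_eq_re {P : Matrix (Fin D) (Fin D) ℂ} (hP : P.PosSemidef) :
    P.trace = (P.trace.re : ℂ) :=
  Complex.ext rfl (by simpa using (Complex.le_def.1 hP.trace_nonneg).2.symm)

theorem traceNorm_smul_le {X : Matrix (Fin D) (Fin D) ℂ} (hX : X.IsHermitian) (a : ℝ) :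
    traceNorm ((a : ℂ) • X) ≤ |a| * traceNorm X := by
  obtain ⟨P, Q, hP, hQ, rfl, h⟩ := exists_posSemidef_sub hX
  rw [← h]
  rcases le_total 0 a with ha | ha
  · rw [smul_sub]
    refine (traceNorm_sub_le (posSemidef_ofReal_smul hP ha)
      (posSemidef_ofReal_smul hQ ha)).trans_eq ?_
    rw [trace_smul, trace_smul, smul_eq_mul, smul_eq_mul, Complex.re_ofReal_mul,
      Complex.re_ofReal_mul, abs_of_nonneg ha]
    ring
  · have e : (a : ℂ) • (P - Q) = ((-a : ℝ) : ℂ) • Q - ((-a : ℝ) : ℂ) • P := by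
      push_cast
      module
    rw [e]
    refine (traceNorm_sub_le (posSemidef_ofReal_smul hQ (neg_nonneg.2 ha))
      (posSemidef_ofReal_smul hP (neg_nonneg.2 ha))).trans_eq ?_
    rw [trace_smul, trace_smul, smul_eq_mul, smul_eq_mul, Complex.re_ofReal_mul,
      Complex.re_ofReal_mul, abs_of_nonpos ha]
    ring

theorem abs_trace_re_le {X : Matrix (Fin D) (Fin D) ℂ} (hX : X.IsHermitian) :
    |X.trace.re| ≤ traceNorm X := by
  obtain ⟨P, Q, hP, hQ, rfl, h⟩ := exists_posSemidef_sub hX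
  have h1 := (Complex.le_def.1 hP.trace_nonneg).1
  have h2 := (Complex.le_def.1 hQ.trace_nonneg).1
  simp only [Complex.zero_re] at h1 h2
  rw [← h, trace_sub, Complex.sub_re, abs_le]
  constructor <;> linarith

/-- Normalizing the trace is Lipschitz on positive semidefinite matrices of trace at least `L`. -/
theorem traceNorm_normalize_sub_le {a b : Matrix (Fin D) (Fin D) ℂ} (ha : a.PosSemidef)
    (hb : b.PosSemidef) {L : ℝ} (hL : 0 < L) (hLa : L ≤ a.trace.re) (hLb : L ≤ b.trace.re) :
    traceNorm (a.trace⁻¹ • a - b.trace⁻¹ • b) ≤ 2 * traceNorm (a - b) / L := by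
  have hab : (a - b).IsHermitian := ha.1.sub hb.1
  rw [trace_eq_re ha, trace_eq_re hb]
  generalize hα : a.trace.re = α at *
  generalize hβ : b.trace.re = β at *
  have hα0 : 0 < α := hL.trans_le hLa
  have hβ0 : 0 < β := hL.trans_le hLb
  have e : (α : ℂ)⁻¹ • a - (β : ℂ)⁻¹ • b
      = ((α⁻¹ : ℝ) : ℂ) • (a - b) + (((β - α) / (α * β) : ℝ) : ℂ) • b := by
    have h1 : ((β - α) / (α * β) : ℝ) = α⁻¹ - β⁻¹ := by
      field_simp
    rw [h1]
    push_cast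
    module
  have h2 : |β - α| ≤ traceNorm (a - b) := by
    have := abs_trace_re_le hab
    rwa [trace_sub, Complex.sub_re, hα, hβ, abs_sub_comm] at this
  have hherm : ∀ (r : ℝ) {X : Matrix (Fin D) (Fin D) ℂ}, X.IsHermitian →
      ((r : ℂ) • X).IsHermitian := by
    intro r X hX
    rw [IsHermitian, conjTranspose_smul, hX.eq]
    simp
  rw [e]
  refine (traceNorm_add_le (hherm _ hab) (hherm _ hb.1)).trans ?_
  have h3 := traceNorm_smul_le hab α⁻¹
  have h4 := traceNorm_smul_le hb.1 ((β - α) / (α * β))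
  have h5 := traceNorm_le_trace hb
  rw [hβ] at h5
  have h6 : |(β - α) / (α * β)| * traceNorm b ≤ traceNorm (a - b) / α := by
    rw [abs_div, abs_of_pos (mul_pos hα0 hβ0), div_mul_eq_mul_div,
      div_le_div_iff₀ (by positivity) hα0]
    calc |β - α| * traceNorm b * α ≤ traceNorm (a - b) * β * α :=
          mul_le_mul_of_nonneg_right
            (mul_le_mul h2 h5 (traceNorm_nonneg b) (traceNorm_nonneg (a - b))) hα0.le
      _ = _ := by ring
  rw [abs_of_pos (inv_pos.2 hα0), inv_mul_eq_div] at h3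
  have h7 : traceNorm (a - b) / α ≤ traceNorm (a - b) / L :=
    div_le_div_of_nonneg_left (traceNorm_nonneg _) hL hLa
  have : 2 * traceNorm (a - b) / L = traceNorm (a - b) / L + traceNorm (a - b) / L := by ring
  linarith

/-- Changing one message changes the contraction only through `hi - N`: the identity part sees
only the trace of the message. -/
theorem traceNorm_contract_update_sub_le {N : Matrix (ι → Fin D) (ι → Fin D) ℂ} {lo hi : ℝ}
    (hlo : (N - (lo : ℂ) • 1).PosSemidef) (hhi : ((hi : ℂ) • 1 - N).PosSemidef) {n m : ι}
    (hm : m ≠ n) {X : ι → Matrix (Fin D) (Fin D) ℂ}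
    (hX : ∀ k, k ≠ n → (X k).PosSemidef ∧ (X k).trace = 1)
    {Y Y' : Matrix (Fin D) (Fin D) ℂ} (hY : Y.IsHermitian) (hY' : Y'.IsHermitian)
    (htr : Y.trace = Y'.trace) :
    traceNorm (contract N n (Function.update X m Y) - contract N n (Function.update X m Y'))
      ≤ (hi - lo) * D * traceNorm (Y - Y') := by
  obtain ⟨P, Q, hP, hQ, hPQ, h⟩ := exists_posSemidef_sub (hY.sub hY')
  have htrPQ : P.trace = Q.trace := by
    have := congrArg trace hPQ
    rw [trace_sub, trace_sub, htr, sub_self] at this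
    exact (sub_eq_zero.1 this.symm)
  have hone : ∀ Z, contract 1 n (Function.update X m Z) = Z.trace • 1 := by
    intro Z
    have hmem : m ∈ Finset.univ.erase n := by simp [hm]
    rw [contract_one, ← Finset.mul_prod_erase _ _ hmem, Function.update_self,
      Finset.prod_eq_one, mul_one]
    intro k hk
    rw [Function.update_of_ne (Finset.ne_of_mem_erase hk)]
    exact (hX k (Finset.ne_of_mem_erase (Finset.mem_of_mem_erase hk))).2
  have hupd : ∀ {Z : Matrix (Fin D) (Fin D) ℂ}, Z.PosSemidef →
      ∀ k, k ≠ n → (Function.update X m Z k).PosSemidef := by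
    intro Z hZ k hk
    by_cases hkm : k = m
    · subst hkm
      rwa [Function.update_self]
    · rw [Function.update_of_ne hkm]
      exact (hX k hk).1
  have htrE : ∀ {Z : Matrix (Fin D) (Fin D) ℂ}, Z.PosSemidef →
      (contract ((hi : ℂ) • 1 - N) n (Function.update X m Z)).trace.re
        ≤ (hi - lo) * D * Z.trace.re := by
    intro Z hZ
    have h1 := (Complex.le_def.1 (contract_posSemidef hlo n (hupd hZ)).trace_nonneg).1
    rw [contract_sub, contract_smul, hone, trace_sub] at h1
    rw [contract_sub, contract_smul, hone, trace_sub]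
    simp only [trace_smul, trace_one_fin, smul_eq_mul, Complex.sub_re, Complex.zero_re,
      Complex.mul_re, Complex.natCast_re, Complex.natCast_im, mul_zero,
      sub_zero, Complex.ofReal_re, Complex.ofReal_im, zero_mul] at h1 ⊢
    linarith
  -- `P` and `Q` have equal traces, so the identity part of `N = hi - (hi - N)` cancels
  have hkey : contract N n (Function.update X m Y) - contract N n (Function.update X m Y')
      = contract ((hi : ℂ) • 1 - N) n (Function.update X m Q)
        - contract ((hi : ℂ) • 1 - N) n (Function.update X m P) := by
    rw [← contract_update_sub N hm, hPQ, contract_update_sub N hm, contract_sub, contract_sub,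
      contract_smul, contract_smul, hone, hone, htrPQ]
    abel
  rw [hkey, ← h]
  refine (traceNorm_sub_le (contract_posSemidef hhi n (hupd hQ))
    (contract_posSemidef hhi n (hupd hP))).trans ?_
  have := htrE hP
  have := htrE hQ
  linarith

/-- The normalized outgoing message as a function of the incoming ones. -/
def outMessage (N : Matrix (ι → Fin D) (ι → Fin D) ℂ) (n : ι)
    (X : ι → Matrix (Fin D) (Fin D) ℂ) : Matrix (Fin D) (Fin D) ℂ :=
  (contract N n X).trace⁻¹ • contract N n X

theorem outMessage_normalized (hD : 1 ≤ D) {N : Matrix (ι → Fin D) (ι → Fin D) ℂ} {lo : ℝ}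
    (hlo0 : 0 < lo) (hN : N.PosSemidef) (hlo : (N - (lo : ℂ) • 1).PosSemidef) (n : ι)
    {X : ι → Matrix (Fin D) (Fin D) ℂ}
    (hX : ∀ m, m ≠ n → (X m).PosSemidef ∧ (X m).trace = 1) :
    (outMessage N n X).PosSemidef ∧ (outMessage N n X).trace = 1 := by
  have hD' : (1 : ℝ) ≤ D := by exact_mod_cast hD
  have hpsd := contract_posSemidef hN n fun m hm => (hX m hm).1
  have hpos : 0 < (contract N n X).trace.re :=
    lt_of_lt_of_le (by positivity) (le_trace_contract hlo n hX)
  have hne : (contract N n X).trace ≠ 0 := by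
    rw [trace_eq_re hpsd]
    exact_mod_cast hpos.ne'
  refine ⟨?_, ?_⟩
  · rw [outMessage, trace_eq_re hpsd, ← Complex.ofReal_inv]
    exact posSemidef_ofReal_smul hpsd (inv_nonneg.2 hpos.le)
  · rw [outMessage, trace_smul, smul_eq_mul, inv_mul_cancel₀ hne]

/-- Telescoping over the legs in `s`, whose messages are exchanged one at a time. -/
theorem traceNorm_outMessage_piecewise_sub_le (hD : 1 ≤ D)
    {N : Matrix (ι → Fin D) (ι → Fin D) ℂ} {lo hi : ℝ} (hlo0 : 0 < lo) (hN : N.PosSemidef)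
    (hlo : (N - (lo : ℂ) • 1).PosSemidef) (hhi : ((hi : ℂ) • 1 - N).PosSemidef) {n : ι}
    {X X' : ι → Matrix (Fin D) (Fin D) ℂ}
    (hX : ∀ k, k ≠ n → (X k).PosSemidef ∧ (X k).trace = 1)
    (hX' : ∀ k, k ≠ n → (X' k).PosSemidef ∧ (X' k).trace = 1) (s : Finset ι)
    (hs : n ∉ s) :
    traceNorm (outMessage N n (s.piecewise X' X) - outMessage N n X)
      ≤ 2 * (hi - lo) / lo * ∑ m ∈ s, traceNorm (X' m - X m) := by
  have hD' : (1 : ℝ) ≤ D := by exact_mod_cast hD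
  induction s using Finset.induction_on with
  | empty =>
    rw [Finset.piecewise_empty, sub_self, Finset.sum_empty, mul_zero]
    simpa using traceNorm_le_trace (PosSemidef.zero (n := Fin D) (R := ℂ))
  | insert m s hms ih =>
    have hm : m ≠ n := by rintro rfl; exact hs (Finset.mem_insert_self _ _)
    have ih := ih fun h => hs (Finset.mem_insert_of_mem h)
    set Z := s.piecewise X' X with hZdef
    have hZ : ∀ k, k ≠ n → (Z k).PosSemidef ∧ (Z k).trace = 1 := by
      intro k hk
      by_cases hks : k ∈ s
      · rw [hZdef, Finset.piecewise_eq_of_mem _ _ _ hks]; exact hX' k hk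
      · rw [hZdef, Finset.piecewise_eq_of_notMem _ _ _ hks]; exact hX k hk
    have hZm : Z = Function.update Z m (X m) := by
      rw [eq_comm, Function.update_eq_self_iff, hZdef, Finset.piecewise_eq_of_notMem _ _ _ hms]
    have hZ' : ∀ k, k ≠ n → (Function.update Z m (X' m) k).PosSemidef ∧
        (Function.update Z m (X' m) k).trace = 1 := by
      intro k hk
      by_cases hkm : k = m
      · subst hkm
        rw [Function.update_self]; exact hX' k hk
      · rw [Function.update_of_ne hkm]; exact hZ k hk
    rw [Finset.piecewise_insert, ← hZdef, Finset.sum_insert hms, mul_add]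
    have hstep : traceNorm (outMessage N n (Function.update Z m (X' m)) - outMessage N n Z)
        ≤ 2 * (hi - lo) / lo * traceNorm (X' m - X m) := by
      have h1 := traceNorm_normalize_sub_le
        (contract_posSemidef hN n fun k hk => (hZ' k hk).1)
        (contract_posSemidef hN n fun k hk => (hZ k hk).1) (L := lo * D) (by positivity)
        (le_trace_contract hlo n hZ') (le_trace_contract hlo n hZ)
      have h2 := traceNorm_contract_update_sub_le hlo hhi hm hZ (hX' m hm).1.1 (hX m hm).1.1
        ((hX' m hm).2.trans (hX m hm).2.symm)
      rw [← hZm] at h2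
      refine h1.trans ?_
      rw [div_le_iff₀ (by positivity)]
      calc _ ≤ 2 * ((hi - lo) * D * traceNorm (X' m - X m)) := by gcongr
        _ = _ := by field_simp
    have e : outMessage N n (Function.update Z m (X' m)) - outMessage N n X
        = (outMessage N n (Function.update Z m (X' m)) - outMessage N n Z)
          + (outMessage N n Z - outMessage N n X) := by abel
    rw [e]
    have hh : ∀ {W : ι → Matrix (Fin D) (Fin D) ℂ},
        (∀ k, k ≠ n → (W k).PosSemidef ∧ (W k).trace = 1) → (outMessage N n W).IsHermitian :=
      fun hW => (outMessage_normalized hD hlo0 hN hlo n hW).1.1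
    exact (traceNorm_add_le ((hh hZ').sub (hh hZ)) ((hh hZ).sub (hh hX))).trans
      (add_le_add hstep ih)

/-- The outgoing message is Lipschitz in the incoming ones, with constant `2 (hi - lo) / lo` on each
leg. -/
theorem traceNorm_outMessage_sub_le (hD : 1 ≤ D)
    {N : Matrix (ι → Fin D) (ι → Fin D) ℂ} {lo hi : ℝ} (hlo0 : 0 < lo) (hN : N.PosSemidef)
    (hlo : (N - (lo : ℂ) • 1).PosSemidef) (hhi : ((hi : ℂ) • 1 - N).PosSemidef) {n : ι}
    {X X' : ι → Matrix (Fin D) (Fin D) ℂ}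
    (hX : ∀ k, k ≠ n → (X k).PosSemidef ∧ (X k).trace = 1)
    (hX' : ∀ k, k ≠ n → (X' k).PosSemidef ∧ (X' k).trace = 1) :
    traceNorm (outMessage N n X' - outMessage N n X)
      ≤ 2 * (hi - lo) / lo * ∑ m ∈ Finset.univ.erase n, traceNorm (X' m - X m) := by
  have h := traceNorm_outMessage_piecewise_sub_le hD hlo0 hN hlo hhi hX hX'
    (Finset.univ.erase n) (Finset.notMem_erase _ _)
  have e : contract N n ((Finset.univ.erase n).piecewise X' X) = contract N n X' :=
    contract_congr fun m hm => Finset.piecewise_eq_of_mem _ _ _ (by simp [hm])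
  rwa [outMessage, e] at h

end Contract

/-! ### Belief-propagation fixed points -/

section FixedPoint

variable {V : Type u} [Fintype V] [DecidableEq V] {G : SimpleGraph V} [DecidableRel G.Adj]
  {D d : ℕ}

/-- `doubleTensor` has its ket indices first, hence the transpose. -/
theorem doubleTensor_eq (T : PEPS G D d) (v : V) (x y : G.neighborSet v → Fin D) :
    doubleTensor T v x y = ((T v)ᴴ * T v)ᵀ x y := by
  rw [transpose_apply, mul_apply, doubleTensor]
  exact Finset.sum_congr rfl fun s _ => by rw [conjTranspose_apply, mul_comm]

theorem update_eq_outMessage (T : PEPS G D d) (μ : Messages G D) (e : G.Dart) :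
    update T μ e = outMessage ((T e.fst)ᴴ * T e.fst)ᵀ (⟨e.snd, e.adj⟩ : G.neighborSet e.fst)
      fun m => μ (inDart e.fst m) := by
  have : rawUpdate T μ e = contract ((T e.fst)ᴴ * T e.fst)ᵀ
      (⟨e.snd, e.adj⟩ : G.neighborSet e.fst) fun m => μ (inDart e.fst m) := by
    funext i j
    simp only [rawUpdate, contract, doubleTensor_eq]
  rw [update, outMessage, this]

variable {T T' : PEPS G D d} {lo hi : ℝ}

theorem HasBounds.transpose {m n : Type*} [Fintype m] [DecidableEq n] {T : Matrix m n ℂ}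
    (h : HasBounds lo hi T) :
    ((Tᴴ * T)ᵀ - (lo : ℂ) • 1).PosSemidef ∧ ((hi : ℂ) • 1 - (Tᴴ * T)ᵀ).PosSemidef := by
  have h1 := h.1.transpose
  have h2 := h.2.transpose
  rw [transpose_sub, transpose_smul, transpose_one] at h1 h2
  exact ⟨h1, h2⟩

theorem isNormalized_update (hD : 1 ≤ D) (hlo : 0 < lo) (hT : ∀ v, HasBounds lo hi (T v))
    {μ : Messages G D} (hμ : IsNormalized μ) : IsNormalized (update T μ) := by
  intro e
  rw [update_eq_outMessage]
  exact outMessage_normalized hD hlo (posSemidef_conjTranspose_mul_self _).transpose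
    (hT e.fst).transpose.1 _ fun m _ => hμ _

theorem traceNorm_update_sub_le (hD : 1 ≤ D) {Δ : ℕ} (hΔ : ∀ v, G.degree v ≤ Δ) (hlo : 0 < lo)
    (hhi : lo ≤ hi) {e : G.Dart} (hT : HasBounds lo hi (T e.fst)) {μ ν : Messages G D}
    (hμ : IsNormalized μ) (hν : IsNormalized ν) {B : ℝ}
    (hB : ∀ m : G.neighborSet e.fst, traceNorm (μ (inDart e.fst m) - ν (inDart e.fst m)) ≤ B) :
    traceNorm (update T μ e - update T ν e) ≤ 2 * (hi - lo) / lo * (Δ - 1) * B := by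
  rw [update_eq_outMessage, update_eq_outMessage]
  refine (traceNorm_outMessage_sub_le hD hlo (posSemidef_conjTranspose_mul_self _).transpose
    hT.transpose.1 hT.transpose.2 (fun m _ => hν _) fun m _ => hμ _).trans ?_
  rw [mul_assoc]
  have hB0 : 0 ≤ B := (traceNorm_nonneg _).trans (hB ⟨e.snd, e.adj⟩)
  refine mul_le_mul_of_nonneg_left ?_ (div_nonneg (by linarith) hlo.le)
  refine (Finset.sum_le_sum fun m _ => hB m).trans ?_
  rw [Finset.sum_const, Finset.card_erase_of_mem (Finset.mem_univ _), Finset.card_univ,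
    G.card_neighborSet_eq_degree, nsmul_eq_mul]
  refine mul_le_mul_of_nonneg_right ?_ hB0
  have h1 : 1 ≤ G.degree e.fst := by
    rw [← G.card_neighborSet_eq_degree]
    exact Fintype.card_pos_iff.2 ⟨⟨e.snd, e.adj⟩⟩
  rw [Nat.cast_sub h1]
  have : (G.degree e.fst : ℝ) ≤ Δ := by exact_mod_cast hΔ e.fst
  push_cast
  linarith

theorem traceNorm_sub_le_two {μ ν : Messages G D} (hμ : IsNormalized μ) (hν : IsNormalized ν)
    (e : G.Dart) : traceNorm (μ e - ν e) ≤ 2 := by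
  refine (traceNorm_sub_le (hμ e).1 (hν e).1).trans_eq ?_
  rw [(hμ e).2, (hν e).2]
  norm_num

theorem eq_of_traceNorm_sub_le_zero {X Y : Matrix (Fin D) (Fin D) ℂ} (hX : X.IsHermitian)
    (hY : Y.IsHermitian) (h : traceNorm (X - Y) ≤ 0) : X = Y := by
  ext i j
  have := (norm_entry_le_traceNorm (hX.sub hY) i j).trans h
  exact sub_eq_zero.1 (norm_le_zero_iff.1 this)

/-- Message passing is a contraction in the maximum over the edges of the trace norm, and hence has
exactly one fixed point. -/
theorem existsUnique_isFixedPoint (hD : 1 ≤ D) {Δ : ℕ} (hΔ1 : 1 ≤ Δ) (hΔ : ∀ v, G.degree v ≤ Δ)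
    (hlo : 0 < lo) (hhi : lo ≤ hi) (hT : ∀ v, HasBounds lo hi (T v))
    (hρ : 2 * (hi - lo) / lo * (Δ - 1) < 1) : ∃! μ : Messages G D, IsFixedPoint T μ := by
  set ρ : ℝ := 2 * (hi - lo) / lo * (Δ - 1) with hρdef
  have hΔ1' : (1 : ℝ) ≤ Δ := by exact_mod_cast hΔ1
  have hρ0 : 0 ≤ ρ := mul_nonneg (div_nonneg (by linarith) hlo.le) (by linarith)
  have hD' : (0 : ℝ) < D := by exact_mod_cast hD
  have hstep : ∀ {μ ν : Messages G D} {B : ℝ}, IsNormalized μ → IsNormalized ν →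
      (∀ e, traceNorm (μ e - ν e) ≤ B) → ∀ e, traceNorm (update T μ e - update T ν e) ≤ ρ * B :=
    fun hμ hν hB e => traceNorm_update_sub_le hD hΔ hlo hhi (hT e.fst) hμ hν fun m => hB _
  -- The trace norm is not an instance, so the fixed point is built as an entrywise limit of the
  -- iterates of the maximally mixed messages.
  set x₀ : Messages G D := fun _ => (((D : ℝ)⁻¹ : ℝ) : ℂ) • 1 with hx₀
  have hx₀n : IsNormalized x₀ := by
    intro e
    refine ⟨posSemidef_ofReal_smul PosSemidef.one (by positivity), ?_⟩
    rw [hx₀, trace_smul, trace_one_fin, smul_eq_mul]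
    push_cast
    exact inv_mul_cancel₀ (by exact_mod_cast hD'.ne')
  set x : ℕ → Messages G D := fun n => (update T)^[n] x₀ with hx
  have hxs : ∀ n, x (n + 1) = update T (x n) := fun n => Function.iterate_succ_apply' _ _ _
  have hxn : ∀ n, IsNormalized (x n) := by
    intro n
    induction n with
    | zero => exact hx₀n
    | succ n ih => rw [hxs]; exact isNormalized_update hD hlo hT ih
  have hdist : ∀ n e, traceNorm (x n e - x (n + 1) e) ≤ 2 * ρ ^ n := by
    intro n
    induction n with
    | zero => intro e; simpa using traceNorm_sub_le_two (hxn 0) (hxn 1) e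
    | succ n ih =>
      intro e
      have := hstep (hxn n) (hxn (n + 1)) ih e
      rw [← hxs, ← hxs] at this
      refine this.trans_eq ?_
      ring
  have hcauchy : ∀ e i j, CauchySeq fun n => x n e i j := by
    intro e i j
    refine cauchySeq_of_le_geometric ρ 2 hρ fun n => ?_
    rw [dist_eq_norm]
    exact (norm_entry_le_traceNorm ((hxn n e).1.1.sub (hxn (n + 1) e).1.1) i j).trans (hdist n e)
  obtain ⟨lim, hlim⟩ : ∃ lim : Messages G D, ∀ e i j,
      Filter.Tendsto (fun n => x n e i j) Filter.atTop (nhds (lim e i j)) := by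
    choose lim hlim using fun e i j => cauchySeq_tendsto_of_complete (hcauchy e i j)
    exact ⟨lim, hlim⟩
  have hlim' : Filter.Tendsto x Filter.atTop (nhds lim) := by
    refine tendsto_pi_nhds.2 fun e => tendsto_pi_nhds.2 fun i => tendsto_pi_nhds.2 fun j => ?_
    exact hlim e i j
  have hnorm : IsNormalized lim := by
    intro e
    have he : Filter.Tendsto (fun n => x n e) Filter.atTop (nhds (lim e)) :=
      tendsto_pi_nhds.1 hlim' e
    have hlimit : ∀ {F : Matrix (Fin D) (Fin D) ℂ → ℂ}, Continuous F →
        Filter.Tendsto (fun n => F (x n e)) Filter.atTop (nhds (F (lim e))) :=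
      fun hF => (hF.tendsto _).comp he
    refine ⟨PosSemidef.of_dotProduct_mulVec_nonneg ?_ fun v => ?_, ?_⟩
    · ext i j
      refine tendsto_nhds_unique (hlimit (F := fun Z => Zᴴ i j) ?_) ?_
      · exact (continuous_id.matrix_conjTranspose).matrix_elem i j
      · simpa only [fun n => (hxn n e).1.1.eq] using hlim e i j
    · refine ge_of_tendsto' (hlimit (F := fun Z => star v ⬝ᵥ (Z *ᵥ v)) ?_) fun n =>
        (hxn n e).1.dotProduct_mulVec_nonneg v
      exact continuous_const.dotProduct (continuous_id.matrix_mulVec continuous_const)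
    · refine tendsto_nhds_unique (hlimit (F := trace) continuous_id.matrix_trace) ?_
      simp only [fun n => (hxn n e).2]
      exact tendsto_const_nhds
  have hcont : Filter.Tendsto (fun n => update T (x n)) Filter.atTop (nhds (update T lim)) := by
    refine tendsto_pi_nhds.2 fun e => ?_
    have hraw : Continuous fun μ : Messages G D => rawUpdate T μ e := by
      refine continuous_pi fun i => continuous_pi fun j => ?_
      unfold rawUpdate
      refine continuous_finsetSum _ fun a _ => continuous_finsetSum _ fun b _ => ?_
      split_ifs
      · refine continuous_const.mul (continuous_finsetProd _ fun m _ => ?_)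
        exact (continuous_apply (inDart e.fst m)).matrix_elem _ _
      · exact continuous_const
    have hne : (rawUpdate T lim e).trace ≠ 0 := by
      intro h0
      have := (isNormalized_update hD hlo hT hnorm e).2
      rw [update, h0, _root_.inv_zero, zero_smul, trace_zero] at this
      exact zero_ne_one this
    have hr := (hraw.tendsto lim).comp hlim'
    have htr := (hraw.matrix_trace.tendsto lim).comp hlim'
    exact (htr.inv₀ hne).smul hr
  have hfix : update T lim = lim := by
    refine tendsto_nhds_unique hcont ?_
    simp only [← hxs]
    exact hlim'.comp (Filter.tendsto_add_atTop_nat 1)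
  refine ⟨lim, ⟨hnorm, hfix⟩, ?_⟩
  rintro ν ⟨hν, hνfix⟩
  have hpow : ∀ n e, traceNorm (ν e - lim e) ≤ ρ ^ n * 2 := by
    intro n
    induction n with
    | zero => intro e; simpa using traceNorm_sub_le_two hν hnorm e
    | succ n ih =>
      intro e
      have := hstep hν hnorm ih e
      rw [hνfix, hfix] at this
      refine this.trans_eq ?_
      ring
  funext e
  refine eq_of_traceNorm_sub_le_zero (hν e).1.1 (hnorm e).1.1 ?_
  have h0 : Filter.Tendsto (fun n : ℕ => ρ ^ n * 2) Filter.atTop (nhds (0 * 2)) :=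
    (tendsto_pow_atTop_nhds_zero_of_lt_one hρ0 hρ).mul_const 2
  rw [zero_mul] at h0
  exact ge_of_tendsto' h0 fun n => hpow n e

/-- Fixed points of networks that agree off `A` agree up to `q ^ r` at distance `r` from `A`: away
from `A` both messages are images under the same contraction. -/
theorem traceNorm_fixedPoint_sub_le (hD : 1 ≤ D) {Δ : ℕ} (hΔ : ∀ v, G.degree v ≤ Δ)
    (hlo : 0 < lo) (hhi : lo ≤ hi) (hT : ∀ v, HasBounds lo hi (T v)) {A : Finset V}
    (hTT' : ∀ v, v ∉ A → T' v = T v) {μ μ' : Messages G D} (hμ : IsFixedPoint T μ)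
    (hμ' : IsFixedPoint T' μ') (r : ℕ) :
    ∀ e : G.Dart, (r : ℕ∞) ≤ setDist G {e.fst} A →
      traceNorm (μ' e - μ e) ≤ 2 * (2 * (hi - lo) / lo * (Δ - 1)) ^ r := by
  induction r with
  | zero => intro e _; simpa using traceNorm_sub_le_two hμ'.1 hμ.1 e
  | succ r ih =>
    intro e he
    have hdist : ∀ a ∈ A, ((r + 1 : ℕ) : ℕ∞) ≤ G.edist e.fst a := fun a ha =>
      he.trans ((iInf₂_le e.fst (Set.mem_singleton _)).trans (iInf₂_le a ha))
    have heA : e.fst ∉ A := by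
      intro h
      have := hdist _ h
      simp at this
    have h1 : update T' μ' e = update T μ' e := by
      rw [update_eq_outMessage, update_eq_outMessage, hTT' _ heA]
    have h2 : μ' e = update T μ' e := by rw [← h1, hμ'.2]
    have h3 : μ e = update T μ e := by rw [hμ.2]
    rw [h2, h3]
    refine (traceNorm_update_sub_le hD hΔ hlo hhi (hT e.fst) hμ'.1 hμ.1 fun m => ih _ ?_).trans_eq
      (by ring)
    refine le_iInf₂ fun w hw => le_iInf₂ fun a ha => ?_
    rw [Set.mem_singleton_iff.1 hw]
    have h4 := hdist a ha
    have h5 : G.edist e.fst a ≤ 1 + G.edist (m : V) a := by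
      have := G.edist_triangle (u := e.fst) (v := m) (w := a)
      rwa [SimpleGraph.edist_eq_one_iff_adj.2 m.2] at this
    have h6 : ((r + 1 : ℕ) : ℕ∞) = 1 + (r : ℕ∞) := by push_cast; exact add_comm _ _
    rw [h6] at h4
    exact (ENat.add_le_add_iff_left (by simp)).1 (h4.trans h5)

end FixedPoint

/-! ### Contractions of tensors close to the identity -/

section Tensor

variable {ι : Type*} [Fintype ι] [DecidableEq ι] {D : ℕ}

/-- The full contraction of a tensor with one matrix per leg. -/
def contractAll (N : Matrix (ι → Fin D) (ι → Fin D) ℂ) (g : ι → Fin D → Fin D → ℂ) : ℂ :=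
  ∑ x : ι → Fin D, ∑ y : ι → Fin D, N x y * ∏ n, g n (x n) (y n)

theorem card_config_le (hD : 1 ≤ D) {Δ : ℕ} (hι : Fintype.card ι ≤ Δ) :
    (Fintype.card (ι → Fin D) : ℝ) ≤ (D : ℝ) ^ Δ := by
  rw [Fintype.card_fun, Fintype.card_fin]
  push_cast
  exact pow_le_pow_right₀ (by exact_mod_cast hD) hι

theorem norm_sum_config_le (hD : 1 ≤ D) {Δ : ℕ} (hι : Fintype.card ι ≤ Δ)
    (f : (ι → Fin D) → (ι → Fin D) → ℂ) {b : ℝ} (hb : ∀ x y, ‖f x y‖ ≤ b) (hb0 : 0 ≤ b) :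
    ‖∑ x, ∑ y, f x y‖ ≤ (D : ℝ) ^ (2 * Δ) * b := by
  have hc := card_config_le (ι := ι) hD hι
  calc ‖∑ x, ∑ y, f x y‖ ≤ ∑ _x : ι → Fin D, ∑ _y : ι → Fin D, b :=
        (norm_sum_le _ _).trans (Finset.sum_le_sum fun x _ => (norm_sum_le _ _).trans
          (Finset.sum_le_sum fun y _ => hb x y))
    _ = Fintype.card (ι → Fin D) * (Fintype.card (ι → Fin D) * b) := by
        simp only [Finset.sum_const, Finset.card_univ, nsmul_eq_mul]
    _ ≤ (D : ℝ) ^ Δ * ((D : ℝ) ^ Δ * b) := by gcongr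
    _ = _ := by rw [two_mul, pow_add, mul_assoc]

theorem contractAll_one (g : ι → Fin D → Fin D → ℂ) :
    contractAll 1 g = ∏ n, ∑ i, g n i i := by
  rw [Finset.prod_univ_sum, Fintype.piFinset_univ, contractAll]
  refine Finset.sum_congr rfl fun x _ => ?_
  rw [Finset.sum_eq_single x]
  · rw [one_apply_eq, one_mul]
  · intro y _ hy
    rw [one_apply_ne hy.symm, zero_mul]
  · simp

/-- Replacing a nearly identical tensor by the identity, the full contraction factorizes into
traces up to `O(ε)`. -/
theorem norm_contractAll_sub_le (hD : 1 ≤ D) {Δ : ℕ} (hι : Fintype.card ι ≤ Δ)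
    {N : Matrix (ι → Fin D) (ι → Fin D) ℂ} {ε : ℝ}
    (hN : ∀ x y, ‖(1 - N) x y‖ ≤ ε) {g : ι → Fin D → Fin D → ℂ} {b : ℝ}
    (hb : 1 ≤ b) (hg : ∀ n i j, ‖g n i j‖ ≤ b) :
    ‖contractAll N g - ∏ n, ∑ i, g n i i‖ ≤ (D : ℝ) ^ (2 * Δ) * (ε * b ^ Δ) := by
  have hε : 0 ≤ ε := (norm_nonneg _).trans (hN (fun _ => ⟨0, hD⟩) fun _ => ⟨0, hD⟩)
  have h : contractAll N g - ∏ n, ∑ i, g n i i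
      = ∑ x, ∑ y, -((1 - N) x y * ∏ n, g n (x n) (y n)) := by
    rw [← contractAll_one, contractAll, contractAll, ← Finset.sum_sub_distrib]
    refine Finset.sum_congr rfl fun x _ => ?_
    rw [← Finset.sum_sub_distrib]
    refine Finset.sum_congr rfl fun y _ => ?_
    rw [Matrix.sub_apply]
    ring
  rw [h]
  refine norm_sum_config_le hD hι _ (fun x y => ?_) (by positivity)
  rw [norm_neg, norm_mul, norm_prod]
  refine mul_le_mul (hN x y) ?_ (by positivity) hε
  refine (Finset.prod_le_prod (fun _ _ => norm_nonneg _) fun n _ => hg n _ _).trans ?_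
  rw [Finset.prod_const, Finset.card_univ]
  exact pow_le_pow_right₀ hb hι

theorem norm_contract_apply_le (hD : 1 ≤ D) {Δ : ℕ} (hι : Fintype.card ι ≤ Δ)
    {N : Matrix (ι → Fin D) (ι → Fin D) ℂ} {ε : ℝ} (hN : ∀ x y, ‖N x y‖ ≤ ε) (n : ι)
    {X : ι → Matrix (Fin D) (Fin D) ℂ} (hX : ∀ m i j, ‖X m i j‖ ≤ 1) (i j : Fin D) :
    ‖contract N n X i j‖ ≤ (D : ℝ) ^ (2 * Δ) * ε := by
  have hε : 0 ≤ ε := (norm_nonneg _).trans (hN (fun _ => ⟨0, hD⟩) fun _ => ⟨0, hD⟩)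
  refine norm_sum_config_le hD hι _ (fun x y => ?_) hε
  split_ifs
  · rw [norm_mul, norm_prod]
    exact (mul_le_of_le_one_right (norm_nonneg _)
      (Finset.prod_le_one (fun _ _ => norm_nonneg _) fun m _ => hX m _ _)).trans (hN x y)
  · simpa using hε

/-- Normalizing a small perturbation of the identity gives a small perturbation of the maximally
mixed state. -/
theorem norm_normalize_one_sub_apply_le (hD : 1 ≤ D) {Z : Matrix (Fin D) (Fin D) ℂ} {η : ℝ}
    (hZ : ∀ i j, ‖Z i j‖ ≤ η) (hη : η ≤ 1 / 2) (i j : Fin D) :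
    ‖((1 - Z).trace⁻¹ • (1 - Z)) i j - if i = j then (D : ℂ)⁻¹ else 0‖ ≤ 4 * η := by
  have hη0 : 0 ≤ η := (norm_nonneg _).trans (hZ ⟨0, hD⟩ ⟨0, hD⟩)
  have hD1 : (1 : ℝ) ≤ D := by exact_mod_cast hD
  have hD0 : (D : ℂ) ≠ 0 := by
    have : D ≠ 0 := by omega
    exact_mod_cast this
  have htrZ : ‖Z.trace‖ ≤ D * η := by
    refine (norm_sum_le _ _).trans ((Finset.sum_le_sum fun k _ => hZ k k).trans_eq ?_)
    simp
  have htr : (1 - Z).trace = D - Z.trace := by rw [trace_sub, trace_one_fin]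
  have hlow : (D : ℝ) / 2 ≤ ‖(D : ℂ) - Z.trace‖ := by
    have h1 := norm_sub_norm_le (D : ℂ) Z.trace
    rw [Complex.norm_natCast] at h1
    nlinarith
  have hne : (D : ℂ) - Z.trace ≠ 0 := by
    rw [← norm_pos_iff]
    linarith
  have hkey : ((1 - Z).trace⁻¹ • (1 - Z)) i j - (if i = j then (D : ℂ)⁻¹ else 0)
      = ((if i = j then Z.trace else 0) - D * Z i j) / (D * (D - Z.trace)) := by
    rw [htr, Matrix.smul_apply, Matrix.sub_apply, one_apply, smul_eq_mul]
    by_cases h : i = j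
    · simp only [h, if_true]
      field_simp
      ring
    · simp only [h, if_false]
      field_simp
      ring
  rw [hkey, norm_div, norm_mul, Complex.norm_natCast, div_le_iff₀ (by
    have : 0 < ‖(D : ℂ) - Z.trace‖ := norm_pos_iff.2 hne
    positivity)]
  have hnum : ‖(if i = j then Z.trace else 0) - (D : ℂ) * Z i j‖ ≤ D * η + D * η := by
    refine (norm_sub_le _ _).trans (add_le_add ?_ ?_)
    · split_ifs
      · exact htrZ
      · simp only [norm_zero]; positivity
    · rw [norm_mul, Complex.norm_natCast]
      gcongr
      exact hZ i j
  refine hnum.trans ?_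
  have h2 : 4 * η * (D * (D / 2 : ℝ)) ≤ 4 * η * (D * ‖(D : ℂ) - Z.trace‖) := by gcongr
  have h3 : (D : ℝ) * η ≤ D * η * D := le_mul_of_one_le_right (by positivity) hD1
  nlinarith

end Tensor

/-! ### Projectors onto and off the messages -/

section Projectors

variable {V : Type u} [Fintype V] [DecidableEq V] {G : SimpleGraph V} [DecidableRel G.Adj]
  {D d : ℕ}

theorem sum_mul_eq_overlap {μ : Messages G D} (hμ : IsNormalized μ) (e : G.Dart) :
    ∑ i, ∑ j, μ e i j * μ e.symm i j = (overlap μ e : ℂ) := by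
  refine (Complex.conj_eq_iff_re.1 ?_).symm
  rw [map_sum, Finset.sum_comm]
  simp only [map_sum]
  refine Finset.sum_congr rfl fun j _ => Finset.sum_congr rfl fun i _ => ?_
  have h1 := congrFun (congrFun (hμ e).1.1 i) j
  have h2 := congrFun (congrFun (hμ e.symm).1.1 i) j
  rw [conjTranspose_apply] at h1 h2
  rw [map_mul]
  exact congrArg₂ (· * ·) h1 h2

theorem overlap_symm (μ : Messages G D) (e : G.Dart) : overlap μ e.symm = overlap μ e := by
  simp only [overlap, SimpleGraph.Dart.symm_symm, mul_comm]

/-- The complementary projector on an edge as a matrix between the leg pairs of its two ends. -/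
def excMatrix (μ : Messages G D) (e : G.Dart) (p q : Fin D × Fin D) : ℂ :=
  (if p = q then 1 else 0) - μ e.symm p.1 p.2 * μ e q.1 q.2 / (overlap μ e : ℂ)

theorem excMatrix_symm (μ : Messages G D) (e : G.Dart) (p q : Fin D × Fin D) :
    excMatrix μ e.symm p q = excMatrix μ e q p := by
  rw [excMatrix, excMatrix, overlap_symm, SimpleGraph.Dart.symm_symm, mul_comm (μ e p.1 p.2)]
  congr 1
  exact if_congr eq_comm rfl rfl

/-- The complementary projector is idempotent; this lets the vertices at both ends of an excited
edge be contracted with it. -/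
theorem excMatrix_eq_sum {μ : Messages G D} (hμ : IsNormalized μ) {e : G.Dart}
    (h0 : overlap μ e ≠ 0) (p q : Fin D × Fin D) :
    excMatrix μ e p q = ∑ k, excMatrix μ e p k * excMatrix μ e.symm q k := by
  have hne : (overlap μ e : ℂ) ≠ 0 := by exact_mod_cast h0
  have hsum := sum_mul_eq_overlap hμ e
  rw [← Fintype.sum_prod_type'] at hsum
  simp only [excMatrix_symm]
  have h1 : ∀ k, excMatrix μ e p k * excMatrix μ e k q
      = (if p = k then excMatrix μ e k q else 0)
        - (if k = q then μ e.symm p.1 p.2 * μ e k.1 k.2 / (overlap μ e : ℂ) else 0)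
        + μ e.symm p.1 p.2 * μ e q.1 q.2 / (overlap μ e : ℂ) ^ 2
          * (μ e k.1 k.2 * μ e.symm k.1 k.2) := by
    intro k
    by_cases hkq : k = q
    · subst hkq
      by_cases hpk : p = k <;> simp only [excMatrix, hpk, if_true, if_false] <;> ring
    · by_cases hpk : p = k
      · subst hpk
        simp only [excMatrix, hkq, if_true, if_false]
        ring
      · simp only [excMatrix, hpk, hkq, if_false]
        ring
  simp only [h1, Finset.sum_add_distrib, Finset.sum_sub_distrib, Finset.sum_ite_eq,
    Finset.sum_ite_eq', Finset.mem_univ, if_true, ← Finset.mul_sum, hsum]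
  field_simp
  ring

theorem excProj_eq (μ : Messages G D) (x y : G.Dart → Fin D) (e : G.Dart) :
    excProj μ x y e = excMatrix μ e (x e, y e) (x e.symm, y e.symm) := by
  simp only [excProj, excMatrix, bpProj, Prod.mk.injEq]

open Classical in
/-- The matrix seen by the leg `e.fst` of the directed edge `e`: the rescaled incoming message, or,
on the edges of `S`, a row of the complementary projector. -/
def legWeight (μ : Messages G D) (S : Set (Sym2 V)) (k : Fin D × Fin D) (e : G.Dart)
    (i j : Fin D) : ℂ :=
  if e.edge ∈ S then excMatrix μ e (i, j) k
  else μ e.symm i j / (Real.sqrt (overlap μ e) : ℂ)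

open Classical in
/-- The summation range for the index of an edge: all index pairs on excited edges, and a single
dummy value elsewhere. -/
def excRange (hD : 1 ≤ D) (S : Set (Sym2 V)) (e : Sym2 V) : Finset (Fin D × Fin D) :=
  if e ∈ S then Finset.univ else {(⟨0, hD⟩, ⟨0, hD⟩)}

theorem dartWeight_eq_sum (hD : 1 ≤ D) {μ : Messages G D} (hμ : IsNormalized μ)
    (h0 : ∀ e, 0 < overlap μ e) (S : Set (Sym2 V)) (x y : G.Dart → Fin D) (e : G.Dart) :
    dartWeight μ S x y e = ∑ k ∈ excRange hD S e.edge,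
      legWeight μ S k e (x e) (y e) * legWeight μ S k e.symm (x e.symm) (y e.symm) := by
  unfold dartWeight legWeight excRange
  rw [SimpleGraph.Dart.edge_symm]
  by_cases h : e.edge ∈ S
  · simp only [h, if_true]
    rw [excProj_eq, excMatrix_eq_sum hμ (h0 e).ne']
  · simp only [h, if_false, Finset.sum_singleton, SimpleGraph.Dart.symm_symm, overlap_symm, bpProj]
    rw [div_mul_div_comm, ← Complex.ofReal_mul, Real.mul_self_sqrt (h0 e).le]

theorem edgeWeight_edge (μ : Messages G D) (S : Set (Sym2 V)) (x y : G.Dart → Fin D)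
    (e : G.Dart) : edgeWeight μ S x y e.edge = dartWeight μ S x y e :=
  dif_pos e.adj

theorem prod_dart_fiber (f : G.Dart → ℂ) (e : G.Dart) :
    ∏ e' ∈ Finset.univ.filter (fun e' : G.Dart => e'.edge = e.edge), f e' = f e * f e.symm := by
  rw [e.edge_fiber, Finset.prod_pair e.symm_ne.symm]

theorem prod_dart_eq (f : G.Dart → ℂ) :
    ∏ e, f e = ∏ v, ∏ n : G.neighborSet v, f (outDart v n) := by
  rw [← Fintype.prod_sigma' (fun v (n : G.neighborSet v) => f (outDart v n))]
  refine Fintype.prod_equiv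
    ⟨fun e => ⟨e.fst, ⟨e.snd, e.adj⟩⟩, fun z => outDart z.1 z.2, fun _ => rfl, fun _ => rfl⟩ _ _
    fun _ => rfl

theorem sum_dart_config (F : ∀ v, (G.neighborSet v → Fin D) → (G.neighborSet v → Fin D) → ℂ) :
    ∑ x : G.Dart → Fin D, ∑ y : G.Dart → Fin D,
        ∏ v, F v (fun n => x (outDart v n)) (fun n => y (outDart v n))
      = ∏ v, ∑ a, ∑ b, F v a b := by
  simp only [← Fintype.sum_prod_type']
  rw [Finset.prod_univ_sum, Fintype.piFinset_univ]
  exact Fintype.sum_equiv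
    ⟨fun z v => (fun n => z.1 (outDart v n), fun n => z.2 (outDart v n)),
      fun w => (fun e => (w e.fst).1 ⟨e.snd, e.adj⟩, fun e => (w e.fst).2 ⟨e.snd, e.adj⟩),
      fun _ => rfl, fun _ => rfl⟩ _ _ fun _ => rfl

/-- The edge carrying the leg `n` of `v`. -/
def legEdge (v : V) (n : G.neighborSet v) : G.edgeSet := ⟨s(v, n), G.mem_edgeSet.2 n.2⟩

/-- The tensor at `v` contracted with the leg weights of its legs. -/
def loopVertex (T : PEPS G D d) (μ : Messages G D) (S : Set (Sym2 V))
    (p : G.edgeSet → Fin D × Fin D) (v : V) : ℂ :=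
  contractAll ((T v)ᴴ * T v)ᵀ fun n => legWeight μ S (p (legEdge v n)) (outDart v n)

/-- Resolving the projectors on the edges factorizes the loop activity over the vertices. -/
theorem loopActivity_eq_sum (hD : 1 ≤ D) (T : PEPS G D d) {μ : Messages G D}
    (hμ : IsNormalized μ) (h0 : ∀ e, 0 < overlap μ e) (ℓ : G.Subgraph) :
    loopActivity T μ ℓ = ∑ p ∈ Fintype.piFinset fun e : G.edgeSet => excRange hD ℓ.edgeSet e,
      ∏ v, loopVertex T μ ℓ.edgeSet p v / bpVertex T μ v := by
  -- one summation index per edge, after which each leg carries its own weight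
  have hedge : ∀ x y : G.Dart → Fin D, ∏ e ∈ G.edgeFinset, edgeWeight μ ℓ.edgeSet x y e
      = ∑ p ∈ Fintype.piFinset fun e : G.edgeSet => excRange hD ℓ.edgeSet e,
        ∏ v, ∏ n, legWeight μ ℓ.edgeSet (p (legEdge v n)) (outDart v n) (x (outDart v n))
          (y (outDart v n)) := by
    intro x y
    have h1 : ∀ e : G.edgeSet, edgeWeight μ ℓ.edgeSet x y e
        = ∑ k ∈ excRange hD ℓ.edgeSet e,
          ∏ e' ∈ Finset.univ.filter (fun e' : G.Dart => (⟨e'.edge, e'.edge_mem⟩ : G.edgeSet) = e),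
            legWeight μ ℓ.edgeSet k e' (x e') (y e') := by
      rintro ⟨e, he⟩
      induction e using Sym2.ind with
      | _ a b =>
        have h2 := edgeWeight_edge μ ℓ.edgeSet x y ⟨(a, b), he⟩
        refine h2.trans ?_
        rw [dartWeight_eq_sum hD hμ h0]
        refine Finset.sum_congr rfl fun k _ => ?_
        rw [← prod_dart_fiber (fun e => legWeight μ ℓ.edgeSet k e (x e) (y e))]
        refine Finset.prod_congr ?_ fun _ _ => rfl
        ext e'
        simp only [Finset.mem_filter, Finset.mem_univ, true_and, Subtype.mk.injEq]
        rfl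
    rw [Finset.prod_subtype G.edgeFinset (p := (· ∈ G.edgeSet)) (by simp)]
    have h3 : ∏ e : G.edgeSet, edgeWeight μ ℓ.edgeSet x y e
        = ∑ p ∈ Fintype.piFinset fun e : G.edgeSet => excRange hD ℓ.edgeSet e,
          ∏ e : G.edgeSet, ∏ e' ∈ Finset.univ.filter
            (fun e' : G.Dart => (⟨e'.edge, e'.edge_mem⟩ : G.edgeSet) = e),
            legWeight μ ℓ.edgeSet (p e) e' (x e') (y e') := by
      rw [Finset.prod_congr rfl fun e _ => h1 e, Finset.prod_univ_sum]
    refine Eq.trans (by congr!) (h3.trans ?_)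
    refine Finset.sum_congr rfl fun p _ => ?_
    have h4 : ∀ e : G.edgeSet, ∏ e' ∈ Finset.univ.filter
            (fun e' : G.Dart => (⟨e'.edge, e'.edge_mem⟩ : G.edgeSet) = e),
            legWeight μ ℓ.edgeSet (p e) e' (x e') (y e')
        = ∏ e' ∈ Finset.univ.filter
            (fun e' : G.Dart => (⟨e'.edge, e'.edge_mem⟩ : G.edgeSet) = e),
            legWeight μ ℓ.edgeSet (p ⟨e'.edge, e'.edge_mem⟩) e' (x e') (y e') := fun e =>
      Finset.prod_congr rfl fun e' he' => by rw [(Finset.mem_filter.1 he').2]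
    rw [Finset.prod_congr rfl fun e _ => h4 e, Finset.prod_fiberwise]
    exact prod_dart_eq fun e' =>
      legWeight μ ℓ.edgeSet (p ⟨e'.edge, e'.edge_mem⟩) e' (x e') (y e')
  rw [loopActivity]
  simp only [hedge, Finset.mul_sum]
  rw [Finset.sum_congr rfl fun x _ => Finset.sum_comm, Finset.sum_comm]
  refine Finset.sum_congr rfl fun p _ => ?_
  simp only [← Finset.prod_mul_distrib]
  rw [sum_dart_config fun v a b => doubleTensor T v a b / bpVertex T μ v *
    ∏ n, legWeight μ ℓ.edgeSet (p (legEdge v n)) (outDart v n) (a n) (b n)]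
  refine Finset.prod_congr rfl fun v _ => ?_
  rw [loopVertex, contractAll, Finset.sum_div]
  refine Finset.sum_congr rfl fun a _ => ?_
  rw [Finset.sum_div]
  refine Finset.sum_congr rfl fun b _ => ?_
  rw [doubleTensor_eq]
  ring

theorem bpVertex_eq (T : PEPS G D d) (μ : Messages G D) (v : V) :
    bpVertex T μ v = contractAll ((T v)ᴴ * T v)ᵀ fun n i j =>
      μ (inDart v n) i j / (Real.sqrt (overlap μ (inDart v n)) : ℂ) := by
  simp only [bpVertex, contractAll, doubleTensor_eq]

theorem loopVertex_eq_bpVertex (T : PEPS G D d) (μ : Messages G D) {S : Set (Sym2 V)}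
    (p : G.edgeSet → Fin D × Fin D) {v : V} (h : ∀ n : G.neighborSet v, s(v, (n : V)) ∉ S) :
    loopVertex T μ S p v = bpVertex T μ v := by
  rw [bpVertex_eq, loopVertex]
  congr 1
  funext n i j
  have h1 : (outDart v n).edge ∉ S := h n
  rw [legWeight, if_neg h1, ← overlap_symm]
  rfl

end Projectors

/-! ### Decay of loops -/

section LoopDecay

variable {V : Type u} [Fintype V] [DecidableEq V] {G : SimpleGraph V} [DecidableRel G.Adj]
  {D d : ℕ}

/-- All messages are entrywise `r`-close to the maximally mixed state. -/
def IsNearlyMixed (μ : Messages G D) (r : ℝ) : Prop :=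
  ∀ e i j, ‖μ e i j - if i = j then (D : ℂ)⁻¹ else 0‖ ≤ r

theorem norm_message_le_one {μ : Messages G D} (hμ : IsNormalized μ) (e : G.Dart) (i j : Fin D) :
    ‖μ e i j‖ ≤ 1 := by
  have := norm_entry_le_trace (hμ e).1 i j
  rwa [(hμ e).2, Complex.one_re] at this

theorem norm_one_sub_gram_le {m n : Type*} [Fintype m] [Fintype n] [DecidableEq n] {δ : ℝ}
    {T : Matrix m n ℂ} (h : HasBounds (δ ^ 2) 1 T) (x y : n) :
    ‖((1 : Matrix n n ℂ) - (Tᴴ * T)ᵀ) x y‖ ≤ deviation δ := by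
  have h2 := h.transpose.2
  rw [Complex.ofReal_one, one_smul] at h2
  refine norm_entry_le_of_le_smul_one h2 ?_ x y
  convert h.transpose.1 using 1
  unfold deviation
  push_cast
  module

/-- A fixed point is an image under message passing, and each tensor, being `ε`-close to the
identity, sends every message to the maximally mixed state up to `O(ε)`. -/
theorem isNearlyMixed_of_isFixedPoint (hD : 1 ≤ D) {Δ : ℕ} (hΔ : ∀ v, G.degree v ≤ Δ) {δ : ℝ}
    {T : PEPS G D d} (hT : ∀ v, HasBounds (δ ^ 2) 1 (T v)) {μ : Messages G D}
    (hμ : IsFixedPoint T μ) (hε : (D : ℝ) ^ (2 * Δ) * deviation δ ≤ 1 / 2) :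
    IsNearlyMixed μ (4 * ((D : ℝ) ^ (2 * Δ) * deviation δ)) := by
  intro e i j
  have hcard : Fintype.card (G.neighborSet e.fst) ≤ Δ :=
    (G.card_neighborSet_eq_degree e.fst).trans_le (hΔ _)
  have h1 := norm_contract_apply_le hD hcard (norm_one_sub_gram_le (hT e.fst))
    (⟨e.snd, e.adj⟩ : G.neighborSet e.fst) (X := fun m => μ (inDart e.fst m))
    (fun m => norm_message_le_one hμ.1 _)
  have h2 := norm_normalize_one_sub_apply_le hD h1 hε i j
  rw [contract_sub, contract_one_of_trace_eq_one _ fun m _ => (hμ.1 _).2, sub_sub_cancel] at h2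
  have h3 : μ e = update T μ e := by rw [hμ.2]
  rw [h3, update_eq_outMessage]
  exact h2

variable {μ : Messages G D} {r : ℝ}

theorem abs_overlap_sub_le (hD : 1 ≤ D) (hμ : IsNormalized μ) (hr : IsNearlyMixed μ r)
    (e : G.Dart) : |overlap μ e - (D : ℝ)⁻¹| ≤ 2 * D ^ 2 * r := by
  have hD1 : (1 : ℝ) ≤ D := by exact_mod_cast hD
  have hD0 : (D : ℂ) ≠ 0 := by
    have : D ≠ 0 := by omega
    exact_mod_cast this
  have ha : ∀ i j : Fin D, ‖(if i = j then (D : ℂ)⁻¹ else 0)‖ ≤ 1 := by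
    intro i j
    split_ifs
    · rw [norm_inv, Complex.norm_natCast]
      exact inv_le_one_of_one_le₀ hD1
    · simp
  have h1 : ((overlap μ e - (D : ℝ)⁻¹ : ℝ) : ℂ) = ∑ i, ∑ j, (μ e i j * μ e.symm i j
      - (if i = j then (D : ℂ)⁻¹ else 0) * (if i = j then (D : ℂ)⁻¹ else 0)) := by
    simp only [Finset.sum_sub_distrib, sum_mul_eq_overlap hμ, mul_ite, mul_zero, ite_mul, zero_mul,
      Finset.sum_ite_eq, Finset.mem_univ, if_true, Finset.sum_const, Finset.card_univ,
      Fintype.card_fin, nsmul_eq_mul]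
    push_cast
    field_simp
  have h2 : ‖((overlap μ e - (D : ℝ)⁻¹ : ℝ) : ℂ)‖ ≤ ∑ _i : Fin D, ∑ _j : Fin D, 2 * r := by
    rw [h1]
    refine (norm_sum_le _ _).trans (Finset.sum_le_sum fun i _ => (norm_sum_le _ _).trans
      (Finset.sum_le_sum fun j _ => ?_))
    set a : ℂ := if i = j then (D : ℂ)⁻¹ else 0 with hadef
    have e1 : μ e i j * μ e.symm i j - a * a
        = (μ e i j - a) * μ e.symm i j + a * (μ e.symm i j - a) := by ring
    rw [e1]
    refine (norm_add_le _ _).trans ?_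
    rw [norm_mul, norm_mul]
    have b1 := mul_le_mul (hr e i j) (norm_message_le_one hμ e.symm i j) (norm_nonneg _)
      ((norm_nonneg _).trans (hr e i j))
    have b2 := mul_le_mul (ha i j) (hr e.symm i j) (norm_nonneg _) zero_le_one
    linarith
  rw [Complex.norm_real, Real.norm_eq_abs] at h2
  refine h2.trans_eq ?_
  simp only [Finset.sum_const, Finset.card_univ, Fintype.card_fin, nsmul_eq_mul]
  ring

theorem overlap_bounds (hD : 1 ≤ D) (hμ : IsNormalized μ) (hr : IsNearlyMixed μ r)
    (hr4 : 4 * (D : ℝ) ^ 3 * r ≤ 1) (e : G.Dart) :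
    (2 * (D : ℝ))⁻¹ ≤ overlap μ e ∧ overlap μ e ≤ 2 := by
  have hD1 : (1 : ℝ) ≤ D := by exact_mod_cast hD
  have h := abs_le.1 (abs_overlap_sub_le hD hμ hr e)
  have h1 : 2 * (D : ℝ) ^ 2 * r ≤ (2 * (D : ℝ))⁻¹ := by
    rw [← one_div, le_div_iff₀ (by positivity)]
    linarith
  have h2 : (D : ℝ)⁻¹ = (2 * (D : ℝ))⁻¹ + (2 * (D : ℝ))⁻¹ := by field_simp; norm_num
  have h3 : (D : ℝ)⁻¹ ≤ 1 := inv_le_one_of_one_le₀ hD1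
  constructor <;> linarith [h.1, h.2]

theorem norm_excMatrix_le (hD : 1 ≤ D) (hμ : IsNormalized μ) {e : G.Dart}
    (h : (2 * (D : ℝ))⁻¹ ≤ overlap μ e) (p q : Fin D × Fin D) :
    ‖excMatrix μ e p q‖ ≤ 3 * D := by
  have hD1 : (1 : ℝ) ≤ D := by exact_mod_cast hD
  have hI : 0 < overlap μ e := lt_of_lt_of_le (by positivity) h
  refine (norm_sub_le _ _).trans ?_
  have h1 : ‖(if p = q then (1 : ℂ) else 0)‖ ≤ 1 := by split_ifs <;> simp
  have h2 : ‖μ e.symm p.1 p.2 * μ e q.1 q.2 / (overlap μ e : ℂ)‖ ≤ 2 * D := by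
    rw [norm_div, norm_mul, Complex.norm_real, Real.norm_of_nonneg hI.le, div_le_iff₀ hI]
    have h3 := mul_le_one₀ (norm_message_le_one hμ e.symm p.1 p.2) (norm_nonneg _)
      (norm_message_le_one hμ e q.1 q.2)
    have h4 : 1 ≤ 2 * D * overlap μ e := by
      rwa [inv_le_iff_one_le_mul₀' (by positivity)] at h
    linarith
  linarith

theorem norm_rescaled_message_le (hD : 1 ≤ D) (hμ : IsNormalized μ) {e : G.Dart}
    (h : (2 * (D : ℝ))⁻¹ ≤ overlap μ e) (e' : G.Dart) (i j : Fin D) :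
    ‖μ e' i j / (Real.sqrt (overlap μ e) : ℂ)‖ ≤ 3 * D := by
  have hD1 : (1 : ℝ) ≤ D := by exact_mod_cast hD
  have hI : 0 < overlap μ e := lt_of_lt_of_le (by positivity) h
  have hs : (2 * (D : ℝ))⁻¹ ≤ Real.sqrt (overlap μ e) := by
    refine Real.le_sqrt_of_sq_le (le_trans ?_ h)
    rw [sq]
    exact mul_le_of_le_one_left (by positivity) (inv_le_one_of_one_le₀ (by linarith))
  rw [norm_div, Complex.norm_real, Real.norm_of_nonneg (Real.sqrt_nonneg _),
    div_le_iff₀ (Real.sqrt_pos.2 hI)]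
  have h3 := norm_message_le_one hμ e' i j
  have h4 : 1 ≤ 2 * D * Real.sqrt (overlap μ e) := by
    rwa [inv_le_iff_one_le_mul₀' (by positivity)] at hs
  nlinarith [Real.sqrt_nonneg (overlap μ e)]

theorem norm_legWeight_le (hD : 1 ≤ D) (hμ : IsNormalized μ) {e : G.Dart}
    (h : (2 * (D : ℝ))⁻¹ ≤ overlap μ e) (S : Set (Sym2 V)) (k : Fin D × Fin D) (i j : Fin D) :
    ‖legWeight μ S k e i j‖ ≤ 3 * D := by
  unfold legWeight
  split_ifs
  · exact norm_excMatrix_le hD hμ h _ _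
  · exact norm_rescaled_message_le hD hμ h _ _ _

/-- The complementary projector nearly annihilates the identity, which is nearly a multiple of the
message. -/
theorem norm_sum_excMatrix_diag_le (hD : 1 ≤ D) (hμ : IsNormalized μ) (hr : IsNearlyMixed μ r)
    {e : G.Dart} (h : (2 * (D : ℝ))⁻¹ ≤ overlap μ e) (k : Fin D × Fin D) :
    ‖∑ i, excMatrix μ e (i, i) k‖ ≤ 6 * D ^ 3 * r := by
  have hD1 : (1 : ℝ) ≤ D := by exact_mod_cast hD
  have hr0 : 0 ≤ r := (norm_nonneg _).trans (hr e ⟨0, hD⟩ ⟨0, hD⟩)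
  have hI : 0 < overlap μ e := lt_of_lt_of_le (by positivity) h
  have hIc : (overlap μ e : ℂ) ≠ 0 := by exact_mod_cast hI.ne'
  have hsum : ∑ i, excMatrix μ e (i, i) k
      = (if k.1 = k.2 then 1 else 0) - μ e k.1 k.2 / (overlap μ e : ℂ) := by
    have htr : ∑ i, μ e.symm i i = 1 := (hμ e.symm).2
    simp only [excMatrix, Finset.sum_sub_distrib, ← Finset.sum_div, ← Finset.sum_mul, htr, one_mul]
    congr 1
    obtain ⟨a, b⟩ := k
    simp only [Prod.mk.injEq]
    by_cases hab : a = b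
    · subst hab
      simp
    · rw [if_neg hab]
      refine Finset.sum_eq_zero fun i _ => if_neg ?_
      rintro ⟨rfl, rfl⟩
      exact hab rfl
  have hkey : (if k.1 = k.2 then 1 else 0) - μ e k.1 k.2 / (overlap μ e : ℂ)
      = ((if k.1 = k.2 then ((overlap μ e - (D : ℝ)⁻¹ : ℝ) : ℂ) else 0)
        - (μ e k.1 k.2 - if k.1 = k.2 then (D : ℂ)⁻¹ else 0)) / (overlap μ e : ℂ) := by
    by_cases hk : k.1 = k.2
    · simp only [hk, if_true]
      push_cast
      field_simp
      ring
    · simp only [hk, if_false]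
      field_simp
      ring
  rw [hsum, hkey, norm_div, Complex.norm_real, Real.norm_of_nonneg hI.le, div_le_iff₀ hI]
  have h1 : ‖(if k.1 = k.2 then ((overlap μ e - (D : ℝ)⁻¹ : ℝ) : ℂ) else 0)‖ ≤ 2 * D ^ 2 * r := by
    split_ifs
    · rw [Complex.norm_real]
      exact abs_overlap_sub_le hD hμ hr e
    · rw [norm_zero]; positivity
  have h4 : 1 ≤ 2 * D * overlap μ e := by
    rwa [inv_le_iff_one_le_mul₀' (by positivity)] at h
  refine (norm_sub_le _ _).trans ((add_le_add h1 (hr e k.1 k.2)).trans ?_)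
  have h5 : r ≤ D ^ 2 * r := le_mul_of_one_le_left hr0 (one_le_pow₀ hD1)
  calc 2 * D ^ 2 * r + r ≤ 3 * D ^ 2 * r * 1 := by linarith
    _ ≤ 3 * D ^ 2 * r * (2 * D * overlap μ e) := by gcongr
    _ = _ := by ring

variable {T : PEPS G D d} {δ : ℝ} {Δ : ℕ}

/-- `Z^(v)` is close to the product of the traces `1 / √I_e`, each at least `1/2`. -/
theorem norm_bpVertex_ge (hD : 1 ≤ D) (hΔ : ∀ v, G.degree v ≤ Δ)
    (hT : ∀ v, HasBounds (δ ^ 2) 1 (T v)) (hμ : IsNormalized μ)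
    (hI : ∀ e, (2 * (D : ℝ))⁻¹ ≤ overlap μ e ∧ overlap μ e ≤ 2)
    (hε : (D : ℝ) ^ (2 * Δ) * (deviation δ * (3 * D) ^ Δ) ≤ (1 / 2) ^ Δ / 2) (v : V) :
    (1 / 2) ^ Δ / 2 ≤ ‖bpVertex T μ v‖ := by
  have hD1 : (1 : ℝ) ≤ D := by exact_mod_cast hD
  have hcard : Fintype.card (G.neighborSet v) ≤ Δ :=
    (G.card_neighborSet_eq_degree v).trans_le (hΔ _)
  have h1 := norm_contractAll_sub_le hD hcard (norm_one_sub_gram_le (hT v)) (b := 3 * D)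
    (g := fun n i j => μ (inDart v n) i j / (Real.sqrt (overlap μ (inDart v n)) : ℂ))
    (by linarith) (fun n i j => norm_rescaled_message_le hD hμ (hI _).1 _ i j)
  rw [← bpVertex_eq] at h1
  have h2 : (1 / 2 : ℝ) ^ Δ ≤ ‖∏ n : G.neighborSet v, ∑ i,
      μ (inDart v n) i i / (Real.sqrt (overlap μ (inDart v n)) : ℂ)‖ := by
    rw [norm_prod]
    have h3 : ∀ n : G.neighborSet v, (1 / 2 : ℝ) ≤ ‖∑ i,
        μ (inDart v n) i i / (Real.sqrt (overlap μ (inDart v n)) : ℂ)‖ := by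
      intro n
      have htr : ∑ i, μ (inDart v n) i i = 1 := (hμ (inDart v n)).2
      have hpos : 0 < overlap μ (inDart v n) := lt_of_lt_of_le (by positivity) (hI _).1
      rw [← Finset.sum_div, htr, norm_div, norm_one, Complex.norm_real,
        Real.norm_of_nonneg (Real.sqrt_nonneg _)]
      refine one_div_le_one_div_of_le (Real.sqrt_pos.2 hpos) ?_
      rw [Real.sqrt_le_left (by norm_num)]
      linarith [(hI (inDart v n)).2]
    calc (1 / 2 : ℝ) ^ Δ ≤ (1 / 2) ^ Fintype.card (G.neighborSet v) :=
          pow_le_pow_of_le_one (by norm_num) (by norm_num) hcard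
      _ = ∏ _n : G.neighborSet v, (1 / 2 : ℝ) := by rw [Finset.prod_const, Finset.card_univ]
      _ ≤ _ := Finset.prod_le_prod (fun _ _ => by norm_num) fun n _ => h3 n
  have h4 := norm_sub_norm_le (∏ n : G.neighborSet v, ∑ i,
      μ (inDart v n) i i / (Real.sqrt (overlap μ (inDart v n)) : ℂ)) (bpVertex T μ v)
  rw [norm_sub_rev] at h4
  linarith

/-- If some leg of `v` is excited, the tensor at `v` contracted with its leg weights is `O(ε)`. -/
theorem norm_loopVertex_le (hD : 1 ≤ D) (hΔ : ∀ v, G.degree v ≤ Δ)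
    (hT : ∀ v, HasBounds (δ ^ 2) 1 (T v)) (hμ : IsNormalized μ) (hr : IsNearlyMixed μ r)
    (hI : ∀ e, (2 * (D : ℝ))⁻¹ ≤ overlap μ e) {S : Set (Sym2 V)}
    (p : G.edgeSet → Fin D × Fin D) {v : V} {n₀ : G.neighborSet v} (hn : s(v, (n₀ : V)) ∈ S) :
    ‖loopVertex T μ S p v‖ ≤ 6 * D ^ 3 * r * (3 * D ^ 2) ^ Δ
      + (D : ℝ) ^ (2 * Δ) * (deviation δ * (3 * D) ^ Δ) := by
  have hD1 : (1 : ℝ) ≤ D := by exact_mod_cast hD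
  have hcard : Fintype.card (G.neighborSet v) ≤ Δ :=
    (G.card_neighborSet_eq_degree v).trans_le (hΔ _)
  have hr0 : 0 ≤ r := (norm_nonneg _).trans (hr (outDart v n₀) ⟨0, hD⟩ ⟨0, hD⟩)
  set g : G.neighborSet v → Fin D → Fin D → ℂ :=
    fun n => legWeight μ S (p (legEdge v n)) (outDart v n) with hg
  have hgb : ∀ n i j, ‖g n i j‖ ≤ 3 * D := fun n i j => norm_legWeight_le hD hμ (hI _) S _ i j
  have h1 := norm_contractAll_sub_le hD hcard (norm_one_sub_gram_le (hT v)) (b := 3 * D)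
    (by linarith) hgb
  have h2 : ‖∏ n, ∑ i, g n i i‖ ≤ 6 * D ^ 3 * r * (3 * D ^ 2) ^ Δ := by
    rw [norm_prod, ← Finset.mul_prod_erase _ _ (Finset.mem_univ n₀)]
    refine mul_le_mul ?_ ?_ (Finset.prod_nonneg fun _ _ => norm_nonneg _) (by positivity)
    · have h3 : (outDart v n₀).edge ∈ S := hn
      simp only [hg, legWeight, if_pos h3]
      exact norm_sum_excMatrix_diag_le hD hμ hr (hI _) _
    · have h3 : ∀ n, ‖∑ i, g n i i‖ ≤ 3 * (D : ℝ) ^ 2 := by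
        intro n
        refine (norm_sum_le _ _).trans ((Finset.sum_le_sum fun i _ => hgb n i i).trans_eq ?_)
        rw [Finset.sum_const, Finset.card_univ, Fintype.card_fin, nsmul_eq_mul]
        ring
      refine (Finset.prod_le_prod (fun _ _ => norm_nonneg _) fun n _ => h3 n).trans ?_
      rw [Finset.prod_const]
      refine pow_le_pow_right₀ (by nlinarith) ?_
      exact (Finset.card_le_univ _).trans hcard
  have h3 : loopVertex T μ S p v = ∏ n, ∑ i, g n i i
      + (contractAll ((T v)ᴴ * T v)ᵀ g - ∏ n, ∑ i, g n i i) := by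
    rw [loopVertex]; ring
  rw [h3]
  exact (norm_add_le _ _).trans (add_le_add h2 h1)

/-- Every edge of a subgraph is incident to one of its vertices, each of degree at most `Δ`. -/
theorem loopSize_le (hΔ : ∀ v, G.degree v ≤ Δ) (ℓ : G.Subgraph) :
    loopSize ℓ ≤ Δ * ℓ.verts.ncard := by
  classical
  have hsub : ℓ.edgeSet ⊆ ((ℓ.verts.toFinset.biUnion fun v =>
      (G.neighborFinset v).image fun w => s(v, w) : Finset (Sym2 V)) : Set (Sym2 V)) := by
    intro e he
    induction e using Sym2.ind with
    | _ a b =>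
      have hab : ℓ.Adj a b := he
      simp only [Finset.coe_biUnion, Set.mem_iUnion]
      refine ⟨a, by simpa using ℓ.edge_vert hab, ?_⟩
      rw [Finset.mem_coe, Finset.mem_image]
      exact ⟨b, (G.mem_neighborFinset a b).2 (ℓ.adj_sub hab), rfl⟩
  rw [loopSize]
  refine (Set.ncard_le_ncard hsub (Finset.finite_toSet _)).trans ?_
  rw [Set.ncard_coe_finset]
  refine Finset.card_biUnion_le.trans ?_
  refine (Finset.sum_le_sum fun v _ => Finset.card_image_le.trans
    ((G.card_neighborFinset_eq_degree v).trans_le (hΔ v))).trans ?_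
  rw [Finset.sum_const, smul_eq_mul, mul_comm, Set.ncard_eq_toFinset_card']

theorem card_piFinset_excRange (hD : 1 ≤ D) (ℓ : G.Subgraph) :
    (Fintype.piFinset fun e : G.edgeSet => excRange hD ℓ.edgeSet e).card
      = (D * D) ^ loopSize ℓ := by
  classical
  rw [Fintype.card_piFinset]
  have h1 : ∀ e : G.edgeSet, (excRange hD ℓ.edgeSet (e : Sym2 V)).card
      = if (e : Sym2 V) ∈ ℓ.edgeSet then D * D else 1 := by
    intro e
    unfold excRange
    split_ifs <;> simp
  rw [Finset.prod_congr rfl fun e _ => h1 e, Finset.prod_ite, Finset.prod_const,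
    Finset.prod_const_one, mul_one, loopSize]
  congr 1
  rw [← Set.ncard_coe_finset, ← Set.ncard_image_of_injective _ (Subtype.val_injective)]
  congr 1
  ext e
  simp only [Finset.coe_filter, Finset.mem_univ, true_and, Set.mem_image, Set.mem_ofPred_eq,
    Subtype.exists, exists_and_left, exists_prop, exists_eq_right_right]
  exact and_iff_left_of_imp fun h => ℓ.edgeSet_subset h

/-- The constant `K` in the bound `D ^ (2 |ℓ|) (K ε) ^ |V(ℓ)|` on the loop activities. It
collects the bound of `norm_loopVertex_le` and the factor `2 * 2 ^ Δ` from dividing by `Z^(v)`. -/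
def loopConst (Δ D : ℕ) : ℝ :=
  2 * 2 ^ Δ * (24 * D ^ 3 * D ^ (2 * Δ) * (3 * D ^ 2) ^ Δ + D ^ (2 * Δ) * (3 * D) ^ Δ)

/-- Loops decay at any rate `c`, for `ε` small enough: there are `D ^ (2 |ℓ|)` edge indices, and
each of the at least `|ℓ| / Δ` vertices contributes `K ε`. -/
theorem loopDecay_of_isFixedPoint (hD : 1 ≤ D) (hΔ : ∀ v, G.degree v ≤ Δ) (hε0 : 0 ≤ deviation δ)
    (hT : ∀ v, HasBounds (δ ^ 2) 1 (T v)) (hμ : IsFixedPoint T μ) {c : ℝ} (hc : 0 ≤ c)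
    (hε : loopConst Δ D * deviation δ ≤ (Real.exp (-c) * ((D : ℝ) * D)⁻¹) ^ Δ) :
    LoopDecay T μ c := by
  have hD1 : (1 : ℝ) ≤ D := by exact_mod_cast hD
  set ε := deviation δ with hεdef
  set u : ℝ := Real.exp (-c) * ((D : ℝ) * D)⁻¹ with hu
  have hu0 : 0 ≤ u := by positivity
  have hu1 : u ≤ 1 := mul_le_one₀ (Real.exp_le_one_iff.2 (by linarith)) (by positivity)
    (inv_le_one_of_one_le₀ (by nlinarith))
  have hKε1 : loopConst Δ D * ε ≤ 1 := hε.trans (pow_le_one₀ hu0 hu1)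
  have p2 : (1 : ℝ) ≤ 2 ^ Δ := one_le_pow₀ (by norm_num)
  have pD : (1 : ℝ) ≤ (D : ℝ) ^ (2 * Δ) := one_le_pow₀ hD1
  have pD3 : (1 : ℝ) ≤ (D : ℝ) ^ 3 := one_le_pow₀ hD1
  have p3D2 : (1 : ℝ) ≤ (3 * (D : ℝ) ^ 2) ^ Δ := one_le_pow₀ (by nlinarith)
  have p3D : (1 : ℝ) ≤ (3 * (D : ℝ)) ^ Δ := one_le_pow₀ (by linarith)
  have hmain : 2 * 2 ^ Δ * (6 * D ^ 3 * (4 * ((D : ℝ) ^ (2 * Δ) * ε)) * (3 * D ^ 2) ^ Δ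
      + (D : ℝ) ^ (2 * Δ) * (ε * (3 * D) ^ Δ)) = loopConst Δ D * ε := by
    unfold loopConst; ring
  have hx : 0 ≤ (D : ℝ) ^ (2 * Δ) * (ε * (3 * D) ^ Δ) := by positivity
  have hy : 0 ≤ 6 * (D : ℝ) ^ 3 * (4 * ((D : ℝ) ^ (2 * Δ) * ε)) * (3 * D ^ 2) ^ Δ := by positivity
  have hsmall1 : 4 * (D : ℝ) ^ 3 * (4 * ((D : ℝ) ^ (2 * Δ) * ε)) ≤ 1 := by
    have h1 : 4 * (D : ℝ) ^ 3 * (4 * ((D : ℝ) ^ (2 * Δ) * ε))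
        ≤ 6 * (D : ℝ) ^ 3 * (4 * ((D : ℝ) ^ (2 * Δ) * ε)) * (3 * D ^ 2) ^ Δ := by
      refine le_trans ?_ (le_mul_of_one_le_right (by positivity) p3D2)
      gcongr
      norm_num
    nlinarith
  have hsmall2 : (D : ℝ) ^ (2 * Δ) * ε ≤ 1 / 2 := by
    have : (D : ℝ) ^ (2 * Δ) * ε ≤ (D : ℝ) ^ 3 * ((D : ℝ) ^ (2 * Δ) * ε) :=
      le_mul_of_one_le_left (by positivity) pD3
    linarith
  have hsmall3 : (D : ℝ) ^ (2 * Δ) * (ε * (3 * D) ^ Δ) ≤ (1 / 2) ^ Δ / 2 := by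
    rw [one_div, inv_pow, le_div_iff₀ two_pos, ← one_div, le_div_iff₀ (by positivity)]
    have := mul_nonneg (zero_le_one.trans p2) hy
    linarith
  have hr := isNearlyMixed_of_isFixedPoint hD hΔ hT hμ hsmall2
  have hI := overlap_bounds hD hμ.1 hr hsmall1
  have hIpos : ∀ e, 0 < overlap μ e := fun e => lt_of_lt_of_le (by positivity) (hI e).1
  have hZ := norm_bpVertex_ge hD hΔ hT hμ.1 hI hsmall3
  have hZpos : ∀ v, 0 < ‖bpVertex T μ v‖ := fun v => lt_of_lt_of_le (by positivity) (hZ v)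
  refine ⟨hIpos, fun v => norm_pos_iff.1 (hZpos v), fun ℓ hℓ => ?_⟩
  classical
  have hfac : ∀ (p : G.edgeSet → Fin D × Fin D) (v : V),
      ‖loopVertex T μ ℓ.edgeSet p v / bpVertex T μ v‖
        ≤ if v ∈ ℓ.verts then loopConst Δ D * ε else 1 := by
    intro p v
    split_ifs with hv
    · obtain ⟨n, hn⟩ : (ℓ.neighborSet v).Nonempty := by
        rw [Set.nonempty_iff_ne_empty]
        intro h0
        have := hℓ.2 v hv
        rw [h0, Set.ncard_empty] at this
        omega
      have h1 := norm_loopVertex_le hD hΔ hT hμ.1 hr (fun e => (hI e).1) (S := ℓ.edgeSet) p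
        (v := v) (n₀ := ⟨n, ℓ.adj_sub hn⟩) hn
      rw [norm_div, div_le_iff₀ (hZpos v)]
      refine h1.trans ?_
      calc _ = loopConst Δ D * ε * ((1 / 2) ^ Δ / 2) := by
            rw [← hmain, ← hεdef, one_div, inv_pow]
            field_simp
        _ ≤ _ := mul_le_mul_of_nonneg_left (hZ v) (by rw [← hmain]; positivity)
    · rw [loopVertex_eq_bpVertex, div_self (norm_pos_iff.1 (hZpos v)), norm_one]
      intro n hn
      exact hv (ℓ.edge_vert hn)
  rw [loopActivity_eq_sum hD T hμ.1 hIpos]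
  have hK0 : 0 ≤ loopConst Δ D * ε := by rw [← hmain]; positivity
  calc ‖∑ p ∈ Fintype.piFinset fun e : G.edgeSet => excRange hD ℓ.edgeSet e,
          ∏ v, loopVertex T μ ℓ.edgeSet p v / bpVertex T μ v‖
      ≤ ∑ p ∈ Fintype.piFinset fun e : G.edgeSet => excRange hD ℓ.edgeSet e,
          (loopConst Δ D * ε) ^ ℓ.verts.ncard := by
        refine (norm_sum_le _ _).trans (Finset.sum_le_sum fun p _ => ?_)
        rw [norm_prod]
        refine (Finset.prod_le_prod (fun _ _ => norm_nonneg _) fun v _ => hfac p v).trans_eq ?_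
        rw [Finset.prod_ite, Finset.prod_const, Finset.prod_const_one, mul_one,
          ← Set.ncard_coe_finset]
        simp
    _ = ((D : ℝ) * D) ^ loopSize ℓ * (loopConst Δ D * ε) ^ ℓ.verts.ncard := by
        rw [Finset.sum_const, card_piFinset_excRange, nsmul_eq_mul]
        push_cast
        rfl
    _ ≤ ((D : ℝ) * D) ^ loopSize ℓ * (u ^ Δ) ^ ℓ.verts.ncard := by gcongr
    _ ≤ ((D : ℝ) * D) ^ loopSize ℓ * u ^ loopSize ℓ := by
        rw [← pow_mul]
        exact mul_le_mul_of_nonneg_left (pow_le_pow_of_le_one hu0 hu1 (loopSize_le hΔ ℓ))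
          (by positivity)
    _ = Real.exp (-(c * loopSize ℓ)) := by
        rw [← mul_pow, hu, mul_left_comm, mul_inv_cancel₀ (by positivity), mul_one,
          ← Real.exp_nat_mul]
        congr 1
        ring

end LoopDecay

/-! ### Thresholds and rates -/

section Thresholds

variable {Δ : ℕ} {δ : ℝ}

theorem epsStar_pos (hΔ : 2 ≤ Δ) : 0 < epsStar Δ := by
  have : (2 : ℝ) ≤ Δ := by exact_mod_cast hΔ
  exact one_div_pos.2 (by linarith)

theorem epsStar_mul (hΔ : 2 ≤ Δ) : epsStar Δ * (2 * Δ - 1) = 1 := by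
  have : (2 : ℝ) ≤ Δ := by exact_mod_cast hΔ
  exact one_div_mul_cancel (by linarith)

theorem epsStar_le (hΔ : 2 ≤ Δ) : epsStar Δ ≤ 1 / 3 := by
  have : (2 : ℝ) ≤ Δ := by exact_mod_cast hΔ
  exact one_div_le_one_div_of_le (by norm_num) (by linarith)

theorem deviation_pos (h0 : 0 < δ) (h1 : δ < 1) : 0 < deviation δ := by
  unfold deviation; nlinarith

theorem deviation_mul_lt_one (hΔ : 2 ≤ Δ) (hε : deviation δ < epsStar Δ) :
    deviation δ * (2 * Δ - 1) < 1 := by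
  have h2 : (2 : ℝ) ≤ Δ := by exact_mod_cast hΔ
  exact (mul_lt_mul_of_pos_right hε (by linarith)).trans_eq (epsStar_mul hΔ)

/-- The perturbation strength stays below the injectivity parameter. -/
theorem slack_lt (hΔ : 2 ≤ Δ) (h0 : 0 < δ) (h1 : δ < 1) :
    (epsStar Δ - deviation δ) / 4 < δ := by
  have h2 := epsStar_le hΔ
  have h3 := deviation_pos h0 h1
  have h4 : deviation δ = 1 - δ ^ 2 := rfl
  nlinarith

theorem contractionConst_lt_one (hΔ : 2 ≤ Δ) (h0 : 0 < δ) (hε : deviation δ < epsStar Δ) :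
    2 * (1 - δ ^ 2) / δ ^ 2 * ((Δ : ℝ) - 1) < 1 := by
  have h2 : (2 : ℝ) ≤ Δ := by exact_mod_cast hΔ
  have h4 : deviation δ = 1 - δ ^ 2 := rfl
  rw [div_mul_eq_mul_div, div_lt_one (by positivity)]
  have h5 := deviation_mul_lt_one hΔ hε
  rw [h4] at h5
  nlinarith

/-- Singular values in `[δ - η, 1 + η]` with `η = (ε_* - ε) / 4` still give a contraction. -/
theorem perturbed_contraction_lt_one (hΔ : 2 ≤ Δ) (h0 : 0 < δ) (h1 : δ < 1)
    (hε : deviation δ < epsStar Δ) {η : ℝ} (hη : η = (epsStar Δ - deviation δ) / 4) :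
    2 * ((1 + η) ^ 2 - (δ - η) ^ 2) / (δ - η) ^ 2 * ((Δ : ℝ) - 1) < 1 := by
  have h2 : (2 : ℝ) ≤ Δ := by exact_mod_cast hΔ
  have h3 := epsStar_mul hΔ
  have h4 : deviation δ = 1 - δ ^ 2 := rfl
  have hηδ : η < δ := hη ▸ slack_lt hΔ h0 h1
  have hη0 : 0 < η := by rw [hη]; linarith
  have hs := epsStar_le hΔ
  have hδ3 : 2 / 3 < δ := by nlinarith
  have hη1 : η ≤ 1 / 12 := by have := deviation_pos h0 h1; linarith
  have hpos : 0 < δ - η := by linarith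
  -- the ratio of the extreme singular values is at least `δ - 2η`
  have h5 : (δ - 2 * η) * (1 + η) ≤ δ - η := by nlinarith
  have h6 : ((δ - 2 * η) * (1 + η)) ^ 2 ≤ (δ - η) ^ 2 :=
    pow_le_pow_left₀ (mul_nonneg (by linarith) (by linarith)) h5 2
  have h7 : 1 - epsStar Δ < (δ - 2 * η) ^ 2 := by nlinarith
  have h8 : (1 - epsStar Δ) * (1 + η) ^ 2 < (δ - η) ^ 2 := by
    refine lt_of_lt_of_le ?_ h6
    rw [mul_pow]
    exact mul_lt_mul_of_pos_right h7 (by positivity)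
  rw [div_mul_eq_mul_div, div_lt_one (by positivity)]
  have h9 := mul_lt_mul_of_pos_right h8 (show (0 : ℝ) < 2 * Δ - 1 by linarith)
  have h10 : (1 - epsStar Δ) * (1 + η) ^ 2 * (2 * Δ - 1)
      = (1 + η) ^ 2 * (2 * Δ - 1) - (1 + η) ^ 2 * (epsStar Δ * (2 * Δ - 1)) := by ring
  rw [h10, h3] at h9
  linarith

theorem contractionConst_nonneg (hΔ : 2 ≤ Δ) (h0 : 0 < δ) (h1 : δ < 1) :
    0 ≤ contractionConst Δ δ := by
  have h2 : (2 : ℝ) ≤ Δ := by exact_mod_cast hΔ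
  have h3 := deviation_pos h0 h1
  have h4 : deviation δ = 1 - δ ^ 2 := rfl
  rw [contractionConst, ← h4]
  exact div_nonneg (mul_nonneg (by linarith) h3.le) (by positivity)

theorem exp_neg_mul_invXiStar (hΔ : 2 ≤ Δ) (h0 : 0 < δ) (h1 : δ < 1) (r : ℕ) :
    Real.exp (-(r * invXiStar Δ δ)) = (deviation δ / epsStar Δ) ^ r := by
  have h3 := deviation_pos h0 h1
  rw [invXiStar, ← mul_neg, Real.exp_nat_mul, ← Real.log_inv, inv_div,
    Real.exp_log (div_pos h3 (epsStar_pos hΔ))]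

theorem contractionConst_le (hΔ : 2 ≤ Δ) (h0 : 0 < δ) (h1 : δ < 1)
    (hε : deviation δ < epsStar Δ) : contractionConst Δ δ ≤ deviation δ / epsStar Δ := by
  have h2 : (2 : ℝ) ≤ Δ := by exact_mod_cast hΔ
  have h3 := deviation_pos h0 h1
  have h4 : deviation δ = 1 - δ ^ 2 := rfl
  have h5 := deviation_mul_lt_one hΔ hε
  have h6 : deviation δ / epsStar Δ = deviation δ * (2 * Δ - 1) := by
    rw [epsStar, div_div_eq_mul_div, div_one]
  rw [contractionConst, ← h4, h6, div_le_iff₀ (by positivity)]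
  nlinarith [mul_nonneg h3.le (show 0 ≤ 1 - deviation δ * (2 * Δ - 1) by linarith)]

theorem cZero_pos (hΔ : 2 ≤ Δ) : 0 < cZero Δ := by
  have h2 : (2 : ℝ) ≤ Δ := by exact_mod_cast hΔ
  have h3 : (1 : ℝ) ≤ Real.exp 1 := Real.one_le_exp zero_le_one
  have := Real.log_nonneg (show 1 ≤ 2 * Real.exp 1 * Δ by nlinarith)
  unfold cZero; linarith

theorem loopScale_pos (hΔ : 2 ≤ Δ) {D : ℕ} (hD : 1 ≤ D) : 0 < loopScale Δ D := by
  have h2 : (0 : ℝ) < Δ := by exact_mod_cast (by omega : 0 < Δ)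
  have hD0 : (0 : ℝ) < D := by exact_mod_cast hD
  unfold loopScale
  refine lt_min ?_ (lt_min ?_ ?_) <;> positivity

/-- At distance at most one the decay factor is bounded below in terms of `c` alone. -/
theorem exp_neg_le_exp_neg_mul_invXiStarStar (c : ℝ) (hc : cZero Δ < c) {R : ℕ} (hR : R ≤ 1) :
    Real.exp (-((c - cZero Δ) / 2)) ≤ Real.exp (-(R * invXiStarStar Δ δ c)) := by
  have h1 : invXiStarStar Δ δ c ≤ (c - cZero Δ) / 2 :=
    div_le_div_of_nonneg_right (min_le_right _ _) zero_le_two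
  refine Real.exp_le_exp.2 (neg_le_neg ?_)
  have hR' : (R : ℝ) ≤ 1 := by exact_mod_cast hR
  have hR0 : (0 : ℝ) ≤ R := R.cast_nonneg
  nlinarith

/-- Since `ε_* ≤ 1`, the rate `1/ξ_**` is at most `log (1/ε) / 2`. -/
theorem sqrt_pow_le_exp (hΔ : 2 ≤ Δ) (h0 : 0 < δ) (h1 : δ < 1) (c : ℝ) (R : ℕ) :
    Real.sqrt (deviation δ) ^ R ≤ Real.exp (-(R * invXiStarStar Δ δ c)) := by
  have h3 := deviation_pos h0 h1
  have h4 := epsStar_pos hΔ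
  have h5 : invXiStarStar Δ δ c ≤ Real.log (1 / deviation δ) / 2 := by
    refine div_le_div_of_nonneg_right ((min_le_left _ _).trans ?_) zero_le_two
    refine Real.log_le_log (div_pos h4 h3) ?_
    exact div_le_div_of_nonneg_right ((epsStar_le hΔ).trans (by norm_num)) h3.le
  have h6 : Real.sqrt (deviation δ) = Real.exp (-(Real.log (1 / deviation δ) / 2)) := by
    rw [one_div, Real.log_inv, neg_div, neg_neg, Real.exp_half, Real.exp_log h3]
  rw [h6, ← Real.exp_nat_mul]
  refine Real.exp_le_exp.2 ?_
  have hR0 : (0 : ℝ) ≤ R := R.cast_nonneg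
  nlinarith

/-- Since `K ε ≤ √ε`, trading the linear rate for a square root absorbs the constant `K`. -/
theorem const_mul_pow_le_sqrt_pow {K ε : ℝ} (hK : 1 ≤ K) (hε : 0 ≤ ε) (h : K ^ 2 * ε ≤ 1) (j : ℕ) :
    (K * ε) ^ (j + 1) ≤ K * Real.sqrt ε ^ (j + 2) := by
  have hs := Real.sqrt_nonneg ε
  have hs2 : Real.sqrt ε * Real.sqrt ε = ε := Real.mul_self_sqrt hε
  have h1 : K * Real.sqrt ε ≤ 1 := by
    have h2 : (K * Real.sqrt ε) ^ 2 ≤ 1 ^ 2 := by rw [mul_pow, sq (Real.sqrt ε), hs2]; linarith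
    exact (pow_le_pow_iff_left₀ (by positivity) zero_le_one two_ne_zero).1 h2
  have h3 : K * ε ≤ Real.sqrt ε := by
    calc K * ε = K * Real.sqrt ε * Real.sqrt ε := by rw [mul_assoc, hs2]
      _ ≤ 1 * Real.sqrt ε := mul_le_mul_of_nonneg_right h1 hs
      _ = Real.sqrt ε := one_mul _
  calc (K * ε) ^ (j + 1) = (K * ε) ^ j * (K * ε) := pow_succ _ _
    _ ≤ Real.sqrt ε ^ j * (K * ε) := by gcongr
    _ = K * Real.sqrt ε ^ (j + 2) := by rw [pow_add, sq, hs2]; ring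

end Thresholds

section Perturbation

variable {V : Type u} [Fintype V] [DecidableEq V] {G : SimpleGraph V} [DecidableRel G.Adj]
  {D d : ℕ} {T T' : PEPS G D d} {Δ : ℕ} {δ : ℝ} {A : Set V}

/-- A perturbed PEPS has singular values in `[δ - η, 1 + η]` at every vertex. -/
theorem IsPerturbation.hasBounds {η : ℝ} (hη : 0 ≤ η) (hηδ : η ≤ δ) (h : IsInjectivePEPS δ T)
    (hp : IsPerturbation A η T T') (v : V) : HasBounds ((δ - η) ^ 2) ((1 + η) ^ 2) (T' v) := by
  by_cases hv : v ∈ A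
  · exact (h v).hasBounds_of_norm_sub_le hη hηδ (hp.2 v hv)
  · rw [hp.1 v hv]
    refine ((h v).hasBounds (hη.trans hηδ)).mono ?_ ?_
    · exact pow_le_pow_left₀ (by linarith) (by linarith) 2
    · nlinarith

end Perturbation

/-- The threshold `ε_**`. The bound `(8 * 8 ^ Δ)⁻²` serves the layer peeling, whose constant it
absorbs into a square root of `ε`; the last bound makes loops decay at rate `c_0 + 1`. -/
def epsSmall (Δ D : ℕ) : ℝ :=
  min (epsStar Δ / 2) (min (loopScale Δ D) (min ((8 * 8 ^ Δ) ^ 2)⁻¹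
    ((Real.exp (-(cZero Δ + 1)) * ((D : ℝ) * D)⁻¹) ^ Δ / loopConst Δ D)))

theorem loopConst_pos (Δ : ℕ) {D : ℕ} (hD : 1 ≤ D) : 0 < loopConst Δ D := by
  have hD0 : (0 : ℝ) < D := by exact_mod_cast hD
  unfold loopConst; positivity

theorem epsSmall_pos {Δ D : ℕ} (hΔ : 2 ≤ Δ) (hD : 1 ≤ D) : 0 < epsSmall Δ D := by
  have hD0 : (0 : ℝ) < D := by exact_mod_cast hD
  refine lt_min (half_pos (epsStar_pos hΔ)) (lt_min (loopScale_pos hΔ hD) (lt_min ?_ ?_))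
  · positivity
  · exact div_pos (by positivity) (loopConst_pos Δ hD)

end
end BPLocality

open BPLocality

theorem theorem3 (Δ D : ℕ) (hΔ : 2 ≤ Δ) (hD : 1 ≤ D) :
    -- locality of the BP fixed points
    (∃ C : ℝ, 0 < C ∧
      ∀ (V : Type u) [Fintype V] [DecidableEq V] (G : SimpleGraph V) [DecidableRel G.Adj]
        (d : ℕ) (δ : ℝ) (T T' : PEPS G D d) (A : Finset V),
        (∀ v, G.degree v ≤ Δ) → 0 < δ → δ < 1 → deviation δ < epsStar Δ →
        IsInjectivePEPS δ T →
        IsPerturbation A ((epsStar Δ - deviation δ) / 4) T T' →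
        (∃! μ : Messages G D, IsFixedPoint T μ) ∧
        (∃! μ' : Messages G D, IsFixedPoint T' μ') ∧
        ∀ μ μ' : Messages G D, IsFixedPoint T μ → IsFixedPoint T' μ' →
          ∀ (e : G.Dart) (r : ℕ), (r : ℕ∞) ≤ setDist G {e.fst} A →
            traceNorm (μ' e - μ e) ≤ C * contractionConst Δ δ ^ r ∧
            C * contractionConst Δ δ ^ r ≤ C * Real.exp (-(r * invXiStar Δ δ))) ∧
    -- locality of expectation values
    (∃ εss : ℝ, 0 < εss ∧ εss < epsStar Δ ∧ εss ≤ loopScale Δ D ∧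
      (∃ c : ℝ, cZero Δ < c ∧
        ∀ (V : Type u) [Fintype V] [DecidableEq V] (G : SimpleGraph V) [DecidableRel G.Adj]
          (d : ℕ) (δ : ℝ) (T : PEPS G D d) (μ : Messages G D),
          (∀ v, G.degree v ≤ Δ) → 0 < δ → δ < 1 → deviation δ < εss →
          IsInjectivePEPS δ T → IsFixedPoint T μ → LoopDecay T μ c) ∧
      ∀ (c : ℝ) (b : ℕ), cZero Δ < c → ∃ C : ℝ, 0 < C ∧
        ∀ (V : Type u) [Fintype V] [DecidableEq V] (G : SimpleGraph V) [DecidableRel G.Adj]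
          (d : ℕ) (δ : ℝ) (T T' : PEPS G D d) (μ : Messages G D) (A B : Finset V),
          (∀ v, G.degree v ≤ Δ) → 0 < δ → δ < 1 → deviation δ < εss →
          IsInjectivePEPS δ T →
          IsPerturbation A ((epsStar Δ - deviation δ) / 4) T T' →
          IsFixedPoint T μ → LoopDecay T μ c → B.card ≤ b →
          stateVec T ≠ 0 ∧ stateVec T' ≠ 0 ∧
          ∀ (O : Matrix (B → Fin d) (B → Fin d) ℂ) (R : ℕ), (R : ℕ∞) ≤ setDist G A B →
            ‖expectation T' B O - expectation T B O‖
              ≤ C * ‖O‖ * Real.exp (-(R * invXiStarStar Δ δ c))) := by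
  have hΔ1 : 1 ≤ Δ := by omega
  constructor
  · refine ⟨2, two_pos, fun V _ _ G _ d δ T T' A hdeg h0 h1 hε hT hp => ?_⟩
    have hη0 : 0 ≤ (epsStar Δ - deviation δ) / 4 := by linarith
    have hηδ := slack_lt hΔ h0 h1
    have hb : ∀ v, HasBounds (δ ^ 2) 1 (T v) := fun v => (hT v).hasBounds h0.le
    have hb' := hp.hasBounds hη0 hηδ.le hT
    have hq := contractionConst_nonneg hΔ h0 h1
    refine ⟨existsUnique_isFixedPoint hD hΔ1 hdeg (by positivity) (by nlinarith) hb
        (contractionConst_lt_one hΔ h0 hε),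
      existsUnique_isFixedPoint hD hΔ1 hdeg (pow_pos (sub_pos.2 hηδ) 2) (by nlinarith) hb'
        (perturbed_contraction_lt_one hΔ h0 h1 hε rfl), fun μ μ' hμ hμ' e r hr => ⟨?_, ?_⟩⟩
    · have h := traceNorm_fixedPoint_sub_le hD hdeg (by positivity) (by nlinarith) hb hp.1 hμ hμ'
        r e hr
      have hc : 2 * (1 - δ ^ 2) / δ ^ 2 * ((Δ : ℝ) - 1) = contractionConst Δ δ := by
        unfold contractionConst; ring
      rwa [hc] at h
    · rw [exp_neg_mul_invXiStar hΔ h0 h1]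
      exact mul_le_mul_of_nonneg_left
        (pow_le_pow_left₀ hq (contractionConst_le hΔ h0 h1 hε) r) zero_le_two
  · refine ⟨epsSmall Δ D, epsSmall_pos hΔ hD,
      (min_le_left _ _).trans_lt (half_lt_self (epsStar_pos hΔ)),
      (min_le_right _ _).trans (min_le_left _ _), ⟨cZero Δ + 1, lt_add_one _, ?_⟩, ?_⟩
    · intro V _ _ G _ d δ T μ hdeg h0 h1 hε hT hμ
      refine loopDecay_of_isFixedPoint hD hdeg (deviation_pos h0 h1).le
        (fun v => (hT v).hasBounds h0.le) hμ (by linarith [cZero_pos hΔ]) ?_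
      have h2 := hε.le.trans ((min_le_right _ _).trans ((min_le_right _ _).trans
        (min_le_right _ _)))
      rw [le_div_iff₀ (loopConst_pos Δ hD)] at h2
      linarith
    · intro c b hc
      set K : ℝ := 8 * 8 ^ Δ with hK
      have h8 : (1 : ℝ) ≤ 8 ^ Δ := one_le_pow₀ (by norm_num)
      have hK8 : 8 ≤ K := by linarith
      set Cs : ℝ := 4 * Real.exp ((c - cZero Δ) / 2) with hCs
      set Cl : ℝ := 4 * K * (8 ^ Δ) ^ b with hCl
      have hCs0 : 0 < Cs := by positivity
      have hCl0 : 0 < Cl := by positivity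
      refine ⟨Cs + Cl, by positivity, fun V _ _ G _ d δ T T' μ A B hdeg h0 h1 hε hT hp _ _ hB => ?_⟩
      have hε0 := deviation_pos h0 h1
      have hε1 : deviation δ < epsStar Δ := hε.trans
        ((min_le_left _ _).trans_lt (half_lt_self (epsStar_pos hΔ)))
      have hKε : K ^ 2 * deviation δ ≤ 1 := by
        have h2 := hε.le.trans ((min_le_right _ _).trans ((min_le_right _ _).trans
          (min_le_left _ _)))
        rw [← one_div, le_div_iff₀ (by positivity)] at h2
        linarith
      have hη0 : 0 ≤ (epsStar Δ - deviation δ) / 4 := by linarith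
      have hηδ := slack_lt hΔ h0 h1
      have hb : ∀ v, HasBounds (δ ^ 2) 1 (T v) := fun v => (hT v).hasBounds h0.le
      have hb' := hp.hasBounds hη0 hηδ.le hT
      have hlo : 0 < δ ^ 2 := by positivity
      have hlo' := pow_pos (sub_pos.2 hηδ) 2
      refine ⟨stateVec_ne_zero hD hlo hb, stateVec_ne_zero hD hlo' hb', fun O R hR => ?_⟩
      have hO := norm_nonneg O
      obtain hR1 | ⟨j, rfl⟩ : R ≤ 1 ∨ ∃ j, R = j + 2 := by
        rcases Nat.lt_or_ge R 2 with h | h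
        · exact Or.inl (by omega)
        · exact Or.inr ⟨R - 2, by omega⟩
      · -- at distance at most one the trivial bound suffices
        have h2 : 4 ≤ Cs * Real.exp (-(R * invXiStarStar Δ δ c)) := by
          refine le_trans (le_of_eq ?_) (mul_le_mul_of_nonneg_left
            (exp_neg_le_exp_neg_mul_invXiStarStar c hc hR1) hCs0.le)
          rw [hCs, mul_assoc, ← Real.exp_add, add_neg_cancel, Real.exp_zero, mul_one]
        have h3 := Real.exp_pos (-(R * invXiStarStar Δ δ c))
        calc ‖expectation T' B O - expectation T B O‖ ≤ 2 * ‖O‖ + 2 * ‖O‖ :=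
              (norm_sub_le _ _).trans (add_le_add (norm_expectation_le hD hlo' hb' B O)
                (norm_expectation_le hD hlo hb B O))
          _ = 4 * ‖O‖ := by ring
          _ ≤ Cs * Real.exp (-(R * invXiStarStar Δ δ c)) * ‖O‖ :=
              mul_le_mul_of_nonneg_right h2 hO
          _ ≤ Cs * Real.exp (-(R * invXiStarStar Δ δ c)) * ‖O‖
              + Cl * Real.exp (-(R * invXiStarStar Δ δ c)) * ‖O‖ :=
              le_add_of_nonneg_right (by positivity)
          _ = _ := by ring
      · have hKε1 : K * deviation δ ≤ 1 / 8 := by nlinarith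
        have hKε2 : 8 * deviation δ * 8 ^ Δ = K * deviation δ := by rw [hK]; ring
        have h2 := norm_expectation_sub_le hD hdeg h0.ne' hb hp.1 hlo' hb' hε0.le
          (by nlinarith) (by rw [hKε2]; linarith) B O (j + 1) hR
        rw [hKε2] at h2
        have h3 := const_mul_pow_le_sqrt_pow (by linarith : 1 ≤ K) hε0.le hKε j
        have h4 := sqrt_pow_le_exp hΔ h0 h1 c (j + 2)
        have h5 : ((8 : ℝ) ^ Δ) ^ B.card ≤ (8 ^ Δ) ^ b := pow_le_pow_right₀ h8 hB
        have h6 := Real.exp_pos (-(((j + 2 : ℕ) : ℝ) * invXiStarStar Δ δ c))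
        calc ‖expectation T' B O - expectation T B O‖
            ≤ 4 * ‖O‖ * (K * deviation δ) ^ (j + 1) * (8 ^ Δ) ^ B.card := h2
          _ ≤ 4 * ‖O‖ * (K * Real.exp (-(((j + 2 : ℕ) : ℝ) * invXiStarStar Δ δ c)))
              * (8 ^ Δ) ^ b := by
              gcongr
              exact h3.trans (mul_le_mul_of_nonneg_left h4 (by linarith))
          _ = Cl * ‖O‖ * Real.exp (-(((j + 2 : ℕ) : ℝ) * invXiStarStar Δ δ c)) := by
              rw [hCl]; ring
          _ ≤ _ := by gcongr; linarith
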